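/- **Definitions.** Let $\Sigma$ be a finite alphabet and $d\in\mathbb N$. A function $f\colon\Sigma^*\to\mathbb Z$ is in $\mathbb Z\mathrm{Poly}_d$ if there are a finite monoid $M$, a morphism $\mu\colon\Sigma^*\to M$ and a map $\pi\colon M^{d+1}\to\mathbb Z$ such that for all $w\in\Sigma^*$ $$f(w)=\sum_{w=u_1\cdots u_{d+1}}\pi(\mu(u_1),\dots,\mu(u_{d+1})),$$ the sum ranging over all factorizations of $w$ into $d+1$ possibly empty words; $f\in\mathbb N\mathrm{Poly}_d$ if $\pi$ can be chosen with values in $\mathbb N$. The function $f$ is commutative if $f(w)$ does not change when the letters of $w$ are permuted. A pumping pattern $q\colon\mathbb N^k\to\Sigma^*$ is a map $q(x_1,\dots,x_k)=\alpha_0u_1^{x_1}\alpha_1\cdots u_k^{x_k}\alpha_k$ with words $\alpha_i,u_i\in\Sigma^*$. A natural binomial polynomial is an $\mathbb N$-linear combination of products $\prod_j\frac{(X_j-\ell_j)(X_j-\ell_j-1)\cdots(X_j-\ell_j-r_j+1)}{r_j!}$ with $\ell_j,r_j\in\mathbb N$. A polynomial $P\in\mathbb Q[X_1,\dots,X_k]$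 is strongly natural if for every partial assignment of values in $\mathbb N$ to its indeterminates, the resulting polynomial in the remaining indeterminates is a natural binomial polynomial. The function $f$ is $(k,\mathbb N)$-combinatorial if there is an $\omega\in\mathbb N_{\ge1}$ such that for every pumping pattern $q\colon\mathbb N^k\to\Sigma^*$ there is a strongly natural binomial polynomial $P\in\mathbb Q[X_1,\dots,X_k]$ with $$f(q(\omega x_1,\dots,\omega x_k))=P(x_1-1,\dots,x_k-1)\qquad\text{for all }x_1,\dots,x_k\ge1.$$ **Theorem.** Let $k,d\in\mathbb N$, and let $f\in\mathbb Z\mathrm{Poly}_d$ be commutative over an alphabet of size $k$. Then $f$ is $(k,\mathbb N)$-combinatorial if and only if $f\in\mathbb N\mathrm{Poly}_d$. Furthermore the properties are decidable and the conversions effective, in the following sense. Let commutative functions $f\in\mathbb Z\mathrm{Poly}_d$ over the alphabet $\{0,\dots,k-1\}$ be given by $k$, $d$ and tables for a finite monoid $M$, for the images under $\mu$ of the letters, and for $\pi\colon M^{d+1}\to\mathbb Z$. There are total computable functions that 1. decide, on every such input, whether $f$ is $(k,\mathbb N)$-combinatorial, equivalently whether $f\in\mathbb N\mathrm{Poly}_d$;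 2. on every such input for which $f$ is $(k,\mathbb N)$-combinatorial, return a finite monoid, images of the letters and a map $\pi$ on $(d+1)$-tuples with values in $\mathbb N$ (again as tables) that present $f$ as a member of $\mathbb N\mathrm{Poly}_d$; 3. on every such input for which $f\in\mathbb N\mathrm{Poly}_d$, return an $\omega\ge1$, and from the input together with any pumping pattern $q\colon\mathbb N^k\to\{0,\dots,k-1\}^*$ return (written as a natural binomial polynomial) a strongly natural binomial polynomial $P$ satisfying the displayed equation for this $\omega$ and $q$. -/

import Mathlib

namespace NPolyreg

/-- A function on words is commutative if permuting the letters of its input does not change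
its value. -/
def IsCommutative {α X : Type*} (f : List α → X) : Prop :=
  ∀ u v : List α, u.Perm v → f u = f v

/-- A word has finitely many factorizations `w = u₁ ⋯ uₙ`, empty factors being allowed. -/
theorem finite_factorizations {α : Type*} (n : ℕ) (w : List α) :
    {u : Fin n → List α | (List.ofFn u).flatten = w}.Finite := by
  have h : {u : Fin n → List α | ∀ i, u i ∈ {v | v ∈ w.sublists}}.Finite :=
    Set.Finite.pi' fun _ => w.sublists.finite_toSet
  refine h.subset fun u hu i => ?_
  have hw : (List.ofFn u).flatten = w := hu
  show u i ∈ w.sublists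
  rw [List.mem_sublists, ← hw]
  exact List.sublist_flatten_of_mem (List.mem_ofFn.2 ⟨i, rfl⟩)

/-- The sum `∑_{w = u₀ ⋯ u_d} π (μ u₀, …, μ u_d)` over all factorizations of `w` into `d + 1`
(possibly empty) factors. -/
noncomputable def factorizationSum {α M : Type*} [Monoid M] {d : ℕ} (μ : FreeMonoid α →* M)
    (π : (Fin (d + 1) → M) → ℤ) (w : List α) : ℤ :=
  ∑ u ∈ (finite_factorizations (d + 1) w).toFinset, π fun i => μ (FreeMonoid.ofList (u i))

/-- The `ℤ`-polyregular functions of degree at most `d`. -/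
def ZPoly {α : Type*} (d : ℕ) : Set (List α → ℤ) :=
  {f | ∃ (M : Type) (_ : Monoid M) (_ : Finite M) (μ : FreeMonoid α →* M)
      (π : (Fin (d + 1) → M) → ℤ), ∀ w, f w = factorizationSum μ π w}

/-- The `ℕ`-polyregular functions of degree at most `d`, as functions with values in `ℤ`. -/
def NPoly {α : Type*} (d : ℕ) : Set (List α → ℤ) :=
  {f | ∃ (M : Type) (_ : Monoid M) (_ : Finite M) (μ : FreeMonoid α →* M)
      (π : (Fin (d + 1) → M) → ℕ), ∀ w, f w = factorizationSum μ (fun m => (π m : ℤ)) w}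

/-- A pumping pattern `α₀ u₁^{X₁} α₁ ⋯ u_p^{X_p} α_p`: `head` is `α₀`, the `block`s are the
`uᵢ` and the `tail`s are `α₁, …, α_p`. -/
structure PumpingPattern (α : Type*) (p : ℕ) where
  head : List α
  block : Fin p → List α
  tail : Fin p → List α

/-- The word obtained from a pumping pattern by giving values to its exponents. -/
def PumpingPattern.word {α : Type*} {p : ℕ} (q : PumpingPattern α p) (x : Fin p → ℕ) : List α :=
  q.head ++ (List.ofFn fun i => (List.replicate (x i) (q.block i)).flatten ++ q.tail i).flatten

/-- The binomial monomial `(X_j - ℓ)(X_j - ℓ - 1) ⋯ (X_j - ℓ - r + 1) / r!`, as a polynomial. -/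
noncomputable def binomialMonomial {σ : Type*} (j : σ) (l r : ℕ) : MvPolynomial σ ℚ :=
  MvPolynomial.C ((r.factorial : ℚ)⁻¹) *
    ∏ i ∈ Finset.range r, (MvPolynomial.X j - MvPolynomial.C ((l : ℚ) + i))

/-- Natural binomial polynomials: the `ℕ`-linear combinations of products of binomial monomials,
one for every indeterminate. -/
def IsNaturalBinomial {σ : Type*} [Fintype σ] (P : MvPolynomial σ ℚ) : Prop :=
  ∃ (n : ℕ) (c : Fin n → ℕ) (l r : Fin n → σ → ℕ),
    P = ∑ i, MvPolynomial.C (c i : ℚ) * ∏ j, binomialMonomial j (l i j) (r i j)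

/-- The restriction of a polynomial along a partial valuation `ν` of its indeterminates by natural
numbers: a polynomial in the indeterminates where `ν` is undefined. -/
noncomputable def restrict {σ : Type*} (ν : σ → Option ℕ) (P : MvPolynomial σ ℚ) :
    MvPolynomial {j : σ // ν j = none} ℚ :=
  MvPolynomial.aeval
    (fun j => match h : ν j with
      | some n => MvPolynomial.C (n : ℚ)
      | none => MvPolynomial.X ⟨j, h⟩) P

/-- Strongly natural binomial polynomials: all restrictions along partial valuations are natural
binomial polynomials. -/
def IsStronglyNaturalBinomial {σ : Type*} [Fintype σ] (P : MvPolynomial σ ℚ) : Prop :=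
  ∀ ν : σ → Option ℕ, IsNaturalBinomial (restrict ν P)

/-- `P` is a strongly natural binomial polynomial that describes the pumping of `f` along `q` with
period `ω`: `f (q (ω x₁, …, ω x_p)) = P (x₁ - 1, …, x_p - 1)` for all integers
`x₁, …, x_p ≥ 1`. -/
def IsPumpingPolynomial {α : Type*} {p : ℕ} (f : List α → ℤ) (ω : ℕ) (q : PumpingPattern α p)
    (P : MvPolynomial (Fin p) ℚ) : Prop :=
  IsStronglyNaturalBinomial P ∧
    ∀ x : Fin p → ℕ, (∀ i, 1 ≤ x i) →
      (f (q.word fun i => ω * x i) : ℚ) = MvPolynomial.eval (fun i => (x i : ℚ) - 1) P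

/-- `(p, ℕ)`-combinatorial functions. -/
def IsCombinatorial {α : Type*} (p : ℕ) (f : List α → ℤ) : Prop :=
  ∃ ω : ℕ, 1 ≤ ω ∧ ∀ q : PumpingPattern α p, ∃ P : MvPolynomial (Fin p) ℚ,
    IsPumpingPolynomial f ω q P

/-- Finite data from which a `ℤ`-polyregular function over the alphabet `Fin k` can be read:
the size of a finite monoid with elements `0, …, size - 1`, its unit, its multiplication table,
the images of the letters, and the table of a production function. -/
structure Presentation where
  size : ℕ
  one : ℕ
  mul : List ℕ
  letter : List ℕ
  production : List ℤ

/-- A presentation as a tuple of numbers and lists of numbers. -/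
def Presentation.equivTuple : Presentation ≃ ℕ × ℕ × List ℕ × List ℕ × List ℤ where
  toFun c := (c.size, c.one, c.mul, c.letter, c.production)
  invFun t := ⟨t.1, t.2.1, t.2.2.1, t.2.2.2.1, t.2.2.2.2⟩
  left_inv _ := rfl
  right_inv _ := rfl

instance : Primcodable Presentation :=
  Primcodable.ofEquiv _ Presentation.equivTuple

/-- `c` presents `f` as a `ℤ`-polyregular function of degree at most `d` over `Fin k`. The product
of `a` and `b` stands at place `a + size * b` of the multiplication table, and the value of the
production function at `(m₀, …, m_d)` at place `∑ i, mᵢ * size ^ i` of its table. -/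
def Presentation.Presents (c : Presentation) (k d : ℕ) (f : List (Fin k) → ℤ) : Prop :=
  ∃ (M : Type) (_ : Monoid M) (e : M ≃ Fin c.size) (μ : FreeMonoid (Fin k) →* M)
    (π : (Fin (d + 1) → M) → ℤ),
    c.one = (e 1 : ℕ) ∧
    (∀ a b : M, c.mul[(e a : ℕ) + c.size * (e b : ℕ)]? = some (e (a * b) : ℕ)) ∧
    (∀ a : Fin k, c.letter[(a : ℕ)]? = some (e (μ (FreeMonoid.of a)) : ℕ)) ∧
    (∀ m : Fin (d + 1) → M,
      c.production[∑ i, (e (m i) : ℕ) * c.size ^ (i : ℕ)]? = some (π m)) ∧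
    ∀ w, f w = factorizationSum μ π w

/-- The production function of the presentation takes values in `ℕ`, so that the presented function
is presented as an `ℕ`-polyregular function. -/
def Presentation.IsNatural (c : Presentation) : Prop :=
  ∀ z ∈ c.production, 0 ≤ z

/-- A pumping pattern over `Fin k` as a list of lists of numbers. -/
def PumpingPattern.code {k p : ℕ} (q : PumpingPattern (Fin k) p) :
    List ℕ × List (List ℕ × List ℕ) :=
  (q.head.map Fin.val,
    List.ofFn fun i => ((q.block i).map Fin.val, (q.tail i).map Fin.val))

/-- The natural binomial polynomial written down by a list of summands: the entry
`(n, [(l₀, r₀), (l₁, r₁), …])` stands for `n ∏_j binomialMonomial j l_j r_j`, and missing factors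
are equal to `1`. -/
noncomputable def polynomialOfList (k : ℕ) (E : List (ℕ × List (ℕ × ℕ))) :
    MvPolynomial (Fin k) ℚ :=
  (E.map fun t => MvPolynomial.C (t.1 : ℚ) *
    ∏ j : Fin k, binomialMonomial j (t.2.getD j (0, 0)).1 (t.2.getD j (0, 0)).2).sum

end NPolyreg

/-! A commutative `f` is a function `F` of the letter counts `n ∈ ℕ^k`. The proof studies the mixed
differences of `F` whose steps add `ω` copies of a letter.

Since powers in a finite monoid are ultimately periodic, differences along `d + 1` letters vanish
once the counts of these letters are large (`hasDegreeLE_of_commutative`). Thus, in its large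
coordinates, `F` is a polynomial of degree at most `d` on each residue class, and Newton's formula
holds (`HasDegreeLE.eq_sum`). The pivot is the property `NonnegDiff`: for some `ℓ`, every mixed
difference along letters with counts at least `ℓ` is nonnegative. Its existence is equivalent to
both sides of the theorem.

From `ℕPoly`: pumping a word inside a factorization sum with values in `ℕ` only adds nonnegative
terms, and the same holds for the differences (`factorizationSum_mem_positive`,
`nonnegDiff_of_commutative`).

To `ℕPoly`: expand `F` by Newton's formula from the truncated letter counts. The terms correspond to
choices of at most `d` marked positions of the word, hence to factorizations into `d + 1` factors,
and the coefficients depend only on data read by a finite monoid (`sum_wordValue`,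
`eq_sum_codeValue`).

To combinatorial: along a pumping pattern the Newton coefficients are nonnegative mixed differences
(`isPumpingPolynomial_of_nonnegDiff`).

From combinatorial: if no `ℓ` works, a compactness argument gives a ray on which some mixed
difference is negative, with nonpositive higher differences at its origin (`exists_nonnegDiff`). A
natural binomial polynomial cannot describe such a ray, because its own differences are eventually
nonnegative (`IsCombinatorial.not_negativeRay`).

Effectivity: a threshold `ℓ` is verified on a finite box (`nonnegDiff_of_box`), and a negative ray
by finitely many values at its origin. With failures of the degree bound as a third kind of
evidence, every input has a certificate (`exists_certificate`). Unbounded search finds one, and all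
three algorithms use its threshold. -/

namespace NPolyreg

/-! ### Mixed differences and Newton's formula. -/

section MixedDifferences

variable {A G : Type*} [AddCommMonoid A] [AddCommGroup G]

/-- The iterated forward difference of a function along a list of steps. -/
def mixedDiff : List A → (A → G) → A → G
  | [], f => f
  | z :: zs, f => mixedDiff zs (fwdDiff z f)

@[simp] theorem mixedDiff_nil (f : A → G) : mixedDiff [] f = f := rfl

theorem mixedDiff_cons (z : A) (zs : List A) (f : A → G) :
    mixedDiff (z :: zs) f = mixedDiff zs (fwdDiff z f) := rfl

theorem mixedDiff_append (xs ys : List A) (f : A → G) :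
    mixedDiff (xs ++ ys) f = mixedDiff ys (mixedDiff xs f) := by
  induction xs generalizing f with
  | nil => rfl
  | cons x xs ih => exact ih _

theorem mixedDiff_add (zs : List A) (f g : A → G) :
    mixedDiff zs (f + g) = mixedDiff zs f + mixedDiff zs g := by
  induction zs generalizing f g with
  | nil => rfl
  | cons z zs ih => rw [mixedDiff_cons, fwdDiff_add, ih]; rfl

theorem mixedDiff_sub (zs : List A) (f g : A → G) :
    mixedDiff zs (f - g) = mixedDiff zs f - mixedDiff zs g := by
  rw [eq_sub_iff_add_eq, ← mixedDiff_add, sub_add_cancel]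

theorem mixedDiff_translate (zs : List A) (f : A → G) (b : A) :
    mixedDiff zs (fun a => f (a + b)) = fun a => mixedDiff zs f (a + b) := by
  induction zs generalizing f with
  | nil => rfl
  | cons z zs ih =>
    rw [mixedDiff_cons, mixedDiff_cons, ← ih]
    congr 1
    funext a
    simp only [fwdDiff, add_right_comm]

theorem mixedDiff_cons_apply (z : A) (zs : List A) (f : A → G) (a : A) :
    mixedDiff (z :: zs) f a = mixedDiff zs f (a + z) - mixedDiff zs f a := by
  have h : fwdDiff z f = (fun a => f (a + z)) - f := rfl
  rw [mixedDiff_cons, h, mixedDiff_sub, mixedDiff_translate]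
  rfl

theorem mixedDiff_perm {xs ys : List A} (h : xs.Perm ys) (f : A → G) :
    mixedDiff xs f = mixedDiff ys f := by
  induction h generalizing f with
  | nil => rfl
  | cons x _ ih => exact ih _
  | swap x y l =>
    have : fwdDiff x (fwdDiff y f) = fwdDiff y (fwdDiff x f) := by
      funext a
      simp only [fwdDiff, add_right_comm a x y]
      abel
    rw [mixedDiff_cons, mixedDiff_cons, mixedDiff_cons, mixedDiff_cons, this]
  | trans _ _ ih₁ ih₂ => rw [ih₁, ih₂]

theorem mixedDiff_replicate (z : A) (n : ℕ) (f : A → G) :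
    mixedDiff (List.replicate n z) f = (fwdDiff z)^[n] f := by
  induction n generalizing f with
  | zero => rfl
  | succ n ih => rw [List.replicate_succ, mixedDiff_cons, ih, Function.iterate_succ_apply]

theorem mixedDiff_zero_step (zs : List A) (f : A → G) (a : A) :
    mixedDiff (0 :: zs) f a = 0 := by
  rw [mixedDiff_cons_apply, add_zero, sub_self]

/-- Telescoping through `a + y`. Differences along words thus become sums, without signs, of
differences along letters. -/
theorem mixedDiff_add_step (x y : A) (zs : List A) (f : A → G) (a : A) :
    mixedDiff ((x + y) :: zs) f a = mixedDiff (x :: zs) f (a + y) + mixedDiff (y :: zs) f a := by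
  simp only [mixedDiff_cons_apply]
  rw [add_assoc a y x, add_comm y x]
  abel

/-- Differences commute with affine changes of variable. It serves to restrict a function to a ray,
or to the points reached by a pumping pattern. -/
theorem mixedDiff_map {B H : Type*} [AddCommMonoid B] [AddCommGroup H] (φ : G →+ H)
    (ψ : B →+ A) (b : A) (zs : List B) (f : A → G) (y : B) :
    mixedDiff zs (fun y => φ (f (b + ψ y))) y = φ (mixedDiff (zs.map ψ) f (b + ψ y)) := by
  induction zs generalizing f y with
  | nil => rfl
  | cons z zs ih =>
    rw [mixedDiff_cons, List.map_cons, mixedDiff_cons, ← ih]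
    congr 1
    funext a
    simp only [fwdDiff, map_add, map_sub, add_assoc]

/-- Newton's formula along one step. -/
theorem eq_sum_choose_smul_of_vanish (f : A → G) (z b : A) (d y : ℕ)
    (h : ∀ n, d < n → (fwdDiff z)^[n] f b = 0) :
    f (b + y • z) = ∑ j : Fin (d + 1), y.choose j • (fwdDiff z)^[(j : ℕ)] f b := by
  rw [shift_eq_sum_fwdDiff_iter z f y b, Fin.sum_univ_eq_sum_range
    (fun j => y.choose j • (fwdDiff z)^[j] f b) (d + 1)]
  -- For `y ≤ d` the added terms have zero binomial coefficients; for `d ≤ y` the dropped terms have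
  -- vanishing differences.
  rcases le_total y d with hy | hy
  · refine Finset.sum_subset (Finset.range_mono (by omega)) fun j _ hj => ?_
    rw [Nat.choose_eq_zero_of_lt (by simpa using hj), zero_smul]
  · refine (Finset.sum_subset (Finset.range_mono (by omega)) fun j _ hj => ?_).symm
    rw [h j (by simpa using hj), smul_zero]

/-- Newton's formula along several steps. -/
theorem eq_sum_prod_choose_smul_of_vanish (d : ℕ) : ∀ (k : ℕ) (f : A → G) (b : A) (z : Fin k → A),
    (∀ (y : Fin k → ℕ) (L : List A), (∀ x ∈ L, x ∈ Set.range z) → d < L.length →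
      mixedDiff L f (b + ∑ i, y i • z i) = 0) →
    ∀ y : Fin k → ℕ, f (b + ∑ i, y i • z i) = ∑ s : Fin k → Fin (d + 1),
      (∏ i, (y i).choose (s i)) •
        mixedDiff ((List.finRange k).flatMap fun i => List.replicate (s i) (z i)) f b
  | 0, f, b, z, _, y => by simp
  | k + 1, f, b, z, h, y => by
    have hrep : ∀ (n : ℕ) (x : A), x ∈ List.replicate n (z 0) → x ∈ Set.range z := fun n x hx =>
      ⟨0, (List.eq_of_mem_replicate hx).symm⟩
    have e0 : b + ∑ i, y i • z i = (b + ∑ i : Fin k, y i.succ • z i.succ) + y 0 • z 0 := by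
      rw [Fin.sum_univ_succ]; abel
    have hcons : ∀ y' : Fin k → ℕ, b + ∑ i : Fin k, y' i • z i.succ =
        b + ∑ i, (Fin.cons 0 y' : Fin (k + 1) → ℕ) i • z i := fun y' => by
      simp [Fin.sum_univ_succ]
    rw [e0, eq_sum_choose_smul_of_vanish f (z 0) _ d (y 0), ← (Fin.consEquiv _).sum_comp,
      Fintype.sum_prod_type]
    · refine Finset.sum_congr rfl fun j _ => ?_
      rw [eq_sum_prod_choose_smul_of_vanish d k ((fwdDiff (z 0))^[(j : ℕ)] f) b (fun i => z i.succ),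
        Finset.smul_sum]
      · refine Finset.sum_congr rfl fun s _ => ?_
        rw [Fin.prod_univ_succ, mul_smul, List.finRange_succ, List.flatMap_cons, mixedDiff_append,
          List.flatMap_map, mixedDiff_replicate]
        simp
      · intro y' L hL hd
        rw [← mixedDiff_replicate, ← mixedDiff_append, hcons]
        refine h _ _ (fun x hx => ?_) (by simp; omega)
        rcases List.mem_append.1 hx with hx | hx
        · exact hrep _ _ hx
        · obtain ⟨i, rfl⟩ := hL x hx
          exact ⟨i.succ, rfl⟩
    · intro n hn
      rw [← mixedDiff_replicate, hcons]
      exact h _ _ (hrep _) (by simpa using hn)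

end MixedDifferences

end NPolyreg

namespace NPolyreg

/-! ### Letter counts, and differences along letters and words. -/

section WordSteps

variable {α : Type*} [DecidableEq α]

/-- The number of occurrences of every letter in a word. -/
def parikh (w : List α) : α → ℕ := fun i => w.count i

@[simp] theorem parikh_nil : parikh ([] : List α) = 0 := by
  funext i; simp [parikh]

@[simp] theorem parikh_append (u v : List α) : parikh (u ++ v) = parikh u + parikh v := by
  funext i; simp [parikh]

theorem parikh_cons (a : α) (v : List α) : parikh (a :: v) = parikh [a] + parikh v := by
  rw [← parikh_append]; rfl

theorem parikh_flatten (L : List (List α)) : parikh L.flatten = (L.map parikh).sum := by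
  induction L with
  | nil => simp
  | cons u L ih => simp [ih]

theorem parikh_replicate_flatten (n : ℕ) (u : List α) :
    parikh (List.replicate n u).flatten = n • parikh u := by
  simp [parikh_flatten]

theorem one_le_parikh {w : List α} {i : α} (h : i ∈ w) : 1 ≤ parikh w i :=
  List.count_pos_iff.2 h

theorem parikh_eq_iff_perm {u v : List α} : parikh u = parikh v ↔ u.Perm v := by
  rw [List.perm_iff_count]
  exact funext_iff

/-- The step that adds `ω` copies of a word. -/
def wordStep (ω : ℕ) (z : List α) : α → ℕ := ω • parikh z

@[simp] theorem wordStep_nil (ω : ℕ) : wordStep ω ([] : List α) = 0 := by simp [wordStep]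

theorem wordStep_append (ω : ℕ) (u v : List α) :
    wordStep ω (u ++ v) = wordStep ω u + wordStep ω v := by simp [wordStep]

theorem wordStep_cons (ω : ℕ) (a : α) (v : List α) :
    wordStep ω (a :: v) = wordStep ω [a] + wordStep ω v := wordStep_append ω [a] v

theorem wordStep_singleton (ω : ℕ) (a i : α) : wordStep ω [a] i = if a = i then ω else 0 := by
  by_cases h : a = i <;> simp [wordStep, parikh, h]

/-- From letter counts `ℓ` on, the mixed differences of `F` with period `ω` along at least `m`
letters lie in `S`. -/
def DiffMem (S : AddSubmonoid ℤ) (ω ℓ m : ℕ) (F : (α → ℕ) → ℤ) : Prop :=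
  ∀ (n : α → ℕ) (is : List α), m ≤ is.length → (∀ i ∈ is, ℓ ≤ n i) →
    mixedDiff (is.map fun i => wordStep ω [i]) F n ∈ S

theorem DiffMem.mono {S : AddSubmonoid ℤ} {ω ℓ ℓ' m : ℕ} {F : (α → ℕ) → ℤ}
    (h : DiffMem S ω ℓ m F) (hl : ℓ ≤ ℓ') : DiffMem S ω ℓ' m F :=
  fun n is hm hi => h n is hm fun i hi' => hl.trans (hi i hi')

/-- `mixedDiff_add_step` peels the letters off the words one by one, and every peeled letter moves
to `is`. The base points only grow, so the bounds by `ℓ` persist. Only sums and zero occur, hence a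
submonoid `S` suffices and one proof serves both vanishing and nonnegativity. -/
theorem DiffMem.words_append_letters {S : AddSubmonoid ℤ} {ω ℓ m : ℕ} {F : (α → ℕ) → ℤ}
    (h : DiffMem S ω ℓ m F) (zs : List (List α)) : ∀ (is : List α) (n : α → ℕ),
      m ≤ zs.length + is.length → (∀ z ∈ zs, ∀ i ∈ z, ℓ ≤ n i) → (∀ i ∈ is, ℓ ≤ n i) →
      mixedDiff (zs.map (wordStep ω) ++ is.map fun i => wordStep ω [i]) F n ∈ S := by
  induction zs with
  | nil => exact fun is n hm _ hi => h n is (by simpa using hm) hi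
  | cons z zs ihzs =>
    induction z with
    | nil =>
      intro is n _ _ _
      rw [List.map_cons, wordStep_nil, List.cons_append, mixedDiff_zero_step]
      exact S.zero_mem
    | cons c z ihz =>
      intro is n hm hz hi
      have hc : ℓ ≤ n c := hz (c :: z) List.mem_cons_self c List.mem_cons_self
      rw [List.map_cons, wordStep_cons, List.cons_append, mixedDiff_add_step]
      refine S.add_mem ?_ ?_
      · have hp : (wordStep ω [c] :: (zs.map (wordStep ω) ++ is.map fun i => wordStep ω [i])).Perm
            (zs.map (wordStep ω) ++ (c :: is).map fun i => wordStep ω [i]) := by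
          rw [List.map_cons]
          exact List.perm_middle.symm
        rw [mixedDiff_perm hp]
        refine ihzs (c :: is) _ (by simp at hm ⊢; omega) (fun z' hz' i hi' => ?_) fun i hi' => ?_
        · exact (hz z' (List.mem_cons_of_mem _ hz') i hi').trans (by simp)
        · rcases List.mem_cons.1 hi' with rfl | hi'
          · exact hc.trans (by simp)
          · exact (hi i hi').trans (by simp)
      · refine ihz is n hm (fun z' hz' i hi' => ?_) hi
        rcases List.mem_cons.1 hz' with rfl | hz'
        · exact hz _ List.mem_cons_self i (List.mem_cons_of_mem _ hi')
        · exact hz z' (List.mem_cons_of_mem _ hz') i hi'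

theorem DiffMem.words {S : AddSubmonoid ℤ} {ω ℓ m : ℕ} {F : (α → ℕ) → ℤ}
    (h : DiffMem S ω ℓ m F) (zs : List (List α)) (n : α → ℕ) (hm : m ≤ zs.length)
    (hz : ∀ z ∈ zs, ∀ i ∈ z, ℓ ≤ n i) : mixedDiff (zs.map (wordStep ω)) F n ∈ S := by
  simpa using h.words_append_letters zs [] n (by simpa using hm) hz (by simp)

/-- The functions that have degree at most `d` in the classes modulo `ω`, from letter counts `T`
on. -/
abbrev HasDegreeLE (ω T d : ℕ) (F : (α → ℕ) → ℤ) : Prop := DiffMem ⊥ ω T (d + 1) F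

/-- The functions with nonnegative mixed differences with period `ω`, from letter counts `ℓ`
on. -/
abbrev NonnegDiff (ω ℓ : ℕ) (F : (α → ℕ) → ℤ) : Prop := DiffMem (AddSubmonoid.nonneg ℤ) ω ℓ 0 F

/-- A difference along a longer list is a difference of two values along a shorter one. -/
theorem hasDegreeLE_of_length_eq {ω T d : ℕ} {F : (α → ℕ) → ℤ}
    (h : ∀ (n : α → ℕ) (is : List α), is.length = d + 1 → (∀ i ∈ is, T ≤ n i) →
      mixedDiff (is.map fun i => wordStep ω [i]) F n = 0) : HasDegreeLE ω T d F := by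
  intro n is
  induction is generalizing n with
  | nil => intro hm; simp at hm
  | cons i is ih =>
    intro hm hi
    rcases hm.eq_or_lt with hm | hm
    · exact h n _ hm.symm hi
    · have hm' : d + 1 ≤ is.length := by simp at hm; omega
      have hi' : ∀ j ∈ is, T ≤ n j := fun j hj => hi j (List.mem_cons_of_mem _ hj)
      have h1 := ih n hm' hi'
      have h2 := ih (n + wordStep ω [i]) hm' fun j hj => (hi' j hj).trans (by simp)
      rw [AddSubmonoid.mem_bot] at h1 h2 ⊢
      rw [List.map_cons, mixedDiff_cons_apply, h1, h2, sub_zero]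

/-- Nonnegativity of the mixed differences can be checked on a box. -/
theorem nonnegDiff_of_box [Fintype α] {ω ℓ d : ℕ} {F : (α → ℕ) → ℤ} (hω : 1 ≤ ω)
    (hF : HasDegreeLE ω ℓ d F)
    (h : ∀ (n : α → ℕ) (is : List α), (∀ i, n i < ℓ + ω) → is.length ≤ d → (∀ i ∈ is, ℓ ≤ n i) →
      0 ≤ mixedDiff (is.map fun i => wordStep ω [i]) F n) : NonnegDiff ω ℓ F := by
  have key : ∀ (s : ℕ) (n : α → ℕ), ∑ i, n i = s → ∀ is : List α, (∀ i ∈ is, ℓ ≤ n i) →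
      0 ≤ mixedDiff (is.map fun i => wordStep ω [i]) F n := by
    intro s
    induction s using Nat.strong_induction_on with
    | _ s ih =>
      intro n hs is hi
      by_cases hbox : ∀ i, n i < ℓ + ω
      · rcases le_or_gt is.length d with hd | hd
        · exact h n is hbox hd hi
        · exact (AddSubmonoid.mem_bot.1 (hF n is hd hi)).ge
      · push Not at hbox
        obtain ⟨i, hni⟩ := hbox
        -- Outside the box one step back in the direction `i` stays above `ℓ`. The difference at `n`
        -- is the one at `n'` plus the one at `n'` with the extra letter `i`, and both are
        -- nonnegative by induction on the sum of the coordinates. The list may grow here, so the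
        -- induction treats all lists at once.
        set n' : α → ℕ := n - wordStep ω [i] with hn'
        have hle : wordStep ω [i] ≤ n := fun j => by
          rw [wordStep_singleton]; split_ifs with hij
          · subst hij; exact (Nat.le_add_left _ _).trans hni
          · exact Nat.zero_le _
        have hnn : n' + wordStep ω [i] = n := tsub_add_cancel_of_le hle
        have hlt : ∑ j, n' j < s := by
          rw [← hs]
          refine Finset.sum_lt_sum (fun j _ => by simp [hn']) ⟨i, Finset.mem_univ _, ?_⟩
          have : n' i = n i - ω := by simp [hn', wordStep_singleton]
          rw [this]
          omega
        have hi' : ∀ j ∈ is, ℓ ≤ n' j := fun j hj => by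
          have := hi j hj
          simp only [hn', Pi.sub_apply, wordStep_singleton]
          split_ifs with hij
          · subst hij; omega
          · omega
        have hii : ℓ ≤ n' i := by
          simp only [hn', Pi.sub_apply, wordStep_singleton, if_true]; omega
        have h1 := ih _ hlt n' rfl is hi'
        have h2 := ih _ hlt n' rfl (i :: is) fun j hj => by
          rcases List.mem_cons.1 hj with rfl | hj
          · exact hii
          · exact hi' j hj
        rw [List.map_cons, mixedDiff_cons_apply, hnn] at h2
        linarith
  exact fun n is _ hi => key _ n rfl is hi

/-- Newton's formula for a function of bounded degree. -/
theorem HasDegreeLE.eq_sum {ω T d k : ℕ} {F : (α → ℕ) → ℤ} (hF : HasDegreeLE ω T d F)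
    (b : α → ℕ) (z : Fin k → List α) (hb : ∀ i, ∀ c ∈ z i, T ≤ b c) (y : Fin k → ℕ) :
    F (b + ∑ i, y i • wordStep ω (z i)) = ∑ s : Fin k → Fin (d + 1),
      (∏ i, (y i).choose (s i)) • mixedDiff
        (((List.finRange k).flatMap fun i => List.replicate (s i) (z i)).map (wordStep ω)) F b := by
  rw [eq_sum_prod_choose_smul_of_vanish d k F b fun i => wordStep ω (z i)]
  · simp [List.map_flatMap]
  · intro y L hL hd
    obtain ⟨L', rfl⟩ : L ∈ Set.range (List.map fun i => wordStep ω (z i)) := by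
      rw [Set.range_list_map]
      exact hL
    have : (L'.map fun i => wordStep ω (z i)) = (L'.map z).map (wordStep ω) := by
      rw [List.map_map]; rfl
    rw [this]
    refine AddSubmonoid.mem_bot.1 (hF.words _ _ (by simpa using hd) fun z' hz' i hi => ?_)
    obtain ⟨x, _, rfl⟩ := List.mem_map.1 hz'
    exact (hb _ i hi).trans (by simp)

end WordSteps

/-! ### Polynomials in the binomial basis. -/

section Polynomials

open MvPolynomial

variable {σ ι : Type*} [Fintype σ] [Fintype ι]

/-- The polynomial with the coefficients `c` in the basis of products of binomial coefficients. -/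
noncomputable def binomialSum (c : ι → ℕ) (r : ι → σ → ℕ) : MvPolynomial σ ℚ :=
  ∑ i, C (c i : ℚ) * ∏ j, binomialMonomial j 0 (r i j)

theorem eval_binomialMonomial_zero {σ : Type*} (y : σ → ℚ) (j : σ) (r n : ℕ) (h : y j = n) :
    eval y (binomialMonomial j 0 r) = (n.choose r : ℚ) := by
  have hp : ∏ i ∈ Finset.range r, ((n : ℚ) - i) = (n.descFactorial r : ℚ) := by
    induction r with
    | zero => simp
    | succ r ih =>
      rw [Finset.prod_range_succ, ih, Nat.descFactorial_succ]
      rcases le_or_gt r n with hr | hr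
      · push_cast [Nat.cast_sub hr]; ring
      · simp [Nat.descFactorial_eq_zero_iff_lt.2 hr]
  have hr : (r.factorial : ℚ) ≠ 0 := by positivity
  have hc : (n.descFactorial r : ℚ) = r.factorial * n.choose r := by
    rw [Nat.descFactorial_eq_factorial_mul_choose]; push_cast; ring
  simp only [binomialMonomial, map_mul, eval_C, map_prod, map_sub, eval_X, h, Nat.cast_zero,
    zero_add, hp, hc]
  field_simp

theorem eval_binomialSum (c : ι → ℕ) (r : ι → σ → ℕ) (y : σ → ℕ) :
    eval (fun j => (y j : ℚ)) (binomialSum c r) =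
      ∑ i, (c i : ℚ) * ∏ j, ((y j).choose (r i j) : ℚ) := by
  simp only [binomialSum, map_sum, map_mul, eval_C, map_prod]
  refine Finset.sum_congr rfl fun i _ => ?_
  congr 1
  exact Finset.prod_congr rfl fun j _ => eval_binomialMonomial_zero _ j _ _ rfl

theorem isNaturalBinomial_binomialSum (c : ι → ℕ) (r : ι → σ → ℕ) :
    IsNaturalBinomial (binomialSum c r) := by
  let e := Fintype.equivFin ι
  refine ⟨Fintype.card ι, fun i => c (e.symm i), fun _ _ => 0, fun i => r (e.symm i), ?_⟩
  rw [binomialSum, ← e.symm.sum_comp]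

theorem restrict_binomialMonomial_of_some {σ : Type*} {ν : σ → Option ℕ} {j : σ} {n : ℕ}
    (h : ν j = some n) (r : ℕ) : restrict ν (binomialMonomial j 0 r) = C (n.choose r : ℚ) := by
  rw [← eval_binomialMonomial_zero (fun _ : σ => (n : ℚ)) j r n rfl]
  simp only [restrict, binomialMonomial, map_mul, map_prod, map_sub, aeval_X, algHom_C,
    algebraMap_eq, eval_C, eval_X]
  congr 1
  refine Finset.prod_congr rfl fun i _ => ?_
  congr 1
  split
  · rename_i m hm
    rw [h] at hm
    cases hm
    rfl
  · rename_i hm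
    rw [h] at hm
    cases hm

theorem restrict_binomialMonomial_of_none {σ : Type*} {ν : σ → Option ℕ} {j : σ} (h : ν j = none)
    (l r : ℕ) : restrict ν (binomialMonomial j l r) =
      binomialMonomial (⟨j, h⟩ : {j : σ // ν j = none}) l r := by
  simp only [restrict, binomialMonomial, map_mul, map_prod, map_sub, aeval_X, algHom_C,
    algebraMap_eq]
  congr 1
  refine Finset.prod_congr rfl fun i _ => ?_
  congr 1
  split
  · rename_i m hm
    rw [h] at hm
    cases hm
  · rfl

/-- Assigned indeterminates turn into binomial coefficients in `ℕ`, which are absorbed into `c`.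
This needs the offsets `0`: with an offset `l`, small assigned values could give negative factors.
-/
theorem isStronglyNaturalBinomial_binomialSum (c : ι → ℕ) (r : ι → σ → ℕ) :
    IsStronglyNaturalBinomial (binomialSum c r) := by
  classical
  intro ν
  have hν : restrict ν (binomialSum c r) = binomialSum
      (fun i => c i * ∏ j : {j // ¬ ν j = none}, ((ν j).getD 0).choose (r i j))
      (fun i (j : {j // ν j = none}) => r i j) := by
    have hmap : ∀ P, restrict ν P = (aeval (fun j => match h : ν j with
      | some n => MvPolynomial.C (n : ℚ)
      | none => MvPolynomial.X ⟨j, h⟩) : MvPolynomial σ ℚ →ₐ[ℚ] MvPolynomial {j // ν j = none} ℚ) P :=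
      fun P => rfl
    rw [hmap, binomialSum, map_sum, binomialSum]
    refine Finset.sum_congr rfl fun i _ => ?_
    rw [map_mul, map_prod, algHom_C, algebraMap_eq]
    simp only [← hmap]
    rw [← Fintype.prod_subtype_mul_prod_subtype (fun j => ν j = none), Nat.cast_mul, C_mul,
      mul_assoc]
    congr 1
    rw [mul_comm]
    congr 1
    · rw [Nat.cast_prod, map_prod]
      refine Finset.prod_congr rfl fun j _ => ?_
      obtain ⟨n, hn⟩ := Option.ne_none_iff_exists'.1 j.2
      rw [restrict_binomialMonomial_of_some hn, hn]
      rfl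
    · exact Finset.prod_congr rfl fun j _ => restrict_binomialMonomial_of_none j.2 _ _
  rw [hν]
  exact isNaturalBinomial_binomialSum _ _

end Polynomials

/-! ### Nonnegative differences give pumping polynomials. -/

section Pumping

variable {α : Type*} [DecidableEq α] {p : ℕ}

theorem parikh_word (q : PumpingPattern α p) (x : Fin p → ℕ) :
    parikh (q.word x) = parikh q.head + ∑ i, (x i • parikh (q.block i) + parikh (q.tail i)) := by
  simp only [PumpingPattern.word, parikh_append, parikh_flatten, List.map_ofFn, List.sum_ofFn,
    Function.comp_apply]
  refine congrArg _ (Finset.sum_congr rfl fun i _ => ?_)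
  rw [← parikh_flatten, parikh_replicate_flatten]

/-- The coefficients of the polynomial that describes the pumping of a function along a
pattern. -/
def pumpingCoeff (F : (α → ℕ) → ℤ) (ω ℓ : ℕ) (q : PumpingPattern α p) (s : Fin p → ℕ) : ℤ :=
  mixedDiff (((List.finRange p).flatMap fun i =>
    List.replicate (s i) (List.replicate ℓ (q.block i)).flatten).map (wordStep ω)) F
    (parikh (q.word fun _ => ω * ℓ))

/-- With period `ω * ℓ`, at `x = 1` every letter of a block already occurs at least `ℓ` times.
Raising `xᵢ` by one adds `ω` copies of the word `uᵢ^ℓ`. So `P` is Newton's formula from this base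
point in the variables `xᵢ - 1`; its coefficients are mixed differences along words, hence
nonnegative, and `toNat` does not change them. -/
theorem isPumpingPolynomial_of_nonnegDiff {f : List α → ℤ} {F : (α → ℕ) → ℤ}
    (hf : ∀ w, f w = F (parikh w)) {ω ℓ d : ℕ} (hω : 1 ≤ ω) (hd : HasDegreeLE ω ℓ d F)
    (hF : NonnegDiff ω ℓ F) (q : PumpingPattern α p) :
    IsPumpingPolynomial f (ω * ℓ) q (binomialSum (ι := Fin p → Fin (d + 1))
      (fun s => (pumpingCoeff F ω ℓ q fun i => s i).toNat) fun s i => s i) := by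
  refine ⟨isStronglyNaturalBinomial_binomialSum _ _, fun x hx => ?_⟩
  set b := parikh (q.word fun _ => ω * ℓ) with hb
  let z : Fin p → List α := fun i => (List.replicate ℓ (q.block i)).flatten
  have hbz : ∀ i, ∀ c ∈ z i, ℓ ≤ b c := by
    intro i c hc
    have hc' : 1 ≤ parikh (q.block i) c := by
      obtain ⟨u, hu, hcu⟩ := List.mem_flatten.1 hc
      rw [List.eq_of_mem_replicate hu] at hcu
      exact one_le_parikh hcu
    have h1 : (ω * ℓ) • parikh (q.block i) + parikh (q.tail i) ≤
        ∑ j, ((ω * ℓ) • parikh (q.block j) + parikh (q.tail j)) :=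
      Finset.single_le_sum (f := fun j => (ω * ℓ) • parikh (q.block j) + parikh (q.tail j))
        (fun j _ => zero_le) (Finset.mem_univ i)
    have h2 := h1 c
    rw [hb, parikh_word, Pi.add_apply]
    simp only [Pi.add_apply, Pi.smul_apply, smul_eq_mul] at h2
    nlinarith [Nat.mul_le_mul hω hc', Nat.mul_le_mul_left ℓ (Nat.mul_le_mul hω hc')]
  have hnn : ∀ s : Fin p → Fin (d + 1), 0 ≤ pumpingCoeff F ω ℓ q fun i => s i := by
    intro s
    refine hF.words _ _ (Nat.zero_le _) fun z' hz' c hc => ?_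
    obtain ⟨i, _, hi⟩ := List.mem_flatMap.1 hz'
    rw [List.eq_of_mem_replicate hi] at hc
    exact hbz i c hc
  have hpar : parikh (q.word fun i => ω * x i * ℓ) = b + ∑ i, (x i - 1) • wordStep ω (z i) := by
    rw [hb, parikh_word, parikh_word, add_assoc, ← Finset.sum_add_distrib]
    congr 1
    refine Finset.sum_congr rfl fun i _ => ?_
    obtain ⟨m, hm⟩ := Nat.exists_eq_add_of_le (hx i)
    rw [wordStep, parikh_replicate_flatten, hm, Nat.add_sub_cancel_left, add_right_comm]
    congr 1
    simp only [smul_smul, ← add_smul]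
    congr 1
    ring
  have hpar' : (fun i => ω * ℓ * x i) = fun i => ω * x i * ℓ := by funext i; ring
  have hev : (fun i => (x i : ℚ) - 1) = fun i => ((x i - 1 : ℕ) : ℚ) := by
    funext i; rw [Nat.cast_sub (hx i), Nat.cast_one]
  rw [hf, hpar', hpar, hd.eq_sum b z hbz, hev, eval_binomialSum, Int.cast_sum]
  refine Finset.sum_congr rfl fun s _ => ?_
  have : ((pumpingCoeff F ω ℓ q fun i => s i).toNat : ℚ) =
      ((pumpingCoeff F ω ℓ q fun i => s i : ℤ) : ℚ) := by
    exact_mod_cast congrArg (Int.cast : ℤ → ℚ) (Int.toNat_of_nonneg (hnn s))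
  rw [this, mul_comm]
  simp [pumpingCoeff, z, hb]

end Pumping

end NPolyreg

namespace NPolyreg

open Filter

/-! ### The eventual sign of the differences of a polynomial function on `ℕ`. -/

section Sign

theorem fwdDiff_iter_eq_zero_of_const {h : ℕ → ℤ} {t : ℕ} {c : ℤ} (hc : ∀ s, t ≤ s → h s = c)
    (j : ℕ) : ∀ s, t ≤ s → (fwdDiff 1)^[j + 1] h s = 0 := by
  induction j generalizing h c with
  | zero => intro s hs; simp [fwdDiff, hc s hs, hc (s + 1) (hs.trans (Nat.le_succ s))]
  | succ j ih =>
    intro s hs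
    rw [Function.iterate_succ_apply]
    exact ih (c := 0) (fun s hs => by
      simp [fwdDiff, hc s hs, hc (s + 1) (hs.trans (Nat.le_succ s))]) s hs

/-- A polynomial function on `ℕ` is eventually nonnegative, or it has at some place a negative
value and nonpositive differences. -/
theorem eventually_differences_sign (n : ℕ) : ∀ h : ℕ → ℤ, (fwdDiff 1)^[n] h = 0 →
    (∀ᶠ t in atTop, ∀ j, 0 ≤ (fwdDiff 1)^[j] h t) ∨
      ∀ᶠ t in atTop, h t < 0 ∧ ∀ j, (fwdDiff 1)^[j] h t ≤ 0 := by
  induction n with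
  | zero =>
    intro h hh
    left
    have h0 : h = 0 := hh
    refine Eventually.of_forall fun t j => ?_
    rcases j with _ | j
    · simp [h0]
    · exact (fwdDiff_iter_eq_zero_of_const (t := 0) (c := 0) (fun s _ => by simp [h0]) j t
        (Nat.zero_le t)).ge
  | succ n ih =>
    intro h hh
    rw [Function.iterate_succ_apply] at hh
    rcases ih _ hh with hA | hB
    · obtain ⟨t0, ht0⟩ := eventually_atTop.1 hA
      have hmono : ∀ s t, t0 ≤ s → s ≤ t → h s ≤ h t := by
        intro s t hs hst
        induction t, hst using Nat.le_induction with
        | base => exact le_rfl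
        | succ t hst ih =>
          have := ht0 t (hs.trans hst) 0
          simp only [Function.iterate_zero, id_eq, fwdDiff] at this
          linarith
      by_cases hpos : ∃ t1, t0 ≤ t1 ∧ 0 ≤ h t1
      · obtain ⟨t1, h01, h1⟩ := hpos
        left
        refine eventually_atTop.2 ⟨t1, fun t ht j => ?_⟩
        rcases j with _ | j
        · exact h1.trans (hmono t1 t h01 ht)
        · exact ht0 t (h01.trans ht) j
      · push Not at hpos
        right
        -- A nondecreasing negative integer sequence is eventually constant: it stops where `-h` is
        -- minimal, and from there on its differences vanish.
        obtain ⟨t1, h01, hmin⟩ : ∃ t1, t0 ≤ t1 ∧ ∀ t, t0 ≤ t → (-h t1).toNat ≤ (-h t).toNat := by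
          obtain ⟨t1, h01, hmin⟩ := WellFounded.has_min (measure fun t => (-h t).toNat).wf
            (Set.Ici t0) ⟨t0, Set.mem_Ici.2 le_rfl⟩
          exact ⟨t1, h01, fun t ht => not_lt.1 (hmin t ht)⟩
        have hc : ∀ s, t1 ≤ s → h s = h t1 := fun s hs => by
          have h1 := hmono t1 s h01 hs
          have h2 := hmin s (h01.trans hs)
          have h3 := hpos s (h01.trans hs)
          have h4 := hpos t1 h01
          omega
        refine eventually_atTop.2 ⟨t1, fun t ht => ⟨hpos t (h01.trans ht), fun j => ?_⟩⟩
        rcases j with _ | j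
        · exact (hpos t (h01.trans ht)).le
        · exact (fwdDiff_iter_eq_zero_of_const hc j t ht).le
    · obtain ⟨t0, ht0⟩ := eventually_atTop.1 hB
      -- The first difference is a negative integer, so `h` drops by at least one at every step and
      -- becomes negative.
      have hdec : ∀ s : ℕ, h (t0 + s) ≤ h t0 - s := by
        intro s
        induction s with
        | zero => simp
        | succ s ih =>
          have := (ht0 (t0 + s) (Nat.le_add_right _ _)).1
          simp only [fwdDiff] at this
          push_cast
          rw [← add_assoc]
          linarith
      right
      refine eventually_atTop.2 ⟨t0 + ((h t0).toNat + 1), fun t ht => ?_⟩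
      obtain ⟨s, rfl⟩ := Nat.exists_eq_add_of_le (show t0 ≤ t by omega)
      have hneg : h (t0 + s) < 0 := by
        have := hdec s
        omega
      refine ⟨hneg, fun j => ?_⟩
      rcases j with _ | j
      · exact hneg.le
      · exact (ht0 (t0 + s) (Nat.le_add_right _ _)).2 j

end Sign

/-! ### Negative rays, and nonnegativity in their absence. -/

section Rays

variable {α : Type*} [DecidableEq α]

/-- A ray on which a mixed difference of `F` is negative, as can be seen at its origin. -/
def NegativeRay (ω T d : ℕ) (F : (α → ℕ) → ℤ) (n : α → ℕ) (z is : List α) : Prop :=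
  (∀ i ∈ z, T ≤ n i) ∧ (∀ i ∈ is, i ∈ z) ∧
    mixedDiff (is.map fun i => wordStep ω [i]) F n < 0 ∧
    ∀ j ≤ d, mixedDiff ((List.replicate j z ++ is.map fun i => [i]).map (wordStep ω)) F n ≤ 0

theorem mixedDiff_replicate_append {ω : ℕ} (F : (α → ℕ) → ℤ) (n : α → ℕ) (z is : List α) (j : ℕ) :
    mixedDiff ((List.replicate j z ++ is.map fun i => [i]).map (wordStep ω)) F n =
      (fwdDiff (wordStep ω z))^[j] (mixedDiff (is.map fun i => wordStep ω [i]) F) n := by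
  rw [← mixedDiff_replicate, ← mixedDiff_append]
  refine congrFun (mixedDiff_perm ?_ F) n
  rw [List.map_append, List.map_replicate, List.map_map]
  exact List.perm_append_comm

theorem HasDegreeLE.iterate_eq_zero {ω T d : ℕ} {F : (α → ℕ) → ℤ} (hF : HasDegreeLE ω T d F)
    {n : α → ℕ} {z is : List α} (hz : ∀ i ∈ z, T ≤ n i) (hi : ∀ i ∈ is, i ∈ z) {j : ℕ}
    (hj : d < j) :
    (fwdDiff (wordStep ω z))^[j] (mixedDiff (is.map fun i => wordStep ω [i]) F) n = 0 := by
  rw [← mixedDiff_replicate_append]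
  refine AddSubmonoid.mem_bot.1 (hF.words _ n (by simp; omega) fun z' hz' i hi' => ?_)
  rcases List.mem_append.1 hz' with h | h
  · rw [List.eq_of_mem_replicate h] at hi'
    exact hz i hi'
  · obtain ⟨i', hmem, rfl⟩ := List.mem_map.1 h
    rw [List.mem_singleton] at hi'
    subst hi'
    exact hz _ (hi _ hmem)

/-- In Newton's formula along `z` the constant term is negative, the next `d` coefficients are
nonpositive, and the others vanish. -/
theorem NegativeRay.neg {ω T d : ℕ} {F : (α → ℕ) → ℤ} (hF : HasDegreeLE ω T d F)
    {n : α → ℕ} {z is : List α} (h : NegativeRay ω T d F n z is) (t : ℕ) :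
    mixedDiff (is.map fun i => wordStep ω [i]) F (n + t • wordStep ω z) < 0 := by
  obtain ⟨hz, hi, h0, hd⟩ := h
  rw [eq_sum_choose_smul_of_vanish _ _ _ d t fun j hj => hF.iterate_eq_zero hz hi hj,
    Fin.sum_univ_succ]
  refine add_neg_of_neg_of_nonpos (by simpa using h0) (Finset.sum_nonpos fun j _ => ?_)
  rw [← mixedDiff_replicate_append]
  exact smul_nonpos_of_nonneg_of_nonpos (Nat.zero_le _) (hd _ (by simp))

theorem fwdDiff_iterate_ray {A : Type*} [AddCommMonoid A] (g : A → ℤ) (b z : A) (j t : ℕ) :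
    (fwdDiff 1)^[j] (fun t : ℕ => g (b + t • z)) t = (fwdDiff z)^[j] g (b + t • z) := by
  have := mixedDiff_map (AddMonoidHom.id ℤ) ((multiplesHom A) z) b (List.replicate j 1) g t
  simpa [mixedDiff_replicate] using this

/-- On the ray the difference is a polynomial function of `t`. The bad alternative of
`eventually_differences_sign` would make some point of the ray the origin of a negative ray. -/
theorem eventually_nonneg_on_ray {ω T d : ℕ} {F : (α → ℕ) → ℤ} (hF : HasDegreeLE ω T d F)
    (hneg : ∀ n z is, ¬ NegativeRay ω T d F n z is)
    {n : α → ℕ} {z is : List α} (hz : ∀ i ∈ z, T ≤ n i) (hi : ∀ i ∈ is, i ∈ z) :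
    ∀ᶠ t : ℕ in atTop,
      0 ≤ mixedDiff (is.map fun i => wordStep ω [i]) F (n + t • wordStep ω z) := by
  set g := mixedDiff (is.map fun i => wordStep ω [i]) F with hg
  have hz' : ∀ t : ℕ, ∀ i ∈ z, T ≤ (n + t • wordStep ω z) i := fun t i hi =>
    (hz i hi).trans (by simp)
  have h0 : (fwdDiff 1)^[d + 1] (fun t : ℕ => g (n + t • wordStep ω z)) = 0 := by
    funext t
    rw [fwdDiff_iterate_ray]
    exact hF.iterate_eq_zero (hz' t) hi (Nat.lt_succ_self d)
  rcases eventually_differences_sign _ _ h0 with h | h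
  · exact h.mono fun t ht => ht 0
  · obtain ⟨t, ht, hj⟩ := h.exists
    refine absurd ⟨hz' t, hi, ht, fun j _ => ?_⟩ (hneg (n + t • wordStep ω z) z is)
    rw [mixedDiff_replicate_append, ← fwdDiff_iterate_ray]
    exact hj j

/-- Adding a letter `c` to the base point adds the difference with the extra step `c`. Nonnegativity
at one point therefore spreads over the cone of letters in `V`. -/
theorem nonneg_add_wordStep {ω : ℕ} {F : (α → ℕ) → ℤ} {b : α → ℕ} {V : Set α}
    (h : ∀ is : List α, (∀ i ∈ is, i ∈ V) → 0 ≤ mixedDiff (is.map fun i => wordStep ω [i]) F b)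
    (u : List α) (hu : ∀ i ∈ u, i ∈ V) : ∀ is : List α, (∀ i ∈ is, i ∈ V) →
      0 ≤ mixedDiff (is.map fun i => wordStep ω [i]) F (b + wordStep ω u) := by
  induction u with
  | nil => simpa using h
  | cons c u ih =>
    intro is hi
    have ih := ih fun i hi => hu i (List.mem_cons_of_mem _ hi)
    have h1 := ih is hi
    have h2 := ih (c :: is) fun i hi' => by
      rcases List.mem_cons.1 hi' with rfl | hi'
      · exact hu _ List.mem_cons_self
      · exact hi i hi'
    rw [List.map_cons, mixedDiff_cons_apply, add_assoc, add_comm (wordStep ω u),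
      ← wordStep_cons] at h2
    linarith

theorem exists_parikh_eq [Fintype α] (m : α → ℕ) : ∃ u : List α, parikh u = m := by
  refine ⟨(∑ i, Multiset.replicate (m i) i).toList, funext fun i => ?_⟩
  rw [parikh, ← Multiset.coe_count, Multiset.coe_toList, Multiset.count_sum']
  simp [Multiset.count_replicate]

/-- A function of bounded degree without negative rays has nonnegative differences from some letter
count on. -/
theorem exists_nonnegDiff [Fintype α] {ω T d : ℕ} (hω : 1 ≤ ω) {F : (α → ℕ) → ℤ}
    (hF : HasDegreeLE ω T d F) (hneg : ∀ n z is, ¬ NegativeRay ω T d F n z is) :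
    ∃ ℓ, NonnegDiff ω ℓ F := by
  by_contra hcon
  have hbad : ∀ ℓ : ℕ, ∃ (n : α → ℕ) (is : List α), (∀ i ∈ is, ℓ ≤ n i) ∧
      mixedDiff (is.map fun i => wordStep ω [i]) F n < 0 := fun ℓ => by
    by_contra h
    push Not at h
    exact hcon ⟨ℓ, fun n is _ hi => h n is hi⟩
  choose n is hn hlt using hbad
  -- Compactness: along a nonprincipal ultrafilter every coordinate of the bad points `n ℓ` either
  -- tends to infinity, and then lies in `V`, or is constant. All residues modulo `ω` become
  -- constant too.
  let U : Ultrafilter ℕ := hyperfilter ℕ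
  have hU : (U : Filter ℕ) ≤ atTop := Nat.hyperfilter_le_atTop
  have hconst : ∀ (g : ℕ → ℕ) (C : ℕ), (∀ᶠ ℓ in U, g ℓ < C) → ∃ c, ∀ᶠ ℓ in U, g ℓ = c := by
    intro g C hC
    have : (⋃ c ∈ Set.Iio C, {ℓ | g ℓ = c}) ∈ U := by
      filter_upwards [hC] with ℓ hℓ
      simpa using hℓ
    obtain ⟨c, _, hc⟩ := (Ultrafilter.finite_biUnion_mem_iff (Set.finite_Iio C)).1 this
    exact ⟨c, hc⟩
  let V : Set α := {i | Tendsto (fun ℓ => n ℓ i) U atTop}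
  have hV : ∀ i, i ∉ V → ∃ c, ∀ᶠ ℓ in U, n ℓ i = c := by
    intro i hi
    have hi : ¬ Tendsto (fun ℓ => n ℓ i) U atTop := hi
    rw [tendsto_atTop] at hi
    push Not at hi
    obtain ⟨C, hC⟩ := hi
    exact hconst _ C hC
  have hres : ∀ i, ∃ ρ, ∀ᶠ ℓ in U, n ℓ i % ω = ρ := fun i =>
    hconst (fun ℓ => n ℓ i % ω) ω (Eventually.of_forall fun ℓ => Nat.mod_lt _ hω)
  choose ρ hρ using hres
  choose! c hc using hV
  classical
  -- A point with the limiting residues on `V`, above the threshold `T` there, and with the constant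
  -- values elsewhere.
  let b : α → ℕ := fun i => if i ∈ V then ω * T + ρ i else c i
  let z : List α := (Finset.univ.filter fun i => i ∈ V).toList
  have hzV : ∀ i, i ∈ z ↔ i ∈ V := fun i => by simp [z]
  have hb : ∀ i ∈ z, T ≤ b i := fun i hi => by
    have : b i = ω * T + ρ i := if_pos ((hzV i).1 hi)
    rw [this]
    nlinarith
  -- Only finitely many lists have length at most `d`, and longer differences vanish, so one `t` on
  -- the ray through all letters of `V` serves for every list.
  have hev : ∀ᶠ t : ℕ in atTop, ∀ js ∈ {js : List α | js.length ≤ d}, (∀ i ∈ js, i ∈ V) →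
      0 ≤ mixedDiff (js.map fun i => wordStep ω [i]) F (b + t • wordStep ω z) := by
    refine (eventually_all_finite (List.finite_length_le α d)).2 fun js _ => ?_
    by_cases hjs : ∀ i ∈ js, i ∈ V
    · exact (eventually_nonneg_on_ray hF hneg hb fun i hi => (hzV i).2 (hjs i hi)).mono
        fun t ht _ => ht
    · exact Eventually.of_forall fun t h => absurd h hjs
  obtain ⟨t, ht⟩ := hev.exists
  have hbase : ∀ js : List α, (∀ i ∈ js, i ∈ V) →
      0 ≤ mixedDiff (js.map fun i => wordStep ω [i]) F (b + t • wordStep ω z) := by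
    intro js hjs
    rcases le_or_gt js.length d with hd | hd
    · exact ht js hd hjs
    · refine (AddSubmonoid.mem_bot.1 (hF _ js hd fun i hi => ?_)).ge
      exact (hb i ((hzV i).2 (hjs i hi))).trans (by simp)
  have hall : ∀ᶠ ℓ in U, ∀ i, (n ℓ i % ω = ρ i) ∧ (i ∈ V → (b + t • wordStep ω z) i ≤ n ℓ i) ∧
      (i ∉ V → n ℓ i = c i ∧ c i < ℓ) := by
    refine eventually_all.2 fun i => (hρ i).and (Eventually.and ?_ ?_)
    · by_cases hi : i ∈ V
      · exact (tendsto_atTop.1 hi _).mono fun ℓ h _ => h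
      · exact Eventually.of_forall fun ℓ h => absurd h hi
    · by_cases hi : i ∈ V
      · exact Eventually.of_forall fun ℓ h => absurd hi h
      · exact ((hc i hi).and (hU (eventually_gt_atTop (c i)))).mono fun ℓ h _ => h
  obtain ⟨ℓ, hℓ⟩ := hall.exists
  -- The bad point lies above the good one with equal residues, so it is reached by steps along
  -- letters of `V`.
  obtain ⟨u, hu⟩ := exists_parikh_eq fun i => (n ℓ i - (b + t • wordStep ω z) i) / ω
  have hnu : n ℓ = b + t • wordStep ω z + wordStep ω u := by
    funext i
    obtain ⟨h1, h2, h3⟩ := hℓ i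
    have hstep : wordStep ω u i = ω * ((n ℓ i - (b + t • wordStep ω z) i) / ω) := by
      change ω * parikh u i = _
      rw [hu]
    rw [Pi.add_apply, hstep]
    by_cases hi : i ∈ V
    · have h2 := h2 hi
      have hbi : (b + t • wordStep ω z) i = ω * (T + t * parikh z i) + ρ i := by
        simp only [Pi.add_apply, Pi.smul_apply, smul_eq_mul, wordStep, b, if_pos hi]
        ring
      have hdvd : ω ∣ n ℓ i - (b + t • wordStep ω z) i := by
        refine (Nat.modEq_iff_dvd' h2).1 ?_
        rw [Nat.ModEq, hbi, Nat.mul_add_mod, h1, ← h1, Nat.mod_mod]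
      rw [Nat.mul_div_cancel' hdvd]
      omega
    · have hz0 : parikh z i = 0 := List.count_eq_zero.2 fun h => hi ((hzV i).1 h)
      have hbi : (b + t • wordStep ω z) i = c i := by
        simp [wordStep, hz0, b, if_neg hi]
      rw [hbi, (h3 hi).1]
      simp
  have huV : ∀ i ∈ u, i ∈ V := by
    intro i hi
    by_contra hiV
    have h1 := one_le_parikh hi
    have hz0 : parikh z i = 0 := List.count_eq_zero.2 fun h => hiV ((hzV i).1 h)
    have hbi : (b + t • wordStep ω z) i = c i := by
      simp [wordStep, hz0, b, if_neg hiV]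
    rw [hu] at h1
    beta_reduce at h1
    rw [hbi, ((hℓ i).2.2 hiV).1] at h1
    simp at h1
  -- Letters outside `V` occur `c i < ℓ` times, whereas those of `is ℓ` occur at least `ℓ` times.
  have hisV : ∀ i ∈ is ℓ, i ∈ V := by
    intro i hi
    by_contra hiV
    have h1 := hn ℓ i hi
    have h2 := (hℓ i).2.2 hiV
    omega
  have := nonneg_add_wordStep hbase u huV (is ℓ) hisV
  rw [← hnu] at this
  exact absurd (hlt ℓ) (not_lt.2 this)

end Rays

end NPolyreg

namespace NPolyreg

/-! ### Eventual nonnegativity of the differences of natural binomial polynomials. -/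

section AbsolutelyMonotone

variable {σ : Type*} [DecidableEq σ]

/-- The functions whose mixed differences are nonnegative from `Z` on. -/
def AbsMonotoneFrom (Z : ℕ) (g : (σ → ℕ) → ℚ) : Prop :=
  ∀ (is : List σ) (n : σ → ℕ), (∀ i, Z ≤ n i) →
    0 ≤ mixedDiff (is.map fun i => Pi.single i 1) g n

theorem AbsMonotoneFrom.fwdDiff {Z : ℕ} {g : (σ → ℕ) → ℚ} (h : AbsMonotoneFrom Z g) (i : σ) :
    AbsMonotoneFrom Z (fwdDiff (Pi.single i 1) g) := fun is => h (i :: is)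

theorem AbsMonotoneFrom.translate {Z : ℕ} {g : (σ → ℕ) → ℚ} (h : AbsMonotoneFrom Z g)
    (b : σ → ℕ) : AbsMonotoneFrom Z fun n => g (n + b) := fun is n hn => by
  rw [mixedDiff_translate]
  exact h is _ fun i => (hn i).trans (by simp)

theorem AbsMonotoneFrom.add {Z : ℕ} {g h : (σ → ℕ) → ℚ} (hg : AbsMonotoneFrom Z g)
    (hh : AbsMonotoneFrom Z h) : AbsMonotoneFrom Z (g + h) := fun is n hn => by
  rw [mixedDiff_add]
  exact add_nonneg (hg is n hn) (hh is n hn)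

/-- Leibniz's rule `Δ(g h) = Δg · h(· + e) + g · Δh`, together with the stability of the property
under translations and differences. -/
theorem AbsMonotoneFrom.mul {Z : ℕ} {g h : (σ → ℕ) → ℚ} (hg : AbsMonotoneFrom Z g)
    (hh : AbsMonotoneFrom Z h) : AbsMonotoneFrom Z (g * h) := by
  intro is
  induction is generalizing g h with
  | nil => exact fun n hn => mul_nonneg (hg [] n hn) (hh [] n hn)
  | cons i is ih =>
    intro n hn
    have hprod : _root_.fwdDiff (Pi.single i 1 : σ → ℕ) (g * h) =
        _root_.fwdDiff (Pi.single i 1) g * (fun n => h (n + Pi.single i 1)) +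
          g * _root_.fwdDiff (Pi.single i 1) h := by
      funext n
      simp only [_root_.fwdDiff, Pi.mul_apply, Pi.add_apply]
      ring
    rw [List.map_cons, mixedDiff_cons, hprod, mixedDiff_add]
    exact add_nonneg (ih (hg.fwdDiff i) (hh.translate _) n hn) (ih hg (hh.fwdDiff i) n hn)

theorem mixedDiff_const_of_ne_nil {A G : Type*} [AddCommMonoid A] [AddCommGroup G] (c : G)
    (zs : List A) (a : A) (hz : zs ≠ []) : mixedDiff zs (fun _ => c) a = 0 := by
  obtain ⟨z, zs, rfl⟩ := List.exists_cons_of_ne_nil hz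
  rw [mixedDiff_cons_apply]
  have h : ∀ a b, mixedDiff zs (fun _ : A => c) (a + b) = mixedDiff zs (fun _ => c) a := fun a b =>
    (congrFun (mixedDiff_translate zs (fun _ => c) b) a).symm
  rw [h, sub_self]

theorem absMonotoneFrom_const (Z : ℕ) {c : ℚ} (hc : 0 ≤ c) :
    AbsMonotoneFrom Z fun _ : σ → ℕ => c := by
  intro is n _
  rcases is with _ | ⟨i, is⟩
  · exact hc
  · exact (mixedDiff_const_of_ne_nil c _ n (by simp)).ge

theorem absMonotoneFrom_linear {Z : ℕ} (j : σ) {a c : ℚ} (ha : 0 ≤ a) (hc : c ≤ a * Z) :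
    AbsMonotoneFrom Z fun n : σ → ℕ => a * n j - c := by
  intro is n hn
  rcases is with _ | ⟨i, is⟩
  · have : (Z : ℚ) ≤ n j := by exact_mod_cast hn j
    have := mul_le_mul_of_nonneg_left this ha
    simp only [List.map_nil, mixedDiff_nil]
    linarith
  · rw [List.map_cons, mixedDiff_cons]
    have : _root_.fwdDiff (Pi.single i 1 : σ → ℕ) (fun n : σ → ℕ => a * n j - c) =
        fun _ => if i = j then a else 0 := by
      funext n
      by_cases h : i = j
      · subst h; simp [_root_.fwdDiff]; ring
      · simp [_root_.fwdDiff, h]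
    rw [this]
    exact absMonotoneFrom_const Z (by split_ifs <;> simp [ha]) is n hn

theorem absMonotoneFrom_prod {ι : Type*} (s : Finset ι) {Z : ℕ} (g : ι → (σ → ℕ) → ℚ)
    (h : ∀ i ∈ s, AbsMonotoneFrom Z (g i)) : AbsMonotoneFrom Z fun n => ∏ i ∈ s, g i n := by
  classical
  induction s using Finset.induction_on with
  | empty => simpa using absMonotoneFrom_const Z zero_le_one
  | insert i s hi ih =>
    simp only [Finset.prod_insert hi]
    exact (h i (Finset.mem_insert_self i s)).mul (ih fun j hj => h j (Finset.mem_insert_of_mem hj))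

theorem absMonotoneFrom_sum {ι : Type*} (s : Finset ι) {Z : ℕ} (g : ι → (σ → ℕ) → ℚ)
    (h : ∀ i ∈ s, AbsMonotoneFrom Z (g i)) : AbsMonotoneFrom Z fun n => ∑ i ∈ s, g i n := by
  classical
  induction s using Finset.induction_on with
  | empty => simpa using absMonotoneFrom_const Z le_rfl
  | insert i s hi ih =>
    simp only [Finset.sum_insert hi]
    exact (h i (Finset.mem_insert_self i s)).add (ih fun j hj => h j (Finset.mem_insert_of_mem hj))

open MvPolynomial

/-- Under the nowhere defined valuation a strongly natural polynomial is itself natural binomial.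
From combinatoriality to `ℕPoly` nothing more of strong naturality is needed. -/
theorem eval_restrict_none {σ : Type*} (P : MvPolynomial σ ℚ) (y : σ → ℚ) :
    eval (fun j : {_j : σ // (none : Option ℕ) = none} => y j) (restrict (fun _ => none) P) =
      eval y P := by
  induction P using MvPolynomial.induction_on with
  | C a => simp [restrict]
  | add p q hp hq => simp only [restrict, map_add] at hp hq ⊢; rw [hp, hq]
  | mul_X p i hp => simp only [restrict, map_mul, aeval_X, eval_X] at hp ⊢; rw [hp]

/-- A natural binomial polynomial, composed with contractions, has nonnegative mixed differences
from some place on. -/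
theorem IsStronglyNaturalBinomial.exists_absMonotoneFrom [Fintype σ] {P : MvPolynomial σ ℚ}
    (hP : IsStronglyNaturalBinomial P) {m : ℕ} (hm : 1 ≤ m) :
    ∃ Z, AbsMonotoneFrom Z fun n : σ → ℕ => eval (fun j => (n j : ℚ) / m - 1) P := by
  obtain ⟨N, c, l, r, h⟩ := hP fun _ => none
  -- A bound beyond which all linear factors `n_j / m - 1 - l - i` with `i < r` are nonnegative.
  let Z : ℕ := ∑ a : Fin N, ∑ j, m * (1 + l a j + r a j)
  have hZ : ∀ a j, m * (1 + l a j + r a j) ≤ Z := fun a j =>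
    (Finset.single_le_sum (f := fun j => m * (1 + l a j + r a j)) (fun _ _ => Nat.zero_le _)
      (Finset.mem_univ j)).trans (Finset.single_le_sum
        (f := fun a => ∑ j, m * (1 + l a j + r a j)) (fun _ _ => Nat.zero_le _)
        (Finset.mem_univ a))
  refine ⟨Z, ?_⟩
  have hm' : (0 : ℚ) < m := by exact_mod_cast hm
  simp only [← eval_restrict_none P, h, map_sum, map_mul, map_prod, eval_C, binomialMonomial,
    map_sub, eval_X]
  refine absMonotoneFrom_sum _ _ fun a _ => (absMonotoneFrom_const Z (Nat.cast_nonneg _)).mul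
    (absMonotoneFrom_prod _ _ fun j _ => (absMonotoneFrom_const Z (by positivity)).mul
      (absMonotoneFrom_prod _ _ fun i hi => ?_))
  have hi' : i ≤ r a j := (Finset.mem_range.1 hi).le
  have hle : ((m * (1 + l a j + i) : ℕ) : ℚ) ≤ Z := by
    exact_mod_cast (Nat.mul_le_mul_left m (by omega)).trans (hZ a j)
  convert absMonotoneFrom_linear (Z := Z) j.1 (a := (m : ℚ)⁻¹) (c := 1 + ((l a j : ℚ) + i))
    (by positivity) ?_ using 2
  · rw [div_eq_inv_mul]; ring
  · rw [← div_eq_inv_mul, le_div_iff₀ hm']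
    push_cast at hle
    linarith

end AbsolutelyMonotone

/-! ### Combinatorial functions have no negative rays. -/

section Combinatorial

open MvPolynomial

/-- A combinatorial function of bounded degree has no negative ray. -/
theorem IsCombinatorial.not_negativeRay {k : ℕ} {f : List (Fin k) → ℤ}
    (hf : IsCombinatorial k f) {F : (Fin k → ℕ) → ℤ} (hfF : ∀ w, f w = F (parikh w))
    {ω T d : ℕ} (hF : HasDegreeLE ω T d F) (n : Fin k → ℕ) (z is : List (Fin k)) :
    ¬ NegativeRay ω T d F n z is := by
  intro hray
  obtain ⟨m, hm, hq⟩ := hf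
  obtain ⟨w, hw⟩ := exists_parikh_eq n
  -- The pattern starts at the origin of the ray and pumps `ω` copies of every letter of `z`
  -- separately. Its `k` exponents suffice for this.
  let u : Fin k → List (Fin k) := fun i => if i ∈ z then [i] else []
  obtain ⟨P, hP, hev⟩ := hq ⟨w, fun i => (List.replicate ω (u i)).flatten, fun _ => []⟩
  obtain ⟨Z, hZ⟩ := hP.exists_absMonotoneFrom hm
  let ψ : (Fin k → ℕ) →+ (Fin k → ℕ) :=
    { toFun := fun y => ∑ i, y i • wordStep ω (u i)
      map_zero' := by simp
      map_add' := fun x y => by simp [add_smul, Finset.sum_add_distrib] }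
  have hu : ∀ i, ∀ c ∈ u i, T ≤ n c := by
    intro i c hc
    by_cases h : i ∈ z
    · have : u i = [i] := if_pos h
      rw [this, List.mem_singleton] at hc
      exact hray.1 c (hc ▸ h)
    · have : u i = [] := if_neg h
      rw [this] at hc
      simp at hc
  let G : MvPolynomial (Fin k) ℚ := ∑ s : Fin k → Fin (d + 1), C ((mixedDiff
    (((List.finRange k).flatMap fun i => List.replicate (s i) (u i)).map (wordStep ω)) F n : ℤ) : ℚ)
      * ∏ i, binomialMonomial i 0 (s i)
  have hG : ∀ y : Fin k → ℕ, eval (fun i => (y i : ℚ)) G = (F (n + ψ y) : ℤ) := by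
    intro y
    have h := hF.eq_sum n u hu y
    change _ = ((F (n + ∑ i, y i • wordStep ω (u i)) : ℤ) : ℚ)
    rw [h]
    simp only [G, map_sum, map_mul, map_prod, eval_C, Int.cast_sum]
    refine Finset.sum_congr rfl fun s _ => ?_
    rw [Finset.prod_congr rfl fun i _ => eval_binomialMonomial_zero _ i (s i) (y i) rfl, mul_comm]
    simp
  have hm0 : (m : ℚ) ≠ 0 := by positivity
  -- `P` describes `F` only at exponents that are positive multiples of `m`; `Q` is `P` in the
  -- variables of Newton's polynomial `G`.
  let Q : MvPolynomial (Fin k) ℚ := aeval (fun i => C ((m : ℚ)⁻¹) * X i - 1) P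
  have hQ : ∀ y : Fin k → ℚ, eval y Q = eval (fun i => y i / m - 1) P := by
    intro y
    have h1 : eval y Q = ((aeval y).comp (aeval fun i => C ((m : ℚ)⁻¹) * X i - 1)) P := by
      simp [Q, aeval_eq_eval]
    rw [h1, comp_aeval, aeval_eq_eval]
    simp [div_eq_inv_mul, aeval_eq_eval]
  -- Both agree on a grid that is infinite in every coordinate. Hence `P` determines `F` at all
  -- exponents, and the period `m` of the pumping no longer matters.
  have hGQ : G = Q := by
    refine funext_set (fun _ : Fin k => Set.range fun x : ℕ => (((x + 1) * m : ℕ) : ℚ))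
      (fun _ => Set.infinite_range_of_injective fun x y h => ?_) fun x hx => ?_
    · have h' : (x + 1) * m = (y + 1) * m := by exact_mod_cast h
      have := Nat.eq_of_mul_eq_mul_right hm h'
      omega
    · choose t ht using fun i => hx i (Set.mem_univ i)
      obtain rfl : x = fun i => (((t i + 1) * m : ℕ) : ℚ) := funext fun i => (ht i).symm
      rw [hG fun i => (t i + 1) * m, hQ]
      have h2 := hev (fun i => t i + 1) fun i => by omega
      have h3 : (fun i => ((((t i + 1) * m : ℕ) : ℚ)) / m - 1) =
          fun i => (((t i + 1 : ℕ) : ℚ)) - 1 := by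
        funext i
        push_cast
        field_simp
      rw [h3, ← h2, hfF, parikh_word]
      congr 2
      change n + ∑ i, ((t i + 1) * m) • wordStep ω (u i) = _
      congr 1
      · exact hw.symm
      · refine Finset.sum_congr rfl fun i _ => ?_
        simp only [parikh_nil, add_zero, parikh_replicate_flatten, wordStep, smul_smul]
        congr 1
        ring
  -- A point beyond `Z` in all coordinates that lands on the ray; letters outside `z` contribute
  -- zero steps, so their exponents are harmless.
  let y : Fin k → ℕ := fun i => if i ∈ z then Z * z.count i else Z
  have hy : ∀ i, Z ≤ y i := by
    intro i
    by_cases h : i ∈ z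
    · have : y i = Z * z.count i := if_pos h
      rw [this]
      exact Nat.le_mul_of_pos_right _ (List.count_pos_iff.2 h)
    · exact (if_neg h : y i = Z).ge
  have hψy : ψ y = Z • wordStep ω z := by
    funext j
    change (∑ i, y i • wordStep ω (u i)) j = _
    rw [Finset.sum_apply, Finset.sum_eq_single j]
    · by_cases h : j ∈ z
      · have h1 : wordStep ω z j = ω * z.count j := rfl
        simp only [y, u, if_pos h, Pi.smul_apply, wordStep_singleton, if_true, h1, smul_eq_mul]
        ring
      · simp [u, h, wordStep, parikh, List.count_eq_zero.2 h]
    · intro i _ hij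
      by_cases h : i ∈ z
      · simp [u, if_pos h, wordStep_singleton, hij]
      · simp [u, if_neg h]
    · simp
  have h0 := hZ is y hy
  have hfun : (fun n : Fin k → ℕ => eval (fun j => (n j : ℚ) / m - 1) P) =
      fun y => Int.castAddHom ℚ (F (n + ψ y)) := by
    funext y
    rw [← hQ, ← hGQ, hG]
    rfl
  rw [hfun, mixedDiff_map, hψy, List.map_map] at h0
  have hmap : is.map (ψ ∘ fun i => Pi.single i 1) = is.map fun i => wordStep ω [i] := by
    refine List.map_congr_left fun i hi => ?_
    change ∑ j, (Pi.single i 1 : Fin k → ℕ) j • wordStep ω (u j) = _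
    rw [Finset.sum_eq_single i]
    · simp [u, if_pos (hray.2.1 i hi)]
    · intro j _ hji
      simp [Pi.single_eq_of_ne hji]
    · simp
  rw [hmap] at h0
  have h1 := hray.neg hF Z
  have h2 : (0 : ℤ) ≤ mixedDiff (is.map fun i => wordStep ω [i]) F (n + Z • wordStep ω z) := by
    rw [Int.coe_castAddHom] at h0
    beta_reduce at h0
    exact_mod_cast h0
  exact absurd h1 (not_lt.2 h2)

end Combinatorial

end NPolyreg

namespace NPolyreg

/-! ### Factorization sums by their first cut. -/

section Splittings

variable {α : Type*}

/-- The sum of `φ x y` over all splittings `w = x y`. -/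
def splitSum : List α → (List α → List α → ℤ) → ℤ
  | [], φ => φ [] []
  | a :: w, φ => φ [] (a :: w) + splitSum w fun x y => φ (a :: x) y

/-- The sum of `φ x y` over all splittings `w = x y` with `y` nonempty. -/
def properSplitSum : List α → (List α → List α → ℤ) → ℤ
  | [], _ => 0
  | a :: w, φ => φ [] (a :: w) + properSplitSum w fun x y => φ (a :: x) y

theorem splitSum_eq_sum_range (w : List α) (φ : List α → List α → ℤ) :
    splitSum w φ = ∑ i ∈ Finset.range (w.length + 1), φ (w.take i) (w.drop i) := by
  induction w generalizing φ with
  | nil => simp [splitSum]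
  | cons a w ih =>
    rw [splitSum, ih, List.length_cons, Finset.sum_range_succ' _ (w.length + 1), add_comm]
    rfl

theorem splitSum_append (u w : List α) (φ : List α → List α → ℤ) :
    splitSum (u ++ w) φ = properSplitSum u (fun x y => φ x (y ++ w)) +
      splitSum w fun x y => φ (u ++ x) y := by
  induction u generalizing φ with
  | nil => simp [properSplitSum]
  | cons a u ih => rw [List.cons_append, splitSum, ih, properSplitSum, add_assoc]; rfl

theorem properSplitSum_append (u w : List α) (φ : List α → List α → ℤ) :
    properSplitSum (u ++ w) φ = properSplitSum u (fun x y => φ x (y ++ w)) +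
      properSplitSum w fun x y => φ (u ++ x) y := by
  induction u generalizing φ with
  | nil => simp [properSplitSum]
  | cons a u ih => rw [List.cons_append, properSplitSum, ih, properSplitSum, add_assoc]; rfl

theorem properSplitSum_sub (w : List α) (φ ψ : List α → List α → ℤ) :
    properSplitSum w (fun x y => φ x y - ψ x y) = properSplitSum w φ - properSplitSum w ψ := by
  induction w generalizing φ ψ with
  | nil => simp [properSplitSum]
  | cons a w ih =>
    rw [properSplitSum, properSplitSum, properSplitSum,
      ih (fun x y => φ (a :: x) y) fun x y => ψ (a :: x) y]
    ring

theorem properSplitSum_mem {C : Set (List α → ℤ)} (h0 : 0 ∈ C)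
    (hadd : ∀ f ∈ C, ∀ g ∈ C, f + g ∈ C) (u : List α) (φ : List α → List α → List α → ℤ)
    (h : ∀ x y, φ x y ∈ C) : (fun w => properSplitSum u fun x y => φ x y w) ∈ C := by
  induction u generalizing φ with
  | nil => exact h0
  | cons a u ih => exact hadd _ (h _ _) _ (ih (fun x y => φ (a :: x) y) fun x y => h _ _)

theorem sum_factorizations_succ (n : ℕ) (φ : (Fin (n + 1) → List α) → ℤ) (w : List α) :
    ∑ u ∈ (finite_factorizations (n + 1) w).toFinset, φ u =
      splitSum w fun x y => ∑ u ∈ (finite_factorizations n y).toFinset, φ (Fin.cons x u) := by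
  rw [splitSum_eq_sum_range, Finset.sum_sigma']
  refine Finset.sum_bij' (fun u _ => ⟨(u 0).length, Fin.tail u⟩)
    (fun p _ => Fin.cons (w.take p.1) p.2) ?_ ?_ ?_ ?_ ?_
  · intro u hu
    rw [Set.Finite.mem_toFinset, Set.mem_ofPred_eq, List.ofFn_succ, List.flatten_cons] at hu
    rw [Finset.mem_sigma, Finset.mem_range, Set.Finite.mem_toFinset, Set.mem_ofPred_eq, ← hu]
    simp [Fin.tail_def]
  · intro p hp
    rw [Finset.mem_sigma, Finset.mem_range, Set.Finite.mem_toFinset, Set.mem_ofPred_eq] at hp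
    rw [Set.Finite.mem_toFinset, Set.mem_ofPred_eq, List.ofFn_succ, List.flatten_cons]
    simp [hp.2]
  · intro u hu
    rw [Set.Finite.mem_toFinset, Set.mem_ofPred_eq, List.ofFn_succ, List.flatten_cons] at hu
    have : w.take (u 0).length = u 0 := by simp [← hu]
    simp only [this]
    exact Fin.cons_self_tail u
  · intro p hp
    rw [Finset.mem_sigma, Finset.mem_range] at hp
    have : (w.take p.1).length = p.1 := by simp; omega
    simp only [Fin.cons_zero, Fin.tail_cons, this]
  · intro u hu
    rw [Set.Finite.mem_toFinset, Set.mem_ofPred_eq, List.ofFn_succ, List.flatten_cons] at hu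
    have : w.take (u 0).length = u 0 := by simp [← hu]
    simp only [this, Fin.cons_self_tail]

theorem sum_factorizations_one (φ : (Fin 1 → List α) → ℤ) (w : List α) :
    ∑ u ∈ (finite_factorizations 1 w).toFinset, φ u = φ fun _ => w := by
  have : (finite_factorizations 1 w).toFinset = {fun _ => w} := by
    ext u
    rw [Set.Finite.mem_toFinset, Set.mem_ofPred_eq, Finset.mem_singleton]
    constructor
    · intro h
      funext i
      rw [Subsingleton.elim i 0, ← h]
      simp
    · rintro rfl
      simp
  rw [this, Finset.sum_singleton]

variable {M : Type*} [Monoid M]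

theorem factorizationSum_zero (μ : FreeMonoid α →* M) (π : (Fin 1 → M) → ℤ) (w : List α) :
    factorizationSum μ π w = π fun _ => μ (FreeMonoid.ofList w) :=
  sum_factorizations_one _ w

theorem factorizationSum_succ {d : ℕ} (μ : FreeMonoid α →* M) (π : (Fin (d + 2) → M) → ℤ)
    (w : List α) : factorizationSum μ π w = splitSum w fun x y =>
      factorizationSum μ (fun m => π (Fin.cons (μ (FreeMonoid.ofList x)) m)) y := by
  rw [factorizationSum, sum_factorizations_succ]
  congr 1
  funext x y
  refine Finset.sum_congr rfl fun u _ => congrArg π ?_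
  funext i
  refine Fin.cases ?_ (fun i => ?_) i <;> simp

end Splittings

/-! ### Powers of words and ultimate periodicity. -/

section Powers

variable {α : Type*}

/-- The power of a word. -/
def wordPow (v : List α) (n : ℕ) : List α := (List.replicate n v).flatten

theorem wordPow_add (v : List α) (m n : ℕ) : wordPow v (m + n) = wordPow v m ++ wordPow v n := by
  rw [wordPow, List.replicate_add, List.flatten_append]; rfl

theorem map_wordPow {M : Type*} [Monoid M] (μ : FreeMonoid α →* M) (v : List α) (n : ℕ) :
    μ (FreeMonoid.ofList (wordPow v n)) = μ (FreeMonoid.ofList v) ^ n := by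
  induction n with
  | zero => simp [wordPow]
  | succ n ih =>
    rw [add_comm, wordPow_add, FreeMonoid.ofList_append, map_mul, ih, pow_add]
    simp [wordPow]

/-- In a finite monoid with `N` elements the powers from `N` on have period `N!`. -/
theorem pow_add_factorial_card {M : Type*} [Monoid M] [Finite M] (m : M) {n : ℕ}
    (hn : Nat.card M ≤ n) : m ^ (n + (Nat.card M).factorial) = m ^ n := by
  have := Fintype.ofFinite M
  rw [Nat.card_eq_fintype_card] at hn ⊢
  obtain ⟨a, b, hab, hm⟩ := Fintype.exists_ne_map_eq_of_card_lt
    (fun i : Fin (Fintype.card M + 1) => m ^ (i : ℕ)) (by simp)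
  wlog h : a < b generalizing a b
  · exact this b a hab.symm hm.symm (lt_of_le_of_ne (not_lt.1 h) hab.symm)
  obtain ⟨p, hp⟩ := Nat.exists_eq_add_of_lt h
  have hper : ∀ t, m ^ ((a : ℕ) + t * (p + 1)) = m ^ (a : ℕ) := by
    intro t
    induction t with
    | zero => simp
    | succ t ih =>
      have : (a : ℕ) + (t + 1) * (p + 1) = (a + t * (p + 1)) + (p + 1) := by ring
      rw [this, pow_add, ih, ← pow_add, ← add_assoc, ← hp]
      exact hm.symm
  -- The period `p + 1 = b - a` from the pigeonhole principle is at most the cardinality, so it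
  -- divides the factorial.
  have hb : (b : ℕ) ≤ Fintype.card M := Nat.le_of_lt_succ b.2
  obtain ⟨t, ht⟩ : p + 1 ∣ (Fintype.card M).factorial :=
    Nat.dvd_factorial (Nat.succ_pos p) (by omega)
  obtain ⟨r, hr⟩ := Nat.exists_eq_add_of_le (show (a : ℕ) ≤ n by omega)
  have : n + (Fintype.card M).factorial = (a + t * (p + 1)) + r := by rw [ht, hr]; ring
  rw [this, pow_add, hper, ← pow_add, hr]

end Powers

/-! ### Bounded degree of polyregular functions. -/

section Vanishing

variable {α : Type*}

/-- The functions on words that are annihilated by any `j` differences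
`f (u v^(N + ω) w) - f (u v^N w)`. -/
def Vanishing (N ω : ℕ) : ℕ → Set (List α → ℤ)
  | 0 => {0}
  | j + 1 => {f | ∀ u v, (fun w => f (u ++ (wordPow v (N + ω) ++ w)) - f (u ++ (wordPow v N ++ w))) ∈
      Vanishing N ω j}

theorem Vanishing.zero_mem {N ω : ℕ} (j : ℕ) : (0 : List α → ℤ) ∈ Vanishing N ω j := by
  induction j with
  | zero => exact rfl
  | succ j ih =>
    intro u v
    simp only [Pi.zero_apply, sub_self]
    exact ih

theorem Vanishing.add {N ω j : ℕ} {f g : List α → ℤ} (hf : f ∈ Vanishing N ω j)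
    (hg : g ∈ Vanishing N ω j) : f + g ∈ Vanishing N ω j := by
  induction j generalizing f g with
  | zero =>
    obtain rfl : f = 0 := hf
    obtain rfl : g = 0 := hg
    exact add_zero _
  | succ j ih =>
    intro u v
    convert ih (hf u v) (hg u v) using 1
    funext w
    simp only [Pi.add_apply]
    ring

theorem Vanishing.neg {N ω j : ℕ} {f : List α → ℤ} (hf : f ∈ Vanishing N ω j) :
    -f ∈ Vanishing N ω j := by
  induction j generalizing f with
  | zero =>
    obtain rfl : f = 0 := hf
    exact neg_zero
  | succ j ih =>
    intro u v
    convert ih (hf u v) using 1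
    funext w
    simp only [Pi.neg_apply]
    ring

theorem Vanishing.translate {N ω j : ℕ} {f : List α → ℤ} (hf : f ∈ Vanishing N ω j)
    (u : List α) : (fun w => f (u ++ w)) ∈ Vanishing N ω j := by
  cases j with
  | zero =>
    obtain rfl : f = 0 := hf
    exact rfl
  | succ j =>
    intro u' v
    simpa using hf (u ++ u') v

/-- If the first cut falls into `w`, the first factor contains the whole pumped power and its image
does not change, so these terms cancel. The remaining terms are finitely many translates of
factorization sums with one factor fewer, to which induction applies. -/
theorem factorizationSum_mem_vanishing {M : Type*} [Monoid M] [Finite M] {d : ℕ}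
    (μ : FreeMonoid α →* M) (π : (Fin (d + 1) → M) → ℤ) :
    factorizationSum μ π ∈ Vanishing (Nat.card M) (Nat.card M).factorial (d + 1) := by
  have hμ : ∀ u v w : List α,
      μ (FreeMonoid.ofList (u ++ (wordPow v (Nat.card M + (Nat.card M).factorial) ++ w))) =
        μ (FreeMonoid.ofList (u ++ (wordPow v (Nat.card M) ++ w))) := fun u v w => by
    simp only [FreeMonoid.ofList_append, map_mul, map_wordPow, pow_add_factorial_card _ le_rfl]
  induction d with
  | zero =>
    intro u v
    change _ = 0
    funext w
    simp only [factorizationSum_zero, hμ, sub_self, Pi.zero_apply]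
  | succ d ih =>
    intro u v
    have hmem : ∀ u, (fun w => properSplitSum u fun x y => factorizationSum μ
        (fun m => π (Fin.cons (μ (FreeMonoid.ofList x)) m)) (y ++ w)) ∈
          Vanishing (α := α) (Nat.card M) (Nat.card M).factorial (d + 1) := fun u =>
      properSplitSum_mem (Vanishing.zero_mem _) (fun f hf g hg => Vanishing.add hf hg) u
        (fun x y w => factorizationSum μ (fun m => π (Fin.cons (μ (FreeMonoid.ofList x)) m))
          (y ++ w)) fun x y => Vanishing.translate (ih _) y
    convert Vanishing.add (hmem (u ++ wordPow v (Nat.card M + (Nat.card M).factorial)))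
      (Vanishing.neg (hmem (u ++ wordPow v (Nat.card M)))) using 1
    funext w
    simp only [factorizationSum_succ, Pi.add_apply, Pi.neg_apply]
    rw [← List.append_assoc, ← List.append_assoc, splitSum_append, splitSum_append]
    simp only [List.append_assoc, hμ]
    ring

/-- For a function of letter counts, pumping the one-letter word `[i]` is a forward difference
translated by `N` copies of `i`. The translations add up to `N • parikh is`. -/
theorem mixedDiff_eq_zero_of_vanishing [DecidableEq α] {N ω : ℕ} (is : List α) :
    ∀ F : (α → ℕ) → ℤ, (fun w => F (parikh w)) ∈ Vanishing N ω is.length →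
      ∀ w : List α, mixedDiff (is.map fun i => wordStep ω [i]) F (parikh w + N • parikh is) = 0 := by
  induction is with
  | nil => exact fun F hF w => by simpa using congrFun (show _ = _ from hF) w
  | cons i is ih =>
    intro F hF w
    have h := ih (fun n => fwdDiff (wordStep ω [i]) F (n + N • parikh [i])) (by
      convert hF [] [i] using 1
      funext w
      simp only [fwdDiff, List.nil_append, parikh_append, wordStep, wordPow,
        parikh_replicate_flatten, add_smul]
      congr 2 <;> abel) w
    rw [mixedDiff_translate] at h
    rw [List.map_cons, mixedDiff_cons, parikh_cons, smul_add, add_comm (N • parikh [i]), ← add_assoc]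
    exact h

theorem hasDegreeLE_of_commutative [DecidableEq α] [Fintype α] {M : Type*} [Monoid M] [Finite M]
    {d : ℕ} (μ : FreeMonoid α →* M) (π : (Fin (d + 1) → M) → ℤ) {F : (α → ℕ) → ℤ}
    (hF : ∀ w, factorizationSum μ π w = F (parikh w)) :
    HasDegreeLE (Nat.card M).factorial (Nat.card M * (d + 1)) d F := by
  refine hasDegreeLE_of_length_eq fun n is his hi => ?_
  -- A letter occurs at most `d + 1` times in `is`; this explains the threshold.
  have hle : Nat.card M • parikh is ≤ n := by
    intro i
    by_cases h : i ∈ is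
    · exact (Nat.mul_le_mul_left _ (his ▸ List.count_le_length)).trans (hi i h)
    · simp [parikh, List.count_eq_zero.2 h]
  obtain ⟨w, hw⟩ := exists_parikh_eq (n - Nat.card M • parikh is)
  have h := mixedDiff_eq_zero_of_vanishing (N := Nat.card M) (ω := (Nat.card M).factorial) is F
    (by
      rw [his]
      simp only [← hF]
      exact factorizationSum_mem_vanishing μ π) w
  rwa [hw, tsub_add_cancel_of_le hle] at h

end Vanishing

/-! ### Nonnegative differences of `ℕ`-polyregular functions. -/

section Positivity

variable {α : Type*}

/-- The functions on words for which up to `n` iterated differences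
`f (u v^(s + ω) w) - f (u v^s w)` are nonnegative. -/
def Positive (s ω : ℕ) : ℕ → Set (List α → ℤ)
  | 0 => {f | 0 ≤ f}
  | n + 1 => {f | 0 ≤ f ∧ ∀ u v,
      (fun w => f (u ++ (wordPow v (s + ω) ++ w)) - f (u ++ (wordPow v s ++ w))) ∈ Positive s ω n}

theorem Positive.zero_mem {s ω : ℕ} (n : ℕ) : (0 : List α → ℤ) ∈ Positive s ω n := by
  induction n with
  | zero => exact le_rfl (a := (0 : List α → ℤ))
  | succ n ih =>
    refine ⟨le_rfl, fun u v => ?_⟩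
    simp only [Pi.zero_apply, sub_self]
    exact ih

theorem Positive.add {s ω n : ℕ} {f g : List α → ℤ} (hf : f ∈ Positive s ω n)
    (hg : g ∈ Positive s ω n) : f + g ∈ Positive s ω n := by
  induction n generalizing f g with
  | zero => exact add_nonneg (α := List α → ℤ) hf hg
  | succ n ih =>
    refine ⟨add_nonneg hf.1 hg.1, fun u v => ?_⟩
    convert ih (hf.2 u v) (hg.2 u v) using 1
    funext w
    simp only [Pi.add_apply]
    ring

theorem Positive.translate {s ω n : ℕ} {f : List α → ℤ} (hf : f ∈ Positive s ω n)
    (u : List α) : (fun w => f (u ++ w)) ∈ Positive s ω n := by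
  cases n with
  | zero => exact fun w => hf (u ++ w)
  | succ n => exact ⟨fun w => hf.1 (u ++ w), fun u' v => by simpa using hf.2 (u ++ u') v⟩

theorem Positive.mono {s t ω n : ℕ} (hst : s ≤ t) {f : List α → ℤ} (hf : f ∈ Positive s ω n) :
    f ∈ Positive t ω n := by
  obtain ⟨r, rfl⟩ := Nat.exists_eq_add_of_le hst
  induction n generalizing f with
  | zero => exact hf
  | succ n ih =>
    refine ⟨hf.1, fun u v => ih ?_⟩
    convert Positive.translate (hf.2 u v) (wordPow v r) using 1
    funext w
    simp only [add_right_comm s r ω, wordPow_add, List.append_assoc]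

/-- Write the pumped words as `u v^N X w` with `X = v^(s + ω)` and `X = v^s`. First cuts in `w`
cancel. First cuts in `u v^N` give differences of sums with one factor fewer, positive by induction.
For first cuts in `X`, split `v^(s + ω) = v^ω v^s`: cuts in the second part match those of `v^s`,
since `v^(N + ω)` and `v^N` have the same image. Cuts in the extra `v^ω` remain as nonnegative
terms. -/
theorem factorizationSum_mem_positive {M : Type*} [Monoid M] [Finite M] {d : ℕ}
    (μ : FreeMonoid α →* M) (π : (Fin (d + 1) → M) → ℤ) (hπ : 0 ≤ π) (n : ℕ) :
    factorizationSum μ π ∈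
      Positive (Nat.card M * (d + 1)) (Nat.card M).factorial n := by
  have hμ : ∀ (s : ℕ) (u v w : List α), Nat.card M ≤ s →
      μ (FreeMonoid.ofList (u ++ (wordPow v (s + (Nat.card M).factorial) ++ w))) =
        μ (FreeMonoid.ofList (u ++ (wordPow v s ++ w))) := fun s u v w h => by
    simp only [FreeMonoid.ofList_append, map_mul, map_wordPow, pow_add_factorial_card _ h]
  have hnn : ∀ {d : ℕ} (π : (Fin (d + 1) → M) → ℤ), 0 ≤ π → 0 ≤ factorizationSum μ π :=
    fun π hπ w => Finset.sum_nonneg fun u _ => hπ _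
  induction d generalizing n with
  | zero =>
    rcases n with _ | n
    · exact hnn π hπ
    · refine ⟨hnn π hπ, fun u v => ?_⟩
      convert Positive.zero_mem n using 1
      funext w
      rw [factorizationSum_zero, factorizationSum_zero, hμ _ _ _ _ (by simp), sub_self]
      rfl
  | succ d ih =>
    rcases n with _ | n
    · exact hnn π hπ
    refine ⟨hnn π hπ, fun u v => Positive.mono (s := Nat.card M * (d + 1)) (by
      exact Nat.mul_le_mul_left _ (Nat.le_succ _)) ?_⟩
    set N := Nat.card M
    set s := N * (d + 1)
    set g : M → List α → ℤ := fun m => factorizationSum μ fun ms => π (Fin.cons m ms)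
    have hg : ∀ m n, g m ∈ Positive s N.factorial n := fun m n => ih _ (fun ms => hπ _) n
    have h1 : (fun w => properSplitSum (u ++ wordPow v N) fun x y =>
        g (μ (FreeMonoid.ofList x)) (y ++ (wordPow v (s + N.factorial) ++ w)) -
          g (μ (FreeMonoid.ofList x)) (y ++ (wordPow v s ++ w))) ∈
        Positive s N.factorial n :=
      properSplitSum_mem (Positive.zero_mem _) (fun f hf g hg => Positive.add hf hg) _
        (fun x y w => g (μ (FreeMonoid.ofList x)) (y ++ (wordPow v (s + N.factorial) ++ w)) -
          g (μ (FreeMonoid.ofList x)) (y ++ (wordPow v s ++ w)))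
        fun x y => (hg _ (n + 1)).2 y v
    have h2 : (fun w => properSplitSum (wordPow v N.factorial) fun x y =>
        g (μ (FreeMonoid.ofList (u ++ wordPow v N ++ x))) (y ++ wordPow v s ++ w)) ∈
        Positive s N.factorial n :=
      properSplitSum_mem (Positive.zero_mem _) (fun f hf g hg => Positive.add hf hg) _
        (fun x y w => g (μ (FreeMonoid.ofList (u ++ wordPow v N ++ x))) (y ++ wordPow v s ++ w))
        fun x y => Positive.translate (hg _ n) _
    convert Positive.add h1 h2 using 1
    funext w
    have e : N * (d + 1 + 1) = N + s := by ring
    have hs : splitSum w (fun x y => g (μ (FreeMonoid.ofList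
        (u ++ wordPow v N ++ wordPow v (s + N.factorial) ++ x))) y) =
        splitSum w fun x y => g (μ (FreeMonoid.ofList (u ++ wordPow v N ++ wordPow v s ++ x))) y := by
      have h := hμ (N + s) u v
      simp only [add_assoc, wordPow_add v N] at h
      congr 1
      funext x y
      have := h x (by omega)
      simp only [List.append_assoc] at this ⊢
      rw [this]
    have hp : properSplitSum (wordPow v s) (fun x y => g (μ (FreeMonoid.ofList
        (u ++ wordPow v N ++ (wordPow v N.factorial ++ x)))) (y ++ w)) =
        properSplitSum (wordPow v s) fun x y => g (μ (FreeMonoid.ofList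
          (u ++ wordPow v N ++ x))) (y ++ w) := by
      congr 1
      funext x y
      have := hμ N u v x le_rfl
      rw [wordPow_add] at this
      simp only [List.append_assoc] at this ⊢
      rw [this]
    have split : ∀ X : List α, factorizationSum μ π (u ++ wordPow v N ++ X ++ w) =
        properSplitSum (u ++ wordPow v N) (fun x y => g (μ (FreeMonoid.ofList x)) (y ++ (X ++ w))) +
        properSplitSum X (fun x y => g (μ (FreeMonoid.ofList (u ++ wordPow v N ++ x))) (y ++ w)) +
        splitSum w (fun x y => g (μ (FreeMonoid.ofList (u ++ wordPow v N ++ X ++ x))) y) := by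
      intro X
      rw [factorizationSum_succ, splitSum_append, properSplitSum_append]
      simp only [List.append_assoc, g]
    have hl := split (wordPow v (s + N.factorial))
    have hr := split (wordPow v s)
    rw [hs] at hl
    rw [show properSplitSum (wordPow v (s + N.factorial)) (fun x y => g (μ (FreeMonoid.ofList
        (u ++ wordPow v N ++ x))) (y ++ w)) = properSplitSum (wordPow v N.factorial) (fun x y =>
        g (μ (FreeMonoid.ofList (u ++ wordPow v N ++ x))) (y ++ wordPow v s ++ w)) +
        properSplitSum (wordPow v s) (fun x y => g (μ (FreeMonoid.ofList
          (u ++ wordPow v N ++ x))) (y ++ w)) by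
      rw [add_comm s, wordPow_add, properSplitSum_append, hp]] at hl
    rw [Pi.add_apply, properSplitSum_sub, e, add_assoc N s, wordPow_add v N (s + N.factorial),
      wordPow_add v N s]
    simp only [← List.append_assoc] at hl hr ⊢
    rw [hl, hr]
    ring

theorem mixedDiff_nonneg_of_positive [DecidableEq α] {s ω : ℕ} (is : List α) :
    ∀ F : (α → ℕ) → ℤ, (fun w => F (parikh w)) ∈ Positive s ω is.length →
      ∀ w : List α, 0 ≤ mixedDiff (is.map fun i => wordStep ω [i]) F (parikh w + s • parikh is) := by
  induction is with
  | nil => exact fun F hF w => by simpa using hF w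
  | cons i is ih =>
    intro F hF w
    have h := ih (fun n => fwdDiff (wordStep ω [i]) F (n + s • parikh [i])) (by
      convert hF.2 [] [i] using 1
      funext w
      simp only [fwdDiff, List.nil_append, parikh_append, wordStep, wordPow,
        parikh_replicate_flatten, add_smul]
      congr 2 <;> abel) w
    rw [mixedDiff_translate] at h
    rw [List.map_cons, mixedDiff_cons, parikh_cons, smul_add, add_comm (s • parikh [i]), ← add_assoc]
    exact h

theorem nonnegDiff_of_commutative [DecidableEq α] [Fintype α] {M : Type*} [Monoid M] [Finite M]
    {d : ℕ} (μ : FreeMonoid α →* M) (π : (Fin (d + 1) → M) → ℤ) (hπ : 0 ≤ π) {F : (α → ℕ) → ℤ}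
    (hF : ∀ w, factorizationSum μ π w = F (parikh w)) :
    NonnegDiff (Nat.card M).factorial (Nat.card M * (d + 1) * (d + 1)) F := by
  intro n is _ hi
  have hT : Nat.card M * (d + 1) ≤ Nat.card M * (d + 1) * (d + 1) :=
    Nat.le_mul_of_pos_right _ (Nat.succ_pos d)
  -- Lists of at most `d` letters need `N (d + 1)` copies of a letter per occurrence; differences
  -- along longer lists vanish.
  rcases le_or_gt is.length d with hd | hd
  · have hle : (Nat.card M * (d + 1)) • parikh is ≤ n := by
      intro i
      by_cases h : i ∈ is
      · exact (Nat.mul_le_mul_left _ ((List.count_le_length (a := i)).trans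
          (hd.trans (Nat.le_succ d)))).trans (hi i h)
      · simp [parikh, List.count_eq_zero.2 h]
    obtain ⟨w, hw⟩ := exists_parikh_eq (n - (Nat.card M * (d + 1)) • parikh is)
    have h := mixedDiff_nonneg_of_positive (s := Nat.card M * (d + 1))
      (ω := (Nat.card M).factorial) is F (by
        simp only [← hF]
        exact factorizationSum_mem_positive μ π hπ _) w
    rwa [hw, tsub_add_cancel_of_le hle] at h
  · exact (AddSubmonoid.mem_bot.1 (hasDegreeLE_of_commutative μ π hF n is hd
      fun i h => hT.trans (hi i h))).ge

end Positivity

end NPolyreg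

namespace NPolyreg

/-! ### Renaming of letters. -/

section Transport

variable {α β : Type*}

theorem splitSum_map (g : α → β) (w : List α) (φ : List β → List β → ℤ) :
    splitSum (w.map g) φ = splitSum w fun x y => φ (x.map g) (y.map g) := by
  induction w generalizing φ with
  | nil => rfl
  | cons a w ih => simp only [List.map_cons, splitSum, ih, List.map_nil]

theorem toFinset_factorizations_zero [DecidableEq α] (v : List α) :
    (finite_factorizations 0 v).toFinset = if v = [] then {default} else ∅ := by
  ext u
  rw [Set.Finite.mem_toFinset, Set.mem_ofPred_eq, Subsingleton.elim u default]
  split_ifs with hv <;> simp [hv, eq_comm]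

theorem sum_factorizations_map (g : α → β) (n : ℕ) (φ : (Fin n → List β) → ℤ) (w : List α) :
    ∑ u ∈ (finite_factorizations n (w.map g)).toFinset, φ u =
      ∑ u ∈ (finite_factorizations n w).toFinset, φ fun i => (u i).map g := by
  classical
  induction n generalizing w with
  | zero =>
    rw [toFinset_factorizations_zero, toFinset_factorizations_zero]
    by_cases hw : w = []
    · rw [if_pos hw, if_pos (by simp [hw]), Finset.sum_singleton, Finset.sum_singleton]
      exact congrArg φ (Subsingleton.elim _ _)
    · rw [if_neg hw, if_neg (by simp [hw]), Finset.sum_empty, Finset.sum_empty]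
  | succ n ih =>
    rw [sum_factorizations_succ, sum_factorizations_succ, splitSum_map]
    congr 1
    funext x y
    rw [ih]
    refine Finset.sum_congr rfl fun u _ => congrArg φ ?_
    funext i
    refine Fin.cases ?_ (fun i => ?_) i <;> simp

theorem factorizationSum_map {M : Type*} [Monoid M] {d : ℕ} (g : α → β) (μ : FreeMonoid β →* M)
    (π : (Fin (d + 1) → M) → ℤ) (w : List α) :
    factorizationSum μ π (w.map g) = factorizationSum (μ.comp (FreeMonoid.map g)) π w :=
  sum_factorizations_map g (d + 1) (fun u => π fun i => μ (FreeMonoid.ofList (u i))) w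

end Transport

/-! ### Newton's formula as a sum over sublists. -/

section SublistSum

/-- The sum of `φ` over the sublists of length less than `n`. -/
def sublistSum : ℕ → (List ℕ → ℤ) → List ℕ → ℤ
  | 0, _, _ => 0
  | _ + 1, φ, [] => φ []
  | n + 1, φ, c :: L => sublistSum (n + 1) φ L + sublistSum n (fun is => φ (c :: is)) L

/-- This is the expansion of the product of the shifts `1 + Δ_c` over `c` in `L`. All coefficients
are `1`, and sublists are counted by position, so the terms can be matched with factorizations of a
word. -/
theorem eq_sublistSum_of_vanish {A : Type*} [AddCommMonoid A] (step : ℕ → A) (a : A) (L : List ℕ) :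
    ∀ (n : ℕ) (f : A → ℤ), (∀ is : List ℕ, is ⊆ L → n ≤ is.length →
      mixedDiff (is.map step) f a = 0) →
      f (a + (L.map step).sum) = sublistSum n (fun is => mixedDiff (is.map step) f a) L := by
  induction L with
  | nil =>
    intro n f h
    rcases n with _ | n
    · simpa [sublistSum] using h [] (List.Subset.refl _) le_rfl
    · simp [sublistSum]
  | cons c L ih =>
    intro n f h
    have e : f (a + ((c :: L).map step).sum) =
        f (a + (L.map step).sum) + fwdDiff (step c) f (a + (L.map step).sum) := by
      simp only [fwdDiff, List.map_cons, List.sum_cons]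
      rw [add_comm (step c), add_assoc]
      ring
    rw [e]
    rcases n with _ | n
    · rw [ih 0 f fun is hi hn => h is (List.Subset.trans hi (List.subset_cons_self c L)) hn,
        ih 0 (fwdDiff (step c) f) fun is hi _ =>
          h (c :: is) (List.cons_subset_cons c hi) (Nat.zero_le _)]
      simp [sublistSum]
    · rw [ih (n + 1) f fun is hi hn => h is (List.Subset.trans hi (List.subset_cons_self c L)) hn,
        ih n (fwdDiff (step c) f) fun is hi hn =>
          h (c :: is) (List.cons_subset_cons c hi) (by simpa using hn)]
      rfl

end SublistSum

/-! ### Counting with a threshold and a period. -/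

section Truncation

/-- The representative below `ℓ + ω` of a number modulo the congruence with index `ℓ` and
period `ω`. -/
def trunc (ℓ ω n : ℕ) : ℕ := if n < ℓ then n else ℓ + (n - ℓ) % ω

variable {ℓ ω : ℕ}

theorem trunc_lt (hω : 1 ≤ ω) (n : ℕ) : trunc ℓ ω n < ℓ + ω := by
  have := Nat.mod_lt (n - ℓ) hω
  unfold trunc
  split_ifs <;> omega

theorem trunc_of_lt {n : ℕ} (h : n < ℓ + ω) : trunc ℓ ω n = n := by
  unfold trunc
  split_ifs with h'
  · rfl
  · rw [Nat.mod_eq_of_lt (by omega)]; omega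

theorem trunc_trunc_add (a b : ℕ) : trunc ℓ ω (trunc ℓ ω a + b) = trunc ℓ ω (a + b) := by
  by_cases ha : a < ℓ
  · rw [show trunc ℓ ω a = a from if_pos ha]
  · have h1 : trunc ℓ ω a = ℓ + (a - ℓ) % ω := if_neg ha
    have h2 : ℓ + (a - ℓ) % ω + b - ℓ = (a - ℓ) % ω + b := by omega
    have h3 : a + b - ℓ = (a - ℓ) + b := by omega
    rw [h1, trunc, trunc, if_neg (by omega), if_neg (by omega), h2, h3, Nat.mod_add_mod]

theorem trunc_add_trunc (a b : ℕ) : trunc ℓ ω (a + trunc ℓ ω b) = trunc ℓ ω (a + b) := by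
  rw [add_comm, trunc_trunc_add, add_comm]

theorem trunc_eq_zero_iff (hℓ : 1 ≤ ℓ) {n : ℕ} : trunc ℓ ω n = 0 ↔ n = 0 := by
  unfold trunc
  split_ifs <;> omega

/-- Distinct numbers are identified only in the periodic part. -/
theorem le_trunc_of_eq {m n : ℕ} (h : trunc ℓ ω m = trunc ℓ ω n) (hmn : m < n) :
    ℓ ≤ trunc ℓ ω n := by
  unfold trunc at *
  split_ifs at * <;> omega

/-- Passing from `m ≥ ℓ` to `m + ω` adds exactly the number `m` to the smaller members of the class.
As `ℓ ≥ 1`, zero is alone in its class, and counting can begin at `1`. -/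
theorem card_filter_trunc_eq (hω : 1 ≤ ω) (hℓ : 1 ≤ ℓ) (n : ℕ) :
    trunc ℓ ω n + ω * ((Finset.Ico 1 n).filter fun c => trunc ℓ ω c = trunc ℓ ω n).card = n := by
  induction n using Nat.strong_induction_on with
  | _ n ih =>
    by_cases hn : n < ℓ + ω
    · rw [Finset.filter_eq_empty_iff.2, Finset.card_empty, mul_zero, add_zero, trunc_of_lt hn]
      intro c hc
      rw [Finset.mem_Ico] at hc
      rw [trunc_of_lt hn, trunc_of_lt (by omega)]
      omega
    · obtain ⟨m, rfl⟩ := Nat.exists_eq_add_of_le' (show ω ≤ n by omega)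
      have hm : ℓ ≤ m := by omega
      have htr : ∀ c, ℓ ≤ c → trunc ℓ ω c = ℓ + (c - ℓ) % ω := fun c hc => if_neg (by omega)
      have ht : trunc ℓ ω (m + ω) = trunc ℓ ω m := by
        rw [htr m hm, htr _ (by omega), show m + ω - ℓ = m - ℓ + ω by omega, Nat.add_mod_right]
      have hlast : (Finset.Ico m (m + ω)).filter (fun c => trunc ℓ ω c = trunc ℓ ω m) = {m} := by
        ext c
        simp only [Finset.mem_filter, Finset.mem_Ico, Finset.mem_singleton]
        constructor
        · rintro ⟨⟨h1, h2⟩, h3⟩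
          rw [htr c (by omega), htr m hm] at h3
          have h4 : ((c - ℓ) : ℕ) ≡ m - ℓ [MOD ω] := Nat.add_left_cancel h3
          have h5 := (Nat.modEq_iff_dvd' (show m - ℓ ≤ c - ℓ by omega)).1 h4.symm
          have h6 := Nat.eq_zero_of_dvd_of_lt h5 (by omega)
          omega
        · rintro rfl
          omega
      have hd : Disjoint ((Finset.Ico 1 m).filter fun c => trunc ℓ ω c = trunc ℓ ω m) {m} := by
        simp
      rw [ht, ← Finset.Ico_union_Ico_eq_Ico (show 1 ≤ m by omega) (show m ≤ m + ω by omega),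
        Finset.filter_union, hlast, Finset.card_union_of_disjoint hd, Finset.card_singleton,
        mul_add, ← add_assoc, ih m (by omega), mul_one]

end Truncation

/-! ### Marked positions and the factorizations that select them. -/

section Marks

variable (ℓ ω : ℕ)

/-- The last letter of the factor `x` of `W = p x y` closes a block. -/
def IsMark (W p y : List ℕ) (i : ℕ) : Prop :=
  i ∈ y ∧ trunc ℓ ω (p.count i) = trunc ℓ ω (W.count i)

instance (W p y : List ℕ) (i : ℕ) : Decidable (IsMark ℓ ω W p y i) :=
  inferInstanceAs (Decidable (_ ∧ _))

/-- The letters that close the blocks of `W` in its suffix `v` after `p`. -/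
def marks (W : List ℕ) : List ℕ → List ℕ → List ℕ
  | _, [] => []
  | p, c :: v => if IsMark ℓ ω W (p ++ [c]) v c then c :: marks W (p ++ [c]) v
      else marks W (p ++ [c]) v

variable {ℓ ω}

theorem le_trunc_of_mem_marks {W : List ℕ} {i : ℕ} (v : List ℕ) : ∀ p, p ++ v = W →
    i ∈ marks ℓ ω W p v → ℓ ≤ trunc ℓ ω (W.count i) := by
  induction v with
  | nil => intro p _ hi; simp [marks] at hi
  | cons c v ih =>
    intro p hW hi
    have hW' : p ++ [c] ++ v = W := by simpa using hW
    rw [marks] at hi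
    split_ifs at hi with h
    · rcases List.mem_cons.1 hi with rfl | hi
      · refine le_trunc_of_eq h.2 ?_
        have h1 : W.count i = (p ++ [i]).count i + v.count i := by rw [← hW', List.count_append]
        have := List.count_pos_iff.2 h.1
        omega
      · exact ih _ hW' hi
    · exact ih _ hW' hi

theorem marks_subset {W : List ℕ} (v : List ℕ) : ∀ p, marks ℓ ω W p v ⊆ v := by
  induction v with
  | nil => intro p; simp [marks]
  | cons c v ih =>
    intro p
    rw [marks]
    split_ifs
    · exact List.cons_subset_cons c (ih _)
    · exact List.Subset.trans (ih _) (List.subset_cons_self c v)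

/-- Marked occurrences of `i` correspond to the running counts with the truncation of the total
count. Requiring a later occurrence of `i` excludes the last one, hence the half-open interval. -/
theorem count_marks {W : List ℕ} (i : ℕ) (v : List ℕ) : ∀ p, p ++ v = W →
    (marks ℓ ω W p v).count i = ((Finset.Ico (p.count i + 1) (W.count i)).filter
      fun c => trunc ℓ ω c = trunc ℓ ω (W.count i)).card := by
  induction v with
  | nil =>
    intro p hW
    rw [← hW, List.append_nil, Finset.Ico_eq_empty (by omega)]
    simp [marks]
  | cons c v ih =>
    intro p hW
    have hW' : p ++ [c] ++ v = W := by simpa using hW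
    have ih := ih _ hW'
    by_cases hc : c = i
    · subst hc
      have hp : (p ++ [c]).count c = p.count c + 1 := by simp
      have hWc : W.count c = p.count c + 1 + v.count c := by rw [← hW', List.count_append, hp]
      rw [hp] at ih
      by_cases hv : c ∈ v
      · have hpos := List.count_pos_iff.2 hv
        rw [← Finset.insert_Ico_add_one_left_eq_Ico (by omega), Finset.filter_insert, marks]
        by_cases ht : trunc ℓ ω (p.count c + 1) = trunc ℓ ω (W.count c)
        · rw [if_pos ⟨hv, hp ▸ ht⟩, if_pos ht, Finset.card_insert_of_notMem (by simp),
            List.count_cons_self, ih]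
        · rw [if_neg fun h => ht (hp ▸ h.2), if_neg ht, ih]
      · have h0 : v.count c = 0 := List.count_eq_zero.2 hv
        rw [Finset.Ico_eq_empty (by omega)] at ih ⊢
        rw [marks, if_neg fun h => hv h.1, ih]
    · have hp : (p ++ [c]).count i = p.count i := by
        simp [hc]
      rw [hp] at ih
      rw [marks]
      split_ifs
      · rw [List.count_cons_of_ne hc, ih]
      · exact ih

theorem trunc_add_count_marks (hω : 1 ≤ ω) (hℓ : 1 ≤ ℓ) (W : List ℕ) (i : ℕ) :
    trunc ℓ ω (W.count i) + ω * (marks ℓ ω W [] W).count i = W.count i := by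
  rw [count_marks i W [] (List.nil_append W)]
  exact card_filter_trunc_eq hω hℓ _

/-- One more than the last letter of a word, and `0` for the empty word. -/
def lastCode (w : List ℕ) : ℕ := w.foldl (fun _ a => a + 1) 0

theorem lastCode_append (u v : List ℕ) :
    lastCode (u ++ v) = if lastCode v = 0 then lastCode u else lastCode v := by
  rcases v.eq_nil_or_concat with rfl | ⟨v, a, rfl⟩
  · simp [lastCode]
  · simp [lastCode]

variable (ℓ ω) in
/-- The contribution of the factor with number `j` of a factorization `us` to the list of letters
that close blocks at the ends of the factors. -/
def wordSlot (W p : List ℕ) (us : List (List ℕ)) (j : ℕ) (acc : Option (List ℕ)) :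
    Option (List ℕ) :=
  if (us.drop (j + 1)).flatten = [] then acc
  else if lastCode (us.getD j []) ≠ 0 ∧ IsMark ℓ ω W (p ++ (us.take (j + 1)).flatten)
      (us.drop (j + 1)).flatten (lastCode (us.getD j []) - 1)
    then acc.map ((lastCode (us.getD j []) - 1) :: ·)
  else none

variable (ℓ ω) in
/-- The value that a factorization contributes. -/
def wordValue (W p : List ℕ) (n : ℕ) (φ : List ℕ → ℤ) (us : List (List ℕ)) : ℤ :=
  ((List.range n).foldr (wordSlot ℓ ω W p us) (some [])).elim 0 φ

theorem wordValue_cons (W p : List ℕ) (n : ℕ) (φ : List ℕ → ℤ) (x : List ℕ) (us : List (List ℕ)) :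
    wordValue ℓ ω W p (n + 1) φ (x :: us) =
      if us.flatten = [] then wordValue ℓ ω W (p ++ x) n φ us
      else if lastCode x ≠ 0 ∧ IsMark ℓ ω W (p ++ x) us.flatten (lastCode x - 1) then
        wordValue ℓ ω W (p ++ x) n (fun is => φ ((lastCode x - 1) :: is)) us
      else 0 := by
  have hshift : (List.map Nat.succ (List.range n)).foldr (wordSlot ℓ ω W p (x :: us)) (some []) =
      (List.range n).foldr (wordSlot ℓ ω W (p ++ x) us) (some []) := by
    rw [List.foldr_map]
    congr 1
    funext j acc
    simp only [wordSlot, Nat.succ_eq_add_one, List.drop_succ_cons, List.take_succ_cons,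
      List.flatten_cons, List.append_assoc, List.getD_cons_succ]
  rw [wordValue, List.range_succ_eq_map, List.foldr_cons, hshift, wordSlot]
  simp only [zero_add, List.drop_succ_cons, List.drop_zero, List.getD_cons_zero,
    List.take_succ_cons, List.take_zero, List.flatten_cons, List.flatten_nil, List.append_nil]
  split_ifs
  · rfl
  · rw [wordValue]
    cases (List.range n).foldr (wordSlot ℓ ω W (p ++ x) us) (some []) <;> rfl
  · rfl

/-- A first cut right after a marked letter chooses that letter as the first entry of the sublist. A
cut at the end of the word chooses nothing, and all other cuts contribute zero. Thus each short
sublist of marks comes from one factorization, whose unused cuts all lie at the end. -/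
theorem splitSum_marks (W : List ℕ) (n : ℕ) (φ : List ℕ → ℤ) (v : List ℕ) : ∀ p : List ℕ,
    (splitSum v fun x y => if y = [] then φ [] else
      if lastCode x ≠ 0 ∧ IsMark ℓ ω W (p ++ x) y (lastCode x - 1) then
        sublistSum (n + 1) (fun is => φ ((lastCode x - 1) :: is)) (marks ℓ ω W (p ++ x) y)
      else 0) = sublistSum (n + 2) φ (marks ℓ ω W p v) := by
  induction v with
  | nil => intro p; simp [splitSum, marks, sublistSum]
  | cons c v ih =>
    intro p
    have hl0 : lastCode [] = 0 := rfl
    have hl1 : lastCode [c] = c + 1 := rfl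
    rcases v with _ | ⟨c', v⟩
    · simp [splitSum, marks, IsMark, sublistSum, hl0]
    · have ih := ih (p ++ [c])
      have hl2 : ∀ x, lastCode (c :: c' :: x) = lastCode (c' :: x) := fun x => rfl
      have hm : marks ℓ ω W p (c :: c' :: v) = if IsMark ℓ ω W (p ++ [c]) (c' :: v) c then
          c :: marks ℓ ω W (p ++ [c]) (c' :: v) else marks ℓ ω W (p ++ [c]) (c' :: v) := rfl
      rw [splitSum] at ih ⊢
      rw [splitSum, hm]
      simp only [hl0, hl1, hl2, List.append_assoc, List.singleton_append, reduceCtorEq, if_false,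
        ne_eq, not_true_eq_false, false_and, zero_add, Nat.add_sub_cancel,
        Nat.succ_ne_zero, not_false_eq_true, true_and] at ih ⊢
      rw [ih]
      split_ifs
      · rw [sublistSum, add_comm]
      · rw [zero_add]

theorem sum_wordValue (W : List ℕ) (n : ℕ) : ∀ (φ : List ℕ → ℤ) (p v : List ℕ),
    ∑ u ∈ (finite_factorizations (n + 1) v).toFinset, wordValue ℓ ω W p n φ (List.ofFn u) =
      sublistSum (n + 1) φ (marks ℓ ω W p v) := by
  induction n with
  | zero =>
    intro φ p v
    have h : ∀ L, sublistSum 1 φ L = φ [] := by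
      intro L
      induction L with
      | nil => rfl
      | cons c L ih => rw [sublistSum, ih, sublistSum, add_zero]
    rw [sum_factorizations_one, h]
    rfl
  | succ n ih =>
    intro φ p v
    rw [sum_factorizations_succ, ← splitSum_marks]
    congr 1
    funext x y
    have hy : ∀ u ∈ (finite_factorizations (n + 1) y).toFinset, (List.ofFn u).flatten = y :=
      fun u hu => (Set.Finite.mem_toFinset (finite_factorizations (n + 1) y)).1 hu
    have hcons : ∀ u : Fin (n + 1) → List ℕ,
        List.ofFn (Fin.cons x u : Fin (n + 2) → List ℕ) = x :: List.ofFn u := fun u => by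
      rw [List.ofFn_succ]; simp
    rw [Finset.sum_congr rfl fun u hu => by rw [hcons, wordValue_cons, hy u hu]]
    split_ifs with h1 h2
    · rw [ih, h1, marks, sublistSum]
    · rw [ih]
    · exact Finset.sum_const_zero

end Marks

end NPolyreg

namespace NPolyreg

/-! ### Positional notation. -/

section Digits

/-- The digit of `x` in base `B` with weight `B ^ i`. -/
def digit (B i x : ℕ) : ℕ := x / B ^ i % B

/-- The number with `n` given digits in base `B`. -/
def fromDigits (B n : ℕ) (g : ℕ → ℕ) : ℕ := ∑ i ∈ Finset.range n, g i * B ^ i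

theorem fromDigits_succ (B n : ℕ) (g : ℕ → ℕ) :
    fromDigits B (n + 1) g = g 0 + B * fromDigits B n fun i => g (i + 1) := by
  rw [fromDigits, fromDigits, Finset.sum_range_succ', Finset.mul_sum, add_comm]
  congr 1
  · simp
  · exact Finset.sum_congr rfl fun i _ => by ring

theorem digit_succ (B i x : ℕ) : digit B (i + 1) x = digit B i (x / B) := by
  rw [digit, digit, Nat.div_div_eq_div_mul, pow_succ']

theorem digit_fromDigits {B : ℕ} (n : ℕ) : ∀ {g : ℕ → ℕ}, (∀ i < n, g i < B) → ∀ {i : ℕ}, i < n →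
    digit B i (fromDigits B n g) = g i := by
  induction n with
  | zero => intro g _ i hi; omega
  | succ n ih =>
    intro g hg i hi
    have h0 := hg 0 (Nat.succ_pos n)
    rw [fromDigits_succ]
    rcases i with _ | i
    · rw [digit, pow_zero, Nat.div_one, Nat.add_mul_mod_self_left, Nat.mod_eq_of_lt h0]
    · rw [digit_succ, Nat.add_mul_div_left _ _ (by omega), Nat.div_eq_of_lt h0, zero_add]
      exact ih (fun i hi => hg (i + 1) (by omega)) (by omega)

theorem fromDigits_lt {B : ℕ} (n : ℕ) : ∀ {g : ℕ → ℕ}, (∀ i < n, g i < B) →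
    fromDigits B n g < B ^ n := by
  induction n with
  | zero => intro g _; simp [fromDigits]
  | succ n ih =>
    intro g hg
    have h0 := hg 0 (Nat.succ_pos n)
    have h1 := ih (g := fun i => g (i + 1)) fun i hi => hg (i + 1) (by omega)
    rw [fromDigits_succ, pow_succ']
    have := Nat.mul_le_mul_left B h1
    rw [Nat.mul_succ] at this
    omega

theorem fromDigits_digit {B : ℕ} (n : ℕ) : ∀ {x : ℕ}, x < B ^ n →
    (fromDigits B n fun i => digit B i x) = x := by
  induction n with
  | zero => intro x hx; rw [pow_zero, Nat.lt_one_iff] at hx; simp [fromDigits, hx]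
  | succ n ih =>
    intro x hx
    rw [fromDigits_succ]
    simp only [digit_succ]
    rw [ih (x := x / B) (Nat.div_lt_of_lt_mul (by rwa [pow_succ'] at hx)), digit, pow_zero,
      Nat.div_one, Nat.mod_add_div]

theorem digit_lt {B : ℕ} (hB : 1 ≤ B) (i x : ℕ) : digit B i x < B := Nat.mod_lt _ hB

theorem fromDigits_congr {B n : ℕ} {g h : ℕ → ℕ} (hgh : ∀ i < n, g i = h i) :
    fromDigits B n g = fromDigits B n h :=
  Finset.sum_congr rfl fun i hi => by rw [hgh i (Finset.mem_range.1 hi)]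

end Digits

/-! ### A finite monoid of truncated letter counts and last letters. -/

section Codes

/-- The product of two codes: truncated addition of the first `k` digits, and the last nonzero
digit with weight `k`. -/
def mulCode (k ℓ ω x y : ℕ) : ℕ :=
  fromDigits (ℓ + ω) (k + 1) fun i =>
    if i < k then trunc ℓ ω (digit (ℓ + ω) i x + digit (ℓ + ω) i y)
    else if digit (ℓ + ω) i y = 0 then digit (ℓ + ω) i x else digit (ℓ + ω) i y

/-- The code of a word: its truncated letter counts and its last letter. -/
def codeWord (k ℓ ω : ℕ) (w : List ℕ) : ℕ :=
  fromDigits (ℓ + ω) (k + 1) fun i => if i < k then trunc ℓ ω (w.count i) else lastCode w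

/-- The product of a list of codes. -/
def prodCode (k ℓ ω : ℕ) (ms : List ℕ) : ℕ := ms.foldl (mulCode k ℓ ω) 0

/-- A word with the letter counts of a code. -/
def wordOfCode (B k a : ℕ) : List ℕ :=
  (List.range k).flatMap fun i => List.replicate (digit B i a) i

variable {k ℓ ω : ℕ}

theorem mulCode_digit_lt (hω : 1 ≤ ω) (x y i : ℕ) :
    (if i < k then trunc ℓ ω (digit (ℓ + ω) i x + digit (ℓ + ω) i y)
    else if digit (ℓ + ω) i y = 0 then digit (ℓ + ω) i x else digit (ℓ + ω) i y) < ℓ + ω := by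
  split_ifs
  · exact trunc_lt hω _
  · exact digit_lt (by omega) _ _
  · exact digit_lt (by omega) _ _

theorem mulCode_lt (hω : 1 ≤ ω) (x y : ℕ) : mulCode k ℓ ω x y < (ℓ + ω) ^ (k + 1) :=
  fromDigits_lt _ fun i _ => mulCode_digit_lt hω x y i

theorem digit_mulCode (hω : 1 ≤ ω) (x y : ℕ) {i : ℕ} (hi : i < k + 1) :
    digit (ℓ + ω) i (mulCode k ℓ ω x y) =
      if i < k then trunc ℓ ω (digit (ℓ + ω) i x + digit (ℓ + ω) i y)
      else if digit (ℓ + ω) i y = 0 then digit (ℓ + ω) i x else digit (ℓ + ω) i y :=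
  digit_fromDigits (k + 1) (fun i _ => mulCode_digit_lt hω x y i) hi

theorem mulCode_assoc (hω : 1 ≤ ω) (x y z : ℕ) :
    mulCode k ℓ ω (mulCode k ℓ ω x y) z = mulCode k ℓ ω x (mulCode k ℓ ω y z) := by
  refine fromDigits_congr fun i hi => ?_
  rw [digit_mulCode hω _ _ hi, digit_mulCode hω _ _ hi]
  split_ifs
  · rw [trunc_trunc_add, trunc_add_trunc, add_assoc]
  all_goals simp_all

theorem digit_zero_right (B i : ℕ) : digit B i 0 = 0 := by simp [digit]

theorem zero_mulCode (hω : 1 ≤ ω) {x : ℕ} (hx : x < (ℓ + ω) ^ (k + 1)) : mulCode k ℓ ω 0 x = x := by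
  rw [← fromDigits_digit (B := ℓ + ω) (k + 1) hx, mulCode]
  refine fromDigits_congr fun i hi => ?_
  rw [fromDigits_digit _ hx, digit_zero_right, zero_add,
    trunc_of_lt (digit_lt (by omega) _ _)]
  split_ifs <;> simp_all

theorem mulCode_zero (hω : 1 ≤ ω) {x : ℕ} (hx : x < (ℓ + ω) ^ (k + 1)) : mulCode k ℓ ω x 0 = x := by
  rw [← fromDigits_digit (B := ℓ + ω) (k + 1) hx, mulCode]
  refine fromDigits_congr fun i hi => ?_
  rw [fromDigits_digit _ hx, digit_zero_right, add_zero,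
    trunc_of_lt (digit_lt (by omega) _ _)]
  split_ifs <;> simp_all

variable (k ℓ ω) in
/-- The monoid of codes. -/
abbrev codeMonoid (hω : 1 ≤ ω) : Monoid (Fin ((ℓ + ω) ^ (k + 1))) where
  mul x y := ⟨mulCode k ℓ ω x y, mulCode_lt hω _ _⟩
  mul_assoc x y z := Fin.ext (mulCode_assoc hω _ _ _)
  one := ⟨0, Nat.pow_pos (by omega)⟩
  one_mul x := Fin.ext (zero_mulCode hω x.2)
  mul_one x := Fin.ext (mulCode_zero hω x.2)

theorem lastCode_le {w : List ℕ} (hw : ∀ a ∈ w, a < k) : lastCode w ≤ k := by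
  rcases w.eq_nil_or_concat with rfl | ⟨v, a, rfl⟩
  · simp [lastCode]
  · have := hw a (by simp)
    simpa [lastCode] using this

/-- The last letter is coded by a number up to `k`; the condition `k < ℓ + ω` lets it fit into one
digit. -/
theorem codeWord_digit_lt (hω : 1 ≤ ω) (hk : k < ℓ + ω) {w : List ℕ} (hw : ∀ a ∈ w, a < k) (i : ℕ) :
    (if i < k then trunc ℓ ω (w.count i) else lastCode w) < ℓ + ω := by
  split_ifs
  · exact trunc_lt hω _
  · exact (lastCode_le hw).trans_lt hk

theorem codeWord_lt (hω : 1 ≤ ω) (hk : k < ℓ + ω) {w : List ℕ} (hw : ∀ a ∈ w, a < k) :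
    codeWord k ℓ ω w < (ℓ + ω) ^ (k + 1) :=
  fromDigits_lt _ fun i _ => codeWord_digit_lt hω hk hw i

theorem digit_codeWord (hω : 1 ≤ ω) (hk : k < ℓ + ω) {w : List ℕ} (hw : ∀ a ∈ w, a < k) {i : ℕ}
    (hi : i < k + 1) : digit (ℓ + ω) i (codeWord k ℓ ω w) =
      if i < k then trunc ℓ ω (w.count i) else lastCode w :=
  digit_fromDigits (k + 1) (fun i _ => codeWord_digit_lt hω hk hw i) hi

theorem codeWord_nil : codeWord k ℓ ω [] = 0 := by
  have h : trunc ℓ ω 0 = 0 := by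
    rcases Nat.eq_zero_or_pos ℓ with rfl | hℓ <;> simp_all [trunc]
  simp [codeWord, fromDigits, lastCode, h]

theorem codeWord_append (hω : 1 ≤ ω) (hk : k < ℓ + ω) {u v : List ℕ} (hu : ∀ a ∈ u, a < k)
    (hv : ∀ a ∈ v, a < k) :
    codeWord k ℓ ω (u ++ v) = mulCode k ℓ ω (codeWord k ℓ ω u) (codeWord k ℓ ω v) := by
  refine fromDigits_congr fun i hi => ?_
  rw [digit_codeWord hω hk hu hi, digit_codeWord hω hk hv hi]
  split_ifs with h1 h2
  · rw [trunc_trunc_add, trunc_add_trunc, List.count_append]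
  · rw [lastCode_append, if_pos h2]
  · rw [lastCode_append, if_neg h2]

theorem codeWord_eq_zero_iff (hω : 1 ≤ ω) (hℓ : 1 ≤ ℓ) (hk : k < ℓ + ω) {w : List ℕ}
    (hw : ∀ a ∈ w, a < k) : codeWord k ℓ ω w = 0 ↔ w = [] := by
  constructor
  · intro h
    rcases w with _ | ⟨a, w⟩
    · rfl
    · have ha := hw a List.mem_cons_self
      have h1 := digit_codeWord hω hk hw (i := a) (by omega)
      rw [h, digit_zero_right, if_pos ha, eq_comm, trunc_eq_zero_iff hℓ] at h1
      simp at h1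
  · rintro rfl
    exact codeWord_nil

theorem prodCode_map_codeWord (hω : 1 ≤ ω) (hk : k < ℓ + ω) (us : List (List ℕ))
    (hus : ∀ u ∈ us, ∀ a ∈ u, a < k) :
    prodCode k ℓ ω (us.map (codeWord k ℓ ω)) = codeWord k ℓ ω us.flatten := by
  have h : ∀ p : List ℕ, (∀ a ∈ p, a < k) → (us.map (codeWord k ℓ ω)).foldl (mulCode k ℓ ω)
      (codeWord k ℓ ω p) = codeWord k ℓ ω (p ++ us.flatten) := by
    induction us with
    | nil => simp
    | cons u us ih =>
      intro p hp
      have hu := hus u List.mem_cons_self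
      rw [List.map_cons, List.foldl_cons, ← codeWord_append hω hk hp hu,
        ih (fun u hu => hus u (List.mem_cons_of_mem _ hu)), List.flatten_cons, List.append_assoc]
      intro a ha
      rcases List.mem_append.1 ha with ha | ha
      · exact hp a ha
      · exact hu a ha
  simpa [prodCode, codeWord_nil] using h [] (by simp)

theorem count_wordOfCode (B a : ℕ) {i : ℕ} (hi : i < k) :
    (wordOfCode B k a).count i = digit B i a := by
  have : ∀ n, ((List.range n).flatMap fun j => List.replicate (digit B j a) j).count i =
      if i < n then digit B i a else 0 := by
    intro n
    induction n with
    | zero => simp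
    | succ n ih =>
      rw [List.range_succ, List.flatMap_append, List.count_append, ih]
      simp only [List.flatMap_cons, List.flatMap_nil, List.append_nil, List.count_replicate]
      by_cases h : n = i
      · subst h; simp
      · have h' : (n == i) = false := by simpa using h
        have h'' : i < n ↔ i < n + 1 := by omega
        simp [h', h'']
  rw [wordOfCode, this, if_pos hi]

end Codes

/-! ### Mixed differences computed from values on words. -/

section LetterCounts

/-- The numbers of occurrences of the letters below `k`. -/
def letterCount (k : ℕ) (w : List ℕ) : Fin k → ℕ := fun i => w.count (i : ℕ)

theorem letterCount_map_val {k : ℕ} (w : List (Fin k)) :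
    letterCount k (w.map Fin.val) = parikh w :=
  funext fun i => List.count_map_of_injective w Fin.val Fin.val_injective i

theorem letterCount_append {k : ℕ} (u v : List ℕ) :
    letterCount k (u ++ v) = letterCount k u + letterCount k v := by
  funext i; simp [letterCount]

theorem letterCount_wordPow {k : ℕ} (u : List ℕ) (n : ℕ) :
    letterCount k (wordPow u n) = n • letterCount k u := by
  induction n with
  | zero => funext i; simp [letterCount, wordPow]
  | succ n ih =>
    rw [wordPow_add, letterCount_append, ih, add_smul, one_smul]
    simp [wordPow]

theorem exists_map_val_eq {k : ℕ} {w : List ℕ} (hw : ∀ a ∈ w, a < k) :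
    ∃ v : List (Fin k), v.map Fin.val = w :=
  ⟨w.attach.map fun a => ⟨a.1, hw a.1 a.2⟩, by simp [List.map_map, Function.comp_def]⟩

/-- The words that occur in a mixed difference, with their signs. -/
def signedWords (ω : ℕ) (zs : List (List ℕ)) (w : List ℕ) : List (ℤ × List ℕ) :=
  zs.foldl (fun L z => L.flatMap fun p => [(p.1, p.2 ++ wordPow z ω), (-p.1, p.2)]) [(1, w)]

/-- The mixed difference of a function on words. -/
def wordDiff (f : List ℕ → ℤ) (ω : ℕ) (zs : List (List ℕ)) (w : List ℕ) : ℤ :=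
  ((signedWords ω zs w).map fun p => p.1 * f p.2).sum

theorem wordDiff_eq {k : ℕ} {f : List ℕ → ℤ} {F : (Fin k → ℕ) → ℤ}
    (hf : ∀ w, f w = F (letterCount k w)) (ω : ℕ) (zs : List (List ℕ)) (w : List ℕ) :
    wordDiff f ω zs w = mixedDiff (zs.map fun z => ω • letterCount k z) F (letterCount k w) := by
  have h : ∀ L : List (ℤ × List ℕ), ((zs.foldl (fun L z => L.flatMap fun p =>
      [(p.1, p.2 ++ wordPow z ω), (-p.1, p.2)]) L).map fun p => p.1 * f p.2).sum =
      (L.map fun p => p.1 * mixedDiff (zs.map fun z => ω • letterCount k z) F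
        (letterCount k p.2)).sum := by
    induction zs with
    | nil => intro L; simp [hf]
    | cons z zs ih =>
      intro L
      rw [List.foldl_cons, ih]
      clear ih
      induction L with
      | nil => simp
      | cons p L ihL =>
        simp only [List.flatMap_cons, List.map_append, List.sum_append, ihL, List.map_cons,
          List.sum_cons, List.map_nil, List.sum_nil, mixedDiff_cons_apply, letterCount_append,
          letterCount_wordPow]
        ring
  rw [wordDiff, signedWords, h]
  simp

theorem wordDiff_map_val {k : ℕ} {f : List ℕ → ℤ} {F : (Fin k → ℕ) → ℤ}
    (hf : ∀ w, f w = F (letterCount k w)) (ω : ℕ) (zs : List (List (Fin k))) (w : List ℕ) :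
    wordDiff f ω (zs.map fun z => z.map Fin.val) w =
      mixedDiff (zs.map (wordStep ω)) F (letterCount k w) := by
  rw [wordDiff_eq hf, List.map_map]
  congr 1
  exact List.map_congr_left fun z _ => by
    rw [Function.comp_apply, letterCount_map_val, wordStep]

end LetterCounts

/-! ### Nonnegative differences give a presentation over `ℕ`. -/

section NaturalPresentation

/-- The contribution of the code with number `j` in the list `ms` to the list of letters that close
blocks. -/
def codeSlot (k ℓ ω : ℕ) (ms : List ℕ) (j : ℕ) (acc : Option (List ℕ)) : Option (List ℕ) :=
  if prodCode k ℓ ω (ms.drop (j + 1)) = 0 then acc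
  else if digit (ℓ + ω) k (ms.getD j 0) ≠ 0 ∧
      digit (ℓ + ω) (digit (ℓ + ω) k (ms.getD j 0) - 1) (prodCode k ℓ ω (ms.drop (j + 1))) ≠ 0 ∧
      digit (ℓ + ω) (digit (ℓ + ω) k (ms.getD j 0) - 1) (prodCode k ℓ ω (ms.take (j + 1))) =
        digit (ℓ + ω) (digit (ℓ + ω) k (ms.getD j 0) - 1) (prodCode k ℓ ω ms)
    then acc.map ((digit (ℓ + ω) k (ms.getD j 0) - 1) :: ·)
  else none

/-- The production function of the natural presentation. -/
def codeValue (f : List ℕ → ℤ) (k d ℓ ω : ℕ) (ms : List ℕ) : ℕ :=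
  ((List.range d).foldr (codeSlot k ℓ ω ms) (some [])).elim 0 fun is =>
    (wordDiff f ω (is.map fun i => [i]) (wordOfCode (ℓ + ω) k (prodCode k ℓ ω ms))).toNat

/-- The presentation of a function with nonnegative differences as an `ℕ`-polyregular function. -/
def naturalPresentation (f : List ℕ → ℤ) (k d ℓ ω : ℕ) : Presentation where
  size := (ℓ + ω) ^ (k + 1)
  one := 0
  mul := (List.range ((ℓ + ω) ^ (k + 1) * (ℓ + ω) ^ (k + 1))).map fun t =>
    mulCode k ℓ ω (t % (ℓ + ω) ^ (k + 1)) (t / (ℓ + ω) ^ (k + 1))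
  letter := (List.range k).map fun a => codeWord k ℓ ω [a]
  production := (List.range (((ℓ + ω) ^ (k + 1)) ^ (d + 1))).map fun t =>
    (codeValue f k d ℓ ω ((List.range (d + 1)).map fun j => digit ((ℓ + ω) ^ (k + 1)) j t) : ℤ)

variable {k d ℓ ω : ℕ}

/-- The slots ask only for the last letter of a factor, the truncated counts of a prefix and of the
whole word, and which letters occur in a suffix. All this is read off products of codes; since `ℓ ≥
1`, truncation detects absence. -/
theorem codeValue_eq_wordValue (hω : 1 ≤ ω) (hℓ : 1 ≤ ℓ) (hk : k < ℓ + ω) (f : List ℕ → ℤ)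
    (us : List (List ℕ)) (hlen : us.length = d + 1) (hus : ∀ u ∈ us, ∀ a ∈ u, a < k) :
    (codeValue f k d ℓ ω (us.map (codeWord k ℓ ω)) : ℤ) = wordValue ℓ ω us.flatten [] d
      (fun is => ((wordDiff f ω (is.map fun i => [i])
        (wordOfCode (ℓ + ω) k (codeWord k ℓ ω us.flatten))).toNat : ℤ)) us := by
  have hfold : (List.range d).foldr (codeSlot k ℓ ω (us.map (codeWord k ℓ ω))) (some []) =
      (List.range d).foldr (wordSlot ℓ ω us.flatten [] us) (some []) := by
    refine List.foldr_ext _ _ _ fun j hj acc => ?_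
    have hj' : j < us.length := by rw [List.mem_range] at hj; omega
    have hdrop : ∀ a ∈ (us.drop (j + 1)).flatten, a < k := fun a ha => by
      obtain ⟨u, hu, hau⟩ := List.mem_flatten.1 ha
      exact hus u (List.mem_of_mem_drop hu) a hau
    have htake : ∀ a ∈ (us.take (j + 1)).flatten, a < k := fun a ha => by
      obtain ⟨u, hu, hau⟩ := List.mem_flatten.1 ha
      exact hus u (List.mem_of_mem_take hu) a hau
    have hall : ∀ a ∈ us.flatten, a < k := fun a ha => by
      obtain ⟨u, hu, hau⟩ := List.mem_flatten.1 ha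
      exact hus u hu a hau
    have hmem : us.getD j [] ∈ us := by
      rw [List.getD_eq_getElem _ _ hj']
      exact List.getElem_mem hj'
    have hlast : digit (ℓ + ω) k ((us.map (codeWord k ℓ ω)).getD j 0) = lastCode (us.getD j []) := by
      rw [← codeWord_nil (k := k) (ℓ := ℓ) (ω := ω), List.getD_map,
        digit_codeWord hω hk (hus _ hmem) (Nat.lt_succ_self k), if_neg (lt_irrefl k)]
    have hle := lastCode_le (hus _ hmem)
    rw [codeSlot, wordSlot, hlast, ← List.map_drop, ← List.map_take,
      prodCode_map_codeWord hω hk _ fun u hu => hus u (List.mem_of_mem_drop hu),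
      prodCode_map_codeWord hω hk _ fun u hu => hus u (List.mem_of_mem_take hu),
      prodCode_map_codeWord hω hk _ hus]
    simp only [codeWord_eq_zero_iff hω hℓ hk hdrop, List.nil_append]
    congr 1
    by_cases h0 : lastCode (us.getD j []) = 0
    · rw [if_neg fun h => h.1 h0, if_neg fun h => h.1 h0]
    · have hi : lastCode (us.getD j []) - 1 < k := by omega
      rw [digit_codeWord hω hk hdrop (by omega), digit_codeWord hω hk htake (by omega),
        digit_codeWord hω hk hall (by omega), if_pos hi, if_pos hi, if_pos hi]
      simp only [IsMark, ne_eq, trunc_eq_zero_iff hℓ, List.count_eq_zero, not_not]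
      congr
  rw [codeValue, wordValue, hfold, prodCode_map_codeWord hω hk _ hus]
  cases (List.range d).foldr (wordSlot ℓ ω us.flatten [] us) (some []) <;> rfl

/-- The letter counts of a word are reached from the truncated ones by adding its blocks. -/
theorem letterCount_eq_add_marks (hω : 1 ≤ ω) (hℓ : 1 ≤ ℓ) (hk : k < ℓ + ω) {w : List ℕ}
    (hw : ∀ a ∈ w, a < k) :
    letterCount k w = letterCount k (wordOfCode (ℓ + ω) k (codeWord k ℓ ω w)) +
      ((marks ℓ ω w [] w).map fun i => ω • letterCount k [i]).sum := by
  have hsum : ∀ L : List ℕ, (L.map fun i => ω • letterCount k [i]).sum = ω • letterCount k L := by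
    intro L
    induction L with
    | nil => funext i; simp [letterCount]
    | cons c L ih =>
      rw [List.map_cons, List.sum_cons, ih, ← smul_add, ← letterCount_append]
      rfl
  funext i
  rw [hsum, Pi.add_apply, Pi.smul_apply, letterCount, letterCount, letterCount,
    count_wordOfCode _ _ i.2, digit_codeWord hω hk hw (by omega), if_pos i.2, smul_eq_mul,
    trunc_add_count_marks hω hℓ]

/-- The letter counts arise from the truncated ones by one step per mark. The Newton expansion over
the marks is the sum over factorizations by `sum_wordValue`. Marked letters have truncated count at
least `ℓ`, so differences along more than `d` of them vanish and the others are nonnegative; `toNat`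
is harmless. -/
theorem eq_sum_codeValue (hω : 1 ≤ ω) (hℓ : 1 ≤ ℓ) (hk : k < ℓ + ω) {f : List ℕ → ℤ}
    {F : (Fin k → ℕ) → ℤ} (hf : ∀ w, f w = F (letterCount k w)) (hd : HasDegreeLE ω ℓ d F)
    (hF : NonnegDiff ω ℓ F) {w : List ℕ} (hw : ∀ a ∈ w, a < k) :
    f w = ∑ u ∈ (finite_factorizations (d + 1) w).toFinset,
      (codeValue f k d ℓ ω (List.ofFn fun i => codeWord k ℓ ω (u i)) : ℤ) := by
  set a := letterCount k (wordOfCode (ℓ + ω) k (codeWord k ℓ ω w)) with ha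
  have hai : ∀ i : Fin k, a i = trunc ℓ ω (w.count (i : ℕ)) := fun i => by
    rw [ha, letterCount, count_wordOfCode _ _ i.2, digit_codeWord hω hk hw (by omega), if_pos i.2]
  have hsum : ∀ u ∈ (finite_factorizations (d + 1) w).toFinset,
      (codeValue f k d ℓ ω (List.ofFn fun i => codeWord k ℓ ω (u i)) : ℤ) =
        wordValue ℓ ω w [] d (fun is => ((wordDiff f ω (is.map fun i => [i])
          (wordOfCode (ℓ + ω) k (codeWord k ℓ ω w))).toNat : ℤ)) (List.ofFn u) := by
    intro u hu
    have hu' : (List.ofFn u).flatten = w :=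
      (Set.Finite.mem_toFinset (finite_factorizations (d + 1) w)).1 hu
    have h := codeValue_eq_wordValue hω hℓ hk f (d := d) (List.ofFn u) (by simp)
      fun v hv a ha => hw a (by
        rw [← hu']
        exact List.mem_flatten.2 ⟨v, hv, ha⟩)
    rw [hu', List.map_ofFn] at h
    exact h
  rw [Finset.sum_congr rfl hsum, sum_wordValue]
  have hmem : ∀ is ⊆ marks ℓ ω w [] w, ∃ js : List (Fin k), js.map Fin.val = is ∧
      ∀ j ∈ js, ℓ ≤ a j := by
    intro is his
    obtain ⟨js, hjs⟩ := exists_map_val_eq fun a ha => hw a (marks_subset w [] (his ha))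
    refine ⟨js, hjs, fun j hj => ?_⟩
    rw [hai]
    exact le_trunc_of_mem_marks w [] rfl (his (by rw [← hjs]; exact List.mem_map_of_mem hj))
  have hstep : ∀ js : List (Fin k), ((js.map Fin.val).map fun i => ω • letterCount k [i]) =
      js.map fun j => wordStep ω [j] := fun js => by
    rw [List.map_map]
    refine List.map_congr_left fun j _ => ?_
    rw [Function.comp_apply, wordStep, ← letterCount_map_val]
    rfl
  rw [hf, letterCount_eq_add_marks hω hℓ hk hw, eq_sublistSum_of_vanish
    (fun i => ω • letterCount k [i]) a _ (d + 1) F]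
  · have key : ∀ (n : ℕ) (φ ψ : List ℕ → ℤ) (L : List ℕ), (∀ is ⊆ L, φ is = ψ is) →
        sublistSum n φ L = sublistSum n ψ L := by
      intro n φ ψ L
      induction L generalizing n φ ψ with
      | nil =>
        intro h
        rcases n with _ | n
        · simp [sublistSum]
        · simpa [sublistSum] using h [] (List.Subset.refl _)
      | cons c L ih =>
        intro h
        rcases n with _ | n
        · simp [sublistSum]
        · rw [sublistSum, sublistSum, ih (n + 1) φ ψ fun is hi => h is
            (List.Subset.trans hi (List.subset_cons_self c L)), ih n (fun is => φ (c :: is))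
            (fun is => ψ (c :: is)) fun is hi => h _ (List.cons_subset_cons c hi)]
    refine key _ _ _ _ fun is his => ?_
    obtain ⟨js, rfl, hj⟩ := hmem is his
    have hcomp : (((js.map Fin.val).map fun i => [i]).map fun z => ω • letterCount k z) =
        (js.map Fin.val).map fun i => ω • letterCount k [i] := List.map_map ..
    rw [wordDiff_eq hf, hcomp, ← ha, hstep, Int.toNat_of_nonneg (hF a js (Nat.zero_le _) hj)]
  · intro is his hlen
    obtain ⟨js, rfl, hj⟩ := hmem is his
    rw [hstep]
    exact AddSubmonoid.mem_bot.1 (hd a js (by simpa using hlen) hj)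

theorem naturalPresentation_isNatural (f : List ℕ → ℤ) (k d ℓ ω : ℕ) :
    (naturalPresentation f k d ℓ ω).IsNatural := by
  intro z hz
  obtain ⟨t, _, rfl⟩ := List.mem_map.1 hz
  exact Nat.cast_nonneg _

/-- The monoid morphism that maps a word to its code. -/
def codeHom (hω : 1 ≤ ω) (hk : k < ℓ + ω) :
    letI := codeMonoid k ℓ ω hω
    FreeMonoid (Fin k) →* Fin ((ℓ + ω) ^ (k + 1)) :=
  letI := codeMonoid k ℓ ω hω
  { toFun := fun w => ⟨codeWord k ℓ ω (w.toList.map Fin.val), codeWord_lt hω hk (by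
      simp)⟩
    map_one' := Fin.ext codeWord_nil
    map_mul' := fun u v => Fin.ext (by
      change codeWord k ℓ ω ((u.toList ++ v.toList).map Fin.val) = _
      rw [List.map_append, codeWord_append hω hk (by simp) (by simp)]
      rfl) }

theorem eq_factorizationSum_codeHom (hω : 1 ≤ ω) (hℓ : 1 ≤ ℓ) (hk : k < ℓ + ω) {f : List ℕ → ℤ}
    {F : (Fin k → ℕ) → ℤ} (hf : ∀ w, f w = F (letterCount k w)) (hd : HasDegreeLE ω ℓ d F)
    (hF : NonnegDiff ω ℓ F) (w : List (Fin k)) :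
    letI := codeMonoid k ℓ ω hω
    f (w.map Fin.val) = factorizationSum (codeHom hω hk)
      (fun m : Fin (d + 1) → Fin ((ℓ + ω) ^ (k + 1)) =>
        (codeValue f k d ℓ ω (List.ofFn fun i => (m i : ℕ)) : ℤ)) w := by
  rw [eq_sum_codeValue hω hℓ hk hf hd hF (by simp), sum_factorizations_map]
  rfl

theorem mem_nPoly_of_nonnegDiff (hω : 1 ≤ ω) (hℓ : 1 ≤ ℓ) (hk : k < ℓ + ω) {f : List ℕ → ℤ}
    {F : (Fin k → ℕ) → ℤ} (hf : ∀ w, f w = F (letterCount k w)) (hd : HasDegreeLE ω ℓ d F)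
    (hF : NonnegDiff ω ℓ F) : (fun w : List (Fin k) => f (w.map Fin.val)) ∈ NPoly d :=
  ⟨Fin ((ℓ + ω) ^ (k + 1)), codeMonoid k ℓ ω hω, inferInstance, codeHom hω hk, _,
    eq_factorizationSum_codeHom hω hℓ hk hf hd hF⟩

theorem naturalPresentation_presents (hω : 1 ≤ ω) (hℓ : 1 ≤ ℓ) (hk : k < ℓ + ω) {f : List ℕ → ℤ}
    {F : (Fin k → ℕ) → ℤ} (hf : ∀ w, f w = F (letterCount k w)) (hd : HasDegreeLE ω ℓ d F)
    (hF : NonnegDiff ω ℓ F) :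
    (naturalPresentation f k d ℓ ω).Presents k d fun w => f (w.map Fin.val) := by
  set s := (ℓ + ω) ^ (k + 1) with hs
  refine ⟨Fin s, codeMonoid k ℓ ω hω, Equiv.refl _, codeHom hω hk, _, rfl, ?_, ?_, ?_,
    eq_factorizationSum_codeHom hω hℓ hk hf hd hF⟩
  · intro a b
    have ha := a.2
    have hb : (b : ℕ) + 1 ≤ s := b.2
    have hlt : (a : ℕ) + s * b < s * s := by
      have := Nat.mul_le_mul_left s hb
      rw [Nat.mul_succ] at this
      omega
    change ((List.range (s * s)).map fun t => mulCode k ℓ ω (t % s) (t / s))[(a : ℕ) + s * b]? = _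
    rw [List.getElem?_map, List.getElem?_range hlt, Option.map_some, Nat.add_mul_mod_self_left,
      Nat.mod_eq_of_lt ha, Nat.add_mul_div_left _ _ (by omega), Nat.div_eq_of_lt ha, zero_add]
    rfl
  · intro a
    change ((List.range k).map fun a => codeWord k ℓ ω [a])[(a : ℕ)]? = _
    rw [List.getElem?_map, List.getElem?_range a.2]
    rfl
  · intro m
    let g : ℕ → ℕ := fun j => if h : j < d + 1 then m ⟨j, h⟩ else 0
    have hg : ∀ j < d + 1, g j < s := fun j hj => by
      simp only [g, dif_pos hj]
      exact (m _).2
    have hsum : ∑ i, (Equiv.refl (Fin s) (m i) : ℕ) * s ^ (i : ℕ) = fromDigits s (d + 1) g := by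
      rw [fromDigits, ← Fin.sum_univ_eq_sum_range (fun i => g i * s ^ i)]
      exact Finset.sum_congr rfl fun i _ => by simp only [g, dif_pos i.2, Equiv.refl_apply]
    have hdig : (List.range (d + 1)).map (fun j => digit s j (fromDigits s (d + 1) g)) =
        List.ofFn fun i => (m i : ℕ) := by
      refine List.ext_getElem (by simp) fun j h1 h2 => ?_
      have hj : j < d + 1 := by simpa using h1
      simp only [List.getElem_map, List.getElem_range, List.getElem_ofFn]
      rw [digit_fromDigits _ hg hj]
      simp only [g, dif_pos hj]
    change ((List.range (s ^ (d + 1))).map fun t => (codeValue f k d ℓ ω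
      ((List.range (d + 1)).map fun j => digit s j t) : ℤ))[
        ∑ i, (Equiv.refl (Fin s) (m i) : ℕ) * s ^ (i : ℕ)]? = _
    rw [hsum, List.getElem?_map, List.getElem?_range (fromDigits_lt _ hg), Option.map_some, hdig]

end NaturalPresentation

end NPolyreg

namespace NPolyreg

/-! ### Closure properties of primitive recursive functions. -/

namespace PR

variable {α β γ σ : Type*} [Primcodable α] [Primcodable β] [Primcodable γ] [Primcodable σ]

section Basic

theorem fst {f : α → β × γ} (hf : Primrec f) : Primrec fun a => (f a).1 := Primrec.fst.comp hf

theorem snd {f : α → β × γ} (hf : Primrec f) : Primrec fun a => (f a).2 := Primrec.snd.comp hf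

theorem natRec {n : α → ℕ} {f : α → σ} {g : α → ℕ → σ → σ} (hn : Primrec n) (hf : Primrec f)
    (hg : Primrec fun p : α × ℕ × σ => g p.1 p.2.1 p.2.2) :
    Primrec fun a => Nat.rec (motive := fun _ => σ) (f a) (g a) (n a) :=
  Primrec.nat_rec' hn hf hg.to₂

theorem ite {c : α → Prop} [DecidablePred c] {f g : α → σ} (hc : PrimrecPred c) (hf : Primrec f)
    (hg : Primrec g) : Primrec fun a => if c a then f a else g a :=
  Primrec.ite hc hf hg

theorem eq [DecidableEq β] {f g : α → β} (hf : Primrec f) (hg : Primrec g) :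
    PrimrecPred fun a => f a = g a :=
  PrimrecRel.comp Primrec.eq hf hg

end Basic

section Nat

variable {f g : α → ℕ}

theorem add (hf : Primrec f) (hg : Primrec g) : Primrec fun a => f a + g a :=
  Primrec.nat_add.comp hf hg

theorem sub (hf : Primrec f) (hg : Primrec g) : Primrec fun a => f a - g a :=
  Primrec.nat_sub.comp hf hg

theorem mul (hf : Primrec f) (hg : Primrec g) : Primrec fun a => f a * g a :=
  Primrec.nat_mul.comp hf hg

theorem div (hf : Primrec f) (hg : Primrec g) : Primrec fun a => f a / g a :=
  Primrec.nat_div.comp hf hg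

theorem mod (hf : Primrec f) (hg : Primrec g) : Primrec fun a => f a % g a :=
  Primrec.nat_mod.comp hf hg

theorem pow (hf : Primrec f) (hg : Primrec g) : Primrec fun a => f a ^ g a :=
  (Primrec₂.unpaired'.1 Nat.Primrec.pow).comp hf hg

theorem le (hf : Primrec f) (hg : Primrec g) : PrimrecPred fun a => f a ≤ g a :=
  PrimrecRel.comp Primrec.nat_le hf hg

theorem lt (hf : Primrec f) (hg : Primrec g) : PrimrecPred fun a => f a < g a :=
  PrimrecRel.comp Primrec.nat_lt hf hg

theorem factorial (hf : Primrec f) : Primrec fun a => (f a).factorial := by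
  refine (natRec (g := fun _ n r => (n + 1) * r) hf (Primrec.const 1) (mul
    (add (fst (snd Primrec.id)) (Primrec.const 1)) (snd (snd Primrec.id)))).of_eq fun a => ?_
  induction f a with
  | zero => rfl
  | succ n ih => rw [Nat.factorial_succ, ← ih]

theorem sumRange {g : α → ℕ → ℕ} (hf : Primrec f) (hg : Primrec fun p : α × ℕ => g p.1 p.2) :
    Primrec fun a => ∑ i ∈ Finset.range (f a), g a i := by
  refine (natRec (g := fun a n r => r + g a n) hf (Primrec.const 0) (add
    (snd (snd Primrec.id)) (hg.comp ((fst Primrec.id).pair (fst (snd Primrec.id)))))).of_eq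
    fun a => ?_
  induction f a with
  | zero => rfl
  | succ n ih => rw [Finset.sum_range_succ, ← ih]

end Nat

section List

theorem append {f g : α → List β} (hf : Primrec f) (hg : Primrec g) :
    Primrec fun a => f a ++ g a :=
  Primrec.list_append.comp hf hg

theorem cons {f : α → β} {g : α → List β} (hf : Primrec f) (hg : Primrec g) :
    Primrec fun a => f a :: g a :=
  Primrec.list_cons.comp hf hg

theorem single {f : α → β} (hf : Primrec f) : Primrec fun a => [f a] :=
  cons hf (Primrec.const [])

theorem length {f : α → List β} (hf : Primrec f) : Primrec fun a => (f a).length :=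
  Primrec.list_length.comp hf

theorem range {f : α → ℕ} (hf : Primrec f) : Primrec fun a => List.range (f a) :=
  Primrec.list_range.comp hf

theorem map {f : α → List β} {g : α → β → γ} (hf : Primrec f)
    (hg : Primrec fun p : α × β => g p.1 p.2) : Primrec fun a => (f a).map (g a) :=
  Primrec.list_map hf hg.to₂

theorem flatMap {f : α → List β} {g : α → β → List γ} (hf : Primrec f)
    (hg : Primrec fun p : α × β => g p.1 p.2) : Primrec fun a => (f a).flatMap (g a) :=
  Primrec.list_flatMap hf hg.to₂

theorem flatten {f : α → List (List β)} (hf : Primrec f) : Primrec fun a => (f a).flatten :=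
  Primrec.list_flatten.comp hf

theorem foldl {f : α → List β} {g : α → σ} {h : α → σ → β → σ} (hf : Primrec f) (hg : Primrec g)
    (hh : Primrec fun p : α × σ × β => h p.1 p.2.1 p.2.2) :
    Primrec fun a => (f a).foldl (h a) (g a) :=
  Primrec.list_foldl hf hg hh.to₂

theorem foldr {f : α → List β} {g : α → σ} {h : α → β → σ → σ} (hf : Primrec f) (hg : Primrec g)
    (hh : Primrec fun p : α × β × σ => h p.1 p.2.1 p.2.2) :
    Primrec fun a => (f a).foldr (h a) (g a) :=
  Primrec.list_foldr hf hg hh.to₂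

theorem getD {f : α → List β} {n : α → ℕ} (d : β) (hf : Primrec f) (hn : Primrec n) :
    Primrec fun a => (f a).getD (n a) d :=
  (Primrec.list_getD d).comp hf hn

theorem take {f : α → List β} {n : α → ℕ} (hn : Primrec n) (hf : Primrec f) :
    Primrec fun a => (f a).take (n a) :=
  Primrec.list_take.comp hn hf

theorem drop {f : α → List β} {n : α → ℕ} (hn : Primrec n) (hf : Primrec f) :
    Primrec fun a => (f a).drop (n a) :=
  Primrec.list_drop.comp hn hf

theorem replicate {f : α → β} {n : α → ℕ} (hn : Primrec n) (hf : Primrec f) :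
    Primrec fun a => List.replicate (n a) (f a) :=
  (map (g := fun a _ => f a) (range hn) (hf.comp (fst Primrec.id))).of_eq fun a => by simp

theorem natSum {f : α → List ℕ} (hf : Primrec f) : Primrec fun a => (f a).sum :=
  foldr (h := fun _ x y => x + y) hf (Primrec.const 0)
    (add (fst (snd Primrec.id)) (snd (snd Primrec.id)))

theorem count {f : α → List ℕ} {n : α → ℕ} (hn : Primrec n) (hf : Primrec f) :
    Primrec fun a => (f a).count (n a) := by
  refine (natSum (map (g := fun a x => if x = n a then 1 else 0) hf (ite
    (eq (snd Primrec.id) (hn.comp (fst Primrec.id))) (Primrec.const 1) (Primrec.const 0)))).of_eq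
    fun a => ?_
  induction f a with
  | nil => rfl
  | cons x L ih => simp [List.count_cons, ih, add_comm]

theorem mem {f : α → List β} [DecidableEq β] {b : α → β} (hb : Primrec b) (hf : Primrec f) :
    PrimrecPred fun a => b a ∈ f a := by
  refine ((PrimrecRel.exists_mem_list (α := β) (β := β) Primrec.eq).comp hf hb).of_eq
    fun a => ?_
  simp

theorem forallMem {f : α → List β} {p : α → β → Prop} (hf : Primrec f)
    (hp : PrimrecPred fun q : α × β => p q.1 q.2) : PrimrecPred fun a => ∀ b ∈ f a, p a b :=
  (PrimrecRel.forall_mem_list (R := fun b a => p a b)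
    (hp.comp (Primrec.snd.pair Primrec.fst)).primrecRel).comp hf Primrec.id

theorem forallLt {f : α → ℕ} {p : α → ℕ → Prop} (hf : Primrec f)
    (hp : PrimrecPred fun q : α × ℕ => p q.1 q.2) : PrimrecPred fun a => ∀ b < f a, p a b :=
  (forallMem (range hf) hp).of_eq fun a => by simp

end List

section Int

/-- Integers are coded by parity, so integer arithmetic can be done on differences of natural
numbers. -/
theorem encode_natCast_sub (m n : ℕ) : Encodable.encode ((m : ℤ) - n) =
    if n ≤ m then 2 * (m - n) else 2 * (n - m - 1) + 1 := by
  have h : ∀ z : ℤ, Encodable.encode z = Equiv.intEquivNat z := fun z => rfl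
  split_ifs with hnm
  · obtain ⟨c, rfl⟩ := Nat.exists_eq_add_of_le hnm
    rw [show ((n + c : ℕ) : ℤ) - n = Int.ofNat c by push_cast; simp, h, Nat.add_sub_cancel_left]
    rfl
  · obtain ⟨c, rfl⟩ := Nat.exists_eq_add_of_lt (not_le.1 hnm)
    rw [show ((m : ℤ) - (m + c + 1 : ℕ)) = Int.negSucc c by
      rw [Int.negSucc_eq]; push_cast; ring, h, show m + c + 1 - m - 1 = c by omega]
    rfl

theorem natCastSub {f g : α → ℕ} (hf : Primrec f) (hg : Primrec g) :
    Primrec fun a => (f a : ℤ) - g a := by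
  rw [← Primrec.encode_iff]
  simp only [encode_natCast_sub]
  exact ite (le hg hf) (mul (Primrec.const 2) (sub hf hg))
    (add (mul (Primrec.const 2) (sub (sub hg hf) (Primrec.const 1))) (Primrec.const 1))

theorem natCast {f : α → ℕ} (hf : Primrec f) : Primrec fun a => (f a : ℤ) :=
  (natCastSub hf (Primrec.const 0)).of_eq fun a => by simp

theorem toNat_eq (z : ℤ) : z.toNat =
    if Encodable.encode z % 2 = 0 then Encodable.encode z / 2 else 0 := by
  rcases z with n | n
  · change n = if 2 * n % 2 = 0 then 2 * n / 2 else 0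
    rw [if_pos (by omega)]
    omega
  · change 0 = if (2 * n + 1) % 2 = 0 then (2 * n + 1) / 2 else 0
    rw [if_neg (by omega)]

theorem neg_toNat_eq (z : ℤ) : (-z).toNat =
    if Encodable.encode z % 2 = 0 then 0 else Encodable.encode z / 2 + 1 := by
  rcases z with n | n
  · change _ = if 2 * n % 2 = 0 then 0 else 2 * n / 2 + 1
    rw [if_pos (by omega)]
    simp
  · change _ = if (2 * n + 1) % 2 = 0 then 0 else (2 * n + 1) / 2 + 1
    rw [if_neg (by omega), Int.neg_negSucc]
    simp
    omega

variable {f g : α → ℤ}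

theorem toNat (hf : Primrec f) : Primrec fun a => (f a).toNat := by
  simp only [toNat_eq]
  have h := Primrec.encode_iff.2 hf
  exact ite (eq (mod h (Primrec.const 2)) (Primrec.const 0)) (div h (Primrec.const 2))
    (Primrec.const 0)

theorem negToNat (hf : Primrec f) : Primrec fun a => (-f a).toNat := by
  simp only [neg_toNat_eq]
  have h := Primrec.encode_iff.2 hf
  exact ite (eq (mod h (Primrec.const 2)) (Primrec.const 0)) (Primrec.const 0)
    (add (div h (Primrec.const 2)) (Primrec.const 1))

theorem intNeg (hf : Primrec f) : Primrec fun a => -f a :=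
  (natCastSub (negToNat hf) (toNat hf)).of_eq fun a => by omega

theorem intAdd (hf : Primrec f) (hg : Primrec g) : Primrec fun a => f a + g a :=
  (natCastSub (add (toNat hf) (toNat hg)) (add (negToNat hf) (negToNat hg))).of_eq fun a => by
    omega

theorem intMul (hf : Primrec f) (hg : Primrec g) : Primrec fun a => f a * g a := by
  refine (natCastSub
    (add (mul (toNat hf) (toNat hg)) (mul (negToNat hf) (negToNat hg)))
    (add (mul (toNat hf) (negToNat hg)) (mul (negToNat hf) (toNat hg)))).of_eq fun a => ?_
  have hfa : f a = ((f a).toNat : ℤ) - (-f a).toNat := by omega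
  have hga : g a = ((g a).toNat : ℤ) - (-g a).toNat := by omega
  conv_rhs => rw [hfa, hga]
  push_cast
  ring

theorem intLe (hf : Primrec f) (hg : Primrec g) : PrimrecPred fun a => f a ≤ g a := by
  refine (eq (toNat (intAdd hf (intNeg hg))) (Primrec.const 0)).of_eq fun a => ?_
  omega

theorem intLt (hf : Primrec f) (hg : Primrec g) : PrimrecPred fun a => f a < g a :=
  (intLe hg hf).not.of_eq fun _ => not_le

theorem intSum {f : α → List ℤ} (hf : Primrec f) : Primrec fun a => (f a).sum :=
  foldr (h := fun _ x y => x + y) hf (Primrec.const 0)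
    (intAdd (fst (snd Primrec.id)) (snd (snd Primrec.id)))

end Int

end PR

end NPolyreg

namespace NPolyreg

/-! ### Evaluation of presentations by list operations. -/

section Evaluation

/-- Splitting the last factor of every factorization in a list into two. -/
def splitStep (L : List (List (List ℕ) × List ℕ)) : List (List (List ℕ) × List ℕ) :=
  L.flatMap fun p => (List.range (p.2.length + 1)).map fun i => (p.1 ++ [p.2.take i], p.2.drop i)

/-- Cutting the last factor `n` times lists all factorizations into `n + 1` factors, so the
factorization sum becomes a computable list sum. -/
theorem sum_iterate_splitStep (φ : List (List ℕ) → ℤ) (n : ℕ) (L : List (List (List ℕ) × List ℕ)) :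
    ((splitStep^[n] L).map fun p => φ (p.1 ++ [p.2])).sum =
      (L.map fun p => ∑ u ∈ (finite_factorizations (n + 1) p.2).toFinset,
        φ (p.1 ++ List.ofFn u)).sum := by
  induction n generalizing L with
  | zero =>
    simp only [Function.iterate_zero, id_eq]
    congr 1
    refine List.map_congr_left fun p _ => ?_
    rw [sum_factorizations_one (fun u => φ (p.1 ++ List.ofFn u))]
    simp
  | succ n ih =>
    rw [Function.iterate_succ_apply, ih]
    induction L with
    | nil => simp [splitStep]
    | cons p L ihL =>
      have hcons : splitStep (p :: L) = ((List.range (p.2.length + 1)).map fun i =>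
        (p.1 ++ [p.2.take i], p.2.drop i)) ++ splitStep L := by simp [splitStep]
      rw [hcons, List.map_append, List.sum_append, ihL, List.map_cons, List.sum_cons,
        sum_factorizations_succ (n + 1) (fun u => φ (p.1 ++ List.ofFn u)), splitSum_eq_sum_range,
        List.map_map]
      congr 1
      rw [← List.sum_toFinset _ List.nodup_range, List.toFinset_range]
      refine Finset.sum_congr rfl fun i _ => Finset.sum_congr rfl fun u _ => ?_
      simp [List.ofFn_succ]

/-- The value of the morphism of a presentation. -/
def Presentation.evalWord (c : Presentation) (w : List ℕ) : ℕ :=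
  w.foldl (fun m a => c.mul.getD (m + c.size * c.letter.getD a 0) 0) c.one

/-- The value of the production function of a presentation. -/
def Presentation.evalProduction (c : Presentation) (ms : List ℕ) : ℤ :=
  c.production.getD (ms.foldr (fun m n => m + c.size * n) 0) 0

/-- The value of the function with a given presentation. -/
def Presentation.eval (c : Presentation) (d : ℕ) (w : List ℕ) : ℤ :=
  ((splitStep^[d] [([], w)]).map fun p =>
    c.evalProduction ((p.1 ++ [p.2]).map c.evalWord)).sum

theorem foldr_ofFn_eq_sum (s : ℕ) {n : ℕ} (g : Fin n → ℕ) :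
    (List.ofFn g).foldr (fun m n => m + s * n) 0 = ∑ i, g i * s ^ (i : ℕ) := by
  induction n with
  | zero => simp
  | succ n ih =>
    rw [List.ofFn_succ, List.foldr_cons, ih, Fin.sum_univ_succ, Finset.mul_sum]
    congr 1
    · simp
    · refine Finset.sum_congr rfl fun i _ => ?_
      rw [Fin.val_succ]
      ring

theorem Presentation.Presents.eval_eq {c : Presentation} {k d : ℕ} {f : List (Fin k) → ℤ}
    (h : c.Presents k d f) (w : List (Fin k)) : c.eval d (w.map Fin.val) = f w := by
  obtain ⟨M, _, e, μ, π, h1, hmul, hlet, hpi, hf⟩ := h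
  have hword : ∀ (v : List (Fin k)) (m : M), (v.map Fin.val).foldl
      (fun m a => c.mul.getD (m + c.size * c.letter.getD a 0) 0) (e m : ℕ) =
        (e (m * μ (FreeMonoid.ofList v)) : ℕ) := by
    intro v
    induction v with
    | nil => intro m; simp
    | cons a v ih =>
      intro m
      rw [List.map_cons, List.foldl_cons, FreeMonoid.ofList_cons, map_mul μ, ← mul_assoc, ← ih,
        List.getD_eq_getElem?_getD (l := c.letter), hlet, Option.getD_some,
        List.getD_eq_getElem?_getD, hmul, Option.getD_some]
  have heval : ∀ v : List (Fin k), c.evalWord (v.map Fin.val) =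
      (e (μ (FreeMonoid.ofList v)) : ℕ) := by
    intro v
    rw [Presentation.evalWord, h1, hword, one_mul]
  have hsum := sum_iterate_splitStep (fun us => c.evalProduction (us.map c.evalWord)) d
    [([], w.map Fin.val)]
  rw [Presentation.eval, hsum, List.map_singleton, List.sum_singleton, sum_factorizations_map, hf,
    factorizationSum]
  refine Finset.sum_congr rfl fun u _ => ?_
  rw [List.nil_append, Presentation.evalProduction, List.map_ofFn, foldr_ofFn_eq_sum,
    List.getD_eq_getElem?_getD]
  have : ∀ i, (c.evalWord ∘ fun i => (u i).map Fin.val) i =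
      (e (μ (FreeMonoid.ofList (u i))) : ℕ) := fun i => heval _
  simp only [this]
  rw [hpi fun i => μ (FreeMonoid.ofList (u i)), Option.getD_some]

/-- The word with sorted letters that has given numbers of occurrences of the letters. -/
def sortedWord (k : ℕ) (n : ℕ → ℕ) : List ℕ :=
  (List.range k).flatMap fun i => List.replicate (n i) i

theorem count_sortedWord {k : ℕ} (n : ℕ → ℕ) {i : ℕ} (hi : i < k) :
    (sortedWord k n).count i = n i := by
  rw [sortedWord, List.count_flatMap]
  simp only [Function.comp_def, List.count_replicate, beq_iff_eq]
  rw [← List.sum_toFinset _ List.nodup_range, List.toFinset_range, Finset.sum_ite_eq',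
    if_pos (Finset.mem_range.2 hi)]

theorem lt_of_mem_sortedWord {k : ℕ} {n : ℕ → ℕ} {i : ℕ} (hi : i ∈ sortedWord k n) : i < k := by
  obtain ⟨j, hj, hij⟩ := List.mem_flatMap.1 hi
  rw [List.eq_of_mem_replicate hij]
  exact List.mem_range.1 hj

/-- The symmetric function on words that agrees with a presented function on sorted words. -/
def symEval (I : ℕ × ℕ × Presentation) (w : List ℕ) : ℤ :=
  I.2.2.eval I.2.1 (sortedWord I.1 fun i => w.count i)

/-- The function on letter counts that belongs to `symEval`. -/
def symFun (I : ℕ × ℕ × Presentation) (n : Fin I.1 → ℕ) : ℤ :=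
  I.2.2.eval I.2.1 (sortedWord I.1 fun i => if h : i < I.1 then n ⟨i, h⟩ else 0)

/-- Evaluation on sorted words factors through letter counts for every input, even one that presents
nothing. The search for certificates can therefore be total. -/
theorem symEval_eq (I : ℕ × ℕ × Presentation) (w : List ℕ) :
    symEval I w = symFun I (letterCount I.1 w) := by
  rw [symEval, symFun]
  congr 1
  refine List.flatMap_congr fun i hi => ?_
  simp only [dif_pos (List.mem_range.1 hi)]
  rfl

theorem Presentation.Presents.symEval_map_val {c : Presentation} {k d : ℕ} {f : List (Fin k) → ℤ}
    (h : c.Presents k d f) (hf : IsCommutative f) (w : List (Fin k)) :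
    symEval (k, d, c) (w.map Fin.val) = f w := by
  obtain ⟨v, hv⟩ := exists_map_val_eq fun a ha =>
    lt_of_mem_sortedWord (n := fun i => (w.map Fin.val).count i) (k := k) ha
  rw [symEval, ← hv, h.eval_eq]
  refine hf _ _ (parikh_eq_iff_perm.1 ?_)
  rw [← letterCount_map_val, ← letterCount_map_val, hv]
  exact funext fun i => count_sortedWord _ i.2

theorem Presentation.Presents.eq_symFun {c : Presentation} {k d : ℕ} {f : List (Fin k) → ℤ}
    (h : c.Presents k d f) (hf : IsCommutative f) (w : List (Fin k)) :
    f w = symFun (k, d, c) (parikh w) := by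
  rw [← h.symEval_map_val hf, symEval_eq, letterCount_map_val]

end Evaluation

/-! ### Finite certificates for and against nonnegative differences. -/

section Certificates

/-- The lists over `0, …, k - 1` of length less than `n`. -/
def letterLists (k n : ℕ) : List (List ℕ) :=
  (fun L : List (List ℕ) => [] :: L.flatMap fun p => (List.range k).map fun i => i :: p)^[n] []

theorem mem_letterLists {k n : ℕ} {is : List ℕ} :
    is ∈ letterLists k n ↔ is.length < n ∧ ∀ i ∈ is, i < k := by
  induction n generalizing is with
  | zero => simp [letterLists]
  | succ n ih =>
    rw [letterLists, Function.iterate_succ_apply']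
    change is ∈ [] :: ((letterLists k n).flatMap fun p => (List.range k).map fun i => i :: p) ↔ _
    rcases is with _ | ⟨i, is⟩
    · simp
    · simp [ih]
      tauto

/-- The period that is used for a presented function. -/
def basePeriod (I : ℕ × ℕ × Presentation) : ℕ := I.2.2.size.factorial

/-- The threshold from which on a presented function has bounded degree. -/
def baseThreshold (I : ℕ × ℕ × Presentation) : ℕ := I.2.2.size * (I.2.1 + 1)

theorem one_le_basePeriod (I : ℕ × ℕ × Presentation) : 1 ≤ basePeriod I := Nat.factorial_pos _

/-- The finitely many conditions that make the differences of a presented function nonnegative from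
`ℓ` on. -/
def IsNonnegThreshold (I : ℕ × ℕ × Presentation) (ℓ : ℕ) : Prop :=
  baseThreshold I + I.1 + 1 ≤ ℓ ∧ ∀ x < (ℓ + basePeriod I) ^ I.1,
    ∀ is ∈ letterLists I.1 (I.2.1 + 1), (∀ i ∈ is, ℓ ≤ digit (ℓ + basePeriod I) i x) →
      0 ≤ wordDiff (symEval I) (basePeriod I) (is.map fun i => [i])
        (wordOfCode (ℓ + basePeriod I) I.1 x)

/-- The negative rays of presented functions. -/
def IsNegativeRayCertificate (I : ℕ × ℕ × Presentation) (w z is : List ℕ) : Prop :=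
  (∀ i ∈ z, i < I.1 ∧ baseThreshold I ≤ w.count i) ∧ (∀ i ∈ is, i ∈ z) ∧
    wordDiff (symEval I) (basePeriod I) (is.map fun i => [i]) w < 0 ∧
      ∀ j < I.2.1 + 1, wordDiff (symEval I) (basePeriod I)
        (List.replicate j z ++ is.map fun i => [i]) w ≤ 0

/-- The evidence against a bound on the degree of a presented function. -/
def IsDegreeCertificate (I : ℕ × ℕ × Presentation) (w is : List ℕ) : Prop :=
  is.length = I.2.1 + 1 ∧ (∀ i ∈ is, i < I.1 ∧ baseThreshold I ≤ w.count i) ∧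
    ¬wordDiff (symEval I) (basePeriod I) (is.map fun i => [i]) w = 0

variable {I : ℕ × ℕ × Presentation}

theorem wordDiff_symEval (zs : List (List (Fin I.1))) (w : List ℕ) :
    wordDiff (symEval I) (basePeriod I) (zs.map fun z => z.map Fin.val) w =
      mixedDiff (zs.map (wordStep (basePeriod I))) (symFun I) (letterCount I.1 w) :=
  wordDiff_map_val (symEval_eq I) _ _ _

theorem wordDiff_symEval_letters (is : List (Fin I.1)) (w : List ℕ) :
    wordDiff (symEval I) (basePeriod I) ((is.map Fin.val).map fun i => [i]) w =
      mixedDiff (is.map fun i => wordStep (basePeriod I) [i]) (symFun I) (letterCount I.1 w) := by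
  have h := wordDiff_symEval (I := I) (is.map fun i => [i]) w
  rw [List.map_map, List.map_map] at h
  rw [List.map_map]
  exact h

theorem exists_letterCount_eq {k : ℕ} (n : Fin k → ℕ) : ∃ w, letterCount k w = n :=
  ⟨_, funext fun i => (count_sortedWord (fun i => if h : i < k then n ⟨i, h⟩ else 0) i.2).trans
    (dif_pos i.2)⟩

theorem hasDegreeLE_symFun (h : ∀ w is, ¬IsDegreeCertificate I w is) :
    HasDegreeLE (basePeriod I) (baseThreshold I) I.2.1 (symFun I) := by
  refine hasDegreeLE_of_length_eq fun n is hlen his => ?_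
  obtain ⟨w, rfl⟩ := exists_letterCount_eq n
  by_contra hne
  refine h w (is.map Fin.val) ⟨by simpa using hlen, ?_, ?_⟩
  · intro i hi
    obtain ⟨j, hj, rfl⟩ := List.mem_map.1 hi
    exact ⟨j.2, his j hj⟩
  · rwa [wordDiff_symEval_letters]

/-- The numbers `x` in the condition run through the points of the box of `nonnegDiff_of_box`, coded
by their digits in base `ℓ + ω`. -/
theorem IsNonnegThreshold.nonnegDiff {ℓ : ℕ} (h : IsNonnegThreshold I ℓ)
    (hd : HasDegreeLE (basePeriod I) (baseThreshold I) I.2.1 (symFun I)) :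
    NonnegDiff (basePeriod I) ℓ (symFun I) := by
  refine nonnegDiff_of_box (one_le_basePeriod I) (hd.mono (by have := h.1; omega))
    fun n is hn hlen his => ?_
  let g : ℕ → ℕ := fun i => if h : i < I.1 then n ⟨i, h⟩ else 0
  have hg : ∀ i < I.1, g i < ℓ + basePeriod I := fun i hi => by
    simp only [g, dif_pos hi]
    exact hn _
  have hdig : ∀ i : Fin I.1, digit (ℓ + basePeriod I) i (fromDigits (ℓ + basePeriod I) I.1 g) =
      n i := fun i => by
    rw [digit_fromDigits _ hg i.2]
    exact dif_pos i.2
  have h1 := h.2 (fromDigits (ℓ + basePeriod I) I.1 g) (fromDigits_lt _ hg) (is.map Fin.val)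
    (mem_letterLists.2 ⟨by simp; omega, by simp⟩) fun i hi => by
      obtain ⟨j, hj, rfl⟩ := List.mem_map.1 hi
      rw [hdig]
      exact his j hj
  rw [wordDiff_symEval_letters] at h1
  convert h1 using 2
  exact funext fun i => ((count_wordOfCode _ _ i.2).trans (hdig i)).symm

theorem isNonnegThreshold_of_nonnegDiff {ℓ : ℕ} (hℓ : baseThreshold I + I.1 + 1 ≤ ℓ)
    (h : NonnegDiff (basePeriod I) ℓ (symFun I)) : IsNonnegThreshold I ℓ := by
  refine ⟨hℓ, fun x _ is his hi => ?_⟩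
  obtain ⟨js, rfl⟩ := exists_map_val_eq (mem_letterLists.1 his).2
  rw [wordDiff_symEval_letters]
  refine h _ _ (Nat.zero_le _) fun j hj => ?_
  rw [letterCount, count_wordOfCode _ _ j.2]
  exact hi _ (List.mem_map_of_mem hj)

theorem IsNegativeRayCertificate.exists_negativeRay {w z is : List ℕ}
    (h : IsNegativeRayCertificate I w z is) :
    ∃ n z is, NegativeRay (basePeriod I) (baseThreshold I) I.2.1 (symFun I) n z is := by
  obtain ⟨hz, his, hneg, hle⟩ := h
  obtain ⟨z, rfl⟩ := exists_map_val_eq fun i hi => (hz i hi).1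
  obtain ⟨is, rfl⟩ := exists_map_val_eq fun i hi => (hz i (his i hi)).1
  refine ⟨letterCount I.1 w, z, is, fun i hi => (hz _ (List.mem_map_of_mem hi)).2, fun i hi => ?_,
    ?_, fun j hj => ?_⟩
  · obtain ⟨i', hi', h⟩ := List.mem_map.1 (his _ (List.mem_map_of_mem hi))
    rwa [← Fin.val_injective h]
  · rwa [wordDiff_symEval_letters] at hneg
  · have h1 := hle j (by omega)
    rw [← wordDiff_symEval]
    convert h1 using 2
    simp [List.map_map, Function.comp_def]

theorem NegativeRay.isNegativeRayCertificate {w : List ℕ} {z is : List (Fin I.1)}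
    (h : NegativeRay (basePeriod I) (baseThreshold I) I.2.1 (symFun I) (letterCount I.1 w) z is) :
    IsNegativeRayCertificate I w (z.map Fin.val) (is.map Fin.val) := by
  obtain ⟨hz, his, hneg, hle⟩ := h
  refine ⟨?_, ?_, ?_, fun j hj => ?_⟩
  · intro i hi
    obtain ⟨j, hj, rfl⟩ := List.mem_map.1 hi
    exact ⟨j.2, hz j hj⟩
  · intro i hi
    obtain ⟨j, hj, rfl⟩ := List.mem_map.1 hi
    exact List.mem_map_of_mem (his j hj)
  · rwa [wordDiff_symEval_letters]
  · have h1 := hle j (by omega)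
    rw [← wordDiff_symEval] at h1
    convert h1 using 2
    simp [List.map_map, Function.comp_def]

/-- Either the degree bound fails visibly, or there is a negative ray, or `exists_nonnegDiff` yields
a threshold. Valid commutative inputs never need the first case; it makes the search halt on the
others. -/
theorem exists_certificate (I : ℕ × ℕ × Presentation) : ∃ (ℓ : ℕ) (w z is : List ℕ),
    IsNonnegThreshold I ℓ ∨ IsNegativeRayCertificate I w z is ∨ IsDegreeCertificate I w is := by
  by_cases hd : ∀ w is, ¬IsDegreeCertificate I w is
  · by_cases hr : ∀ n z is, ¬NegativeRay (basePeriod I) (baseThreshold I) I.2.1 (symFun I) n z is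
    · obtain ⟨ℓ, hℓ⟩ := exists_nonnegDiff (one_le_basePeriod I) (hasDegreeLE_symFun hd) hr
      exact ⟨max ℓ (baseThreshold I + I.1 + 1), [], [], [], Or.inl
        (isNonnegThreshold_of_nonnegDiff (le_max_right _ _) (hℓ.mono (le_max_left _ _)))⟩
    · push Not at hr
      obtain ⟨n, z, is, h⟩ := hr
      obtain ⟨w, rfl⟩ := exists_letterCount_eq n
      exact ⟨0, w, _, _, Or.inr (Or.inl h.isNegativeRayCertificate)⟩
  · push Not at hd
    obtain ⟨w, is, h⟩ := hd
    exact ⟨0, w, [], is, Or.inr (Or.inr h)⟩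

end Certificates

end NPolyreg

namespace NPolyreg

/-! ### Primitive recursiveness of the constructions and of certificate checking. -/

namespace PR

variable {α : Type*} [Primcodable α]

section Codes

variable {B i x y n k ℓ ω : α → ℕ}

theorem digit (hB : Primrec B) (hi : Primrec i) (hx : Primrec x) :
    Primrec fun a => digit (B a) (i a) (x a) :=
  mod (div hx (pow hB hi)) hB

theorem fromDigits {g : α → ℕ → ℕ} (hB : Primrec B) (hn : Primrec n)
    (hg : Primrec fun p : α × ℕ => g p.1 p.2) : Primrec fun a => fromDigits (B a) (n a) (g a) :=
  sumRange hn (mul hg (pow (hB.comp Primrec.fst) Primrec.snd))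

theorem trunc (hℓ : Primrec ℓ) (hω : Primrec ω) (hn : Primrec n) :
    Primrec fun a => trunc (ℓ a) (ω a) (n a) :=
  ite (lt hn hℓ) hn (add hℓ (mod (sub hn hℓ) hω))

theorem mulCode (hk : Primrec k) (hℓ : Primrec ℓ) (hω : Primrec ω) (hx : Primrec x)
    (hy : Primrec y) : Primrec fun a => mulCode (k a) (ℓ a) (ω a) (x a) (y a) := by
  have hB := add hℓ hω
  have hdx := digit (hB.comp Primrec.fst) Primrec.snd (hx.comp Primrec.fst)
  have hdy := digit (hB.comp Primrec.fst) Primrec.snd (hy.comp Primrec.fst)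
  exact fromDigits hB (add hk (Primrec.const 1)) (ite (lt Primrec.snd (hk.comp Primrec.fst))
    (trunc (hℓ.comp Primrec.fst) (hω.comp Primrec.fst) (add hdx hdy))
    (ite (eq hdy (Primrec.const 0)) hdx hdy))

theorem codeWord {w : α → List ℕ} (hk : Primrec k) (hℓ : Primrec ℓ) (hω : Primrec ω)
    (hw : Primrec w) : Primrec fun a => codeWord (k a) (ℓ a) (ω a) (w a) := by
  have hlast : Primrec fun a => lastCode (w a) := foldl (h := fun _ _ b => b + 1) hw
    (Primrec.const 0) (add (snd (snd Primrec.id)) (Primrec.const 1))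
  exact fromDigits (add hℓ hω) (add hk (Primrec.const 1))
    (ite (lt Primrec.snd (hk.comp Primrec.fst)) (trunc (hℓ.comp Primrec.fst)
      (hω.comp Primrec.fst) (count Primrec.snd (hw.comp Primrec.fst))) (hlast.comp Primrec.fst))

theorem prodCode {ms : α → List ℕ} (hk : Primrec k) (hℓ : Primrec ℓ) (hω : Primrec ω)
    (hms : Primrec ms) : Primrec fun a => prodCode (k a) (ℓ a) (ω a) (ms a) :=
  foldl hms (Primrec.const 0) (mulCode (hk.comp Primrec.fst) (hℓ.comp Primrec.fst)
    (hω.comp Primrec.fst) (fst Primrec.snd) (snd Primrec.snd))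

theorem sortedWord {g : α → ℕ → ℕ} (hk : Primrec k) (hg : Primrec fun p : α × ℕ => g p.1 p.2) :
    Primrec fun a => sortedWord (k a) (g a) :=
  flatMap (range hk) (replicate hg Primrec.snd)

theorem wordOfCode (hB : Primrec B) (hk : Primrec k) (hx : Primrec x) :
    Primrec fun a => wordOfCode (B a) (k a) (x a) :=
  flatMap (range hk) (replicate
    (digit (hB.comp Primrec.fst) Primrec.snd (hx.comp Primrec.fst)) Primrec.snd)

theorem wordPow {w : α → List ℕ} (hw : Primrec w) (hn : Primrec n) :
    Primrec fun a => wordPow (w a) (n a) :=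
  flatten (replicate hn hw)

theorem letters {is : α → List ℕ} (his : Primrec is) : Primrec fun a => (is a).map fun i => [i] :=
  map his (single Primrec.snd)

theorem wordDiff {f : α → List ℕ → ℤ} {zs : α → List (List ℕ)} {w : α → List ℕ}
    (hf : Primrec fun p : α × List ℕ => f p.1 p.2) (hω : Primrec ω) (hzs : Primrec zs)
    (hw : Primrec w) : Primrec fun a => wordDiff (f a) (ω a) (zs a) (w a) := by
  have hsigned : Primrec fun a => signedWords (ω a) (zs a) (w a) := by
    refine foldl hzs (single ((Primrec.const 1).pair hw)) (flatMap (fst Primrec.snd) ?_)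
    exact cons ((fst Primrec.snd).pair (append (snd Primrec.snd) (wordPow
      (snd (snd Primrec.fst)) (hω.comp (fst Primrec.fst)))))
      (single ((intNeg (fst Primrec.snd)).pair (snd Primrec.snd)))
  exact intSum (map hsigned (intMul (fst Primrec.snd)
    (hf.comp (Primrec.fst.pair (snd Primrec.snd)))))

theorem codeSlot {ms : α → List ℕ} {acc : α → Option (List ℕ)} (hk : Primrec k) (hℓ : Primrec ℓ)
    (hω : Primrec ω) (hms : Primrec ms) (hi : Primrec i) (hacc : Primrec acc) :
    Primrec fun a => codeSlot (k a) (ℓ a) (ω a) (ms a) (i a) (acc a) := by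
  have h1 := add hi (Primrec.const 1)
  have hy := prodCode hk hℓ hω (drop h1 hms)
  have hx := prodCode hk hℓ hω (take h1 hms)
  have ht := prodCode hk hℓ hω hms
  have hB := add hℓ hω
  have hl := digit hB hk (getD 0 hms hi)
  have hc := sub hl (Primrec.const 1)
  exact ite (eq hy (Primrec.const 0)) hacc (ite
    ((eq hl (Primrec.const 0)).not.and ((eq (digit hB hc hy) (Primrec.const 0)).not.and
      (eq (digit hB hc hx) (digit hB hc ht))))
    (Primrec.option_map hacc (cons (hc.comp Primrec.fst) Primrec.snd).to₂) (Primrec.const none))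

theorem codeValue {f : α → List ℕ → ℤ} {d : α → ℕ} {ms : α → List ℕ}
    (hf : Primrec fun p : α × List ℕ => f p.1 p.2) (hk : Primrec k) (hd : Primrec d)
    (hℓ : Primrec ℓ) (hω : Primrec ω) (hms : Primrec ms) :
    Primrec fun a => codeValue (f a) (k a) (d a) (ℓ a) (ω a) (ms a) := by
  have hfold : Primrec fun a => (List.range (d a)).foldr
      (NPolyreg.codeSlot (k a) (ℓ a) (ω a) (ms a)) (some []) :=
    foldr (range hd) (Primrec.const _) (codeSlot (hk.comp Primrec.fst) (hℓ.comp Primrec.fst)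
      (hω.comp Primrec.fst) (hms.comp Primrec.fst) (fst Primrec.snd) (snd Primrec.snd))
  have hf' : Primrec fun q : (α × List ℕ) × List ℕ => f q.1.1 q.2 :=
    hf.comp ((fst Primrec.fst).pair Primrec.snd)
  refine (Primrec.option_casesOn hfold (Primrec.const 0) (toNat (wordDiff
    (f := fun q : α × List ℕ => f q.1) hf' (hω.comp Primrec.fst) (letters Primrec.snd)
    (wordOfCode ((add hℓ hω).comp Primrec.fst) (hk.comp Primrec.fst)
      ((prodCode hk hℓ hω hms).comp Primrec.fst)))).to₂).of_eq fun a => ?_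
  rw [NPolyreg.codeValue]
  cases (List.range (d a)).foldr (NPolyreg.codeSlot (k a) (ℓ a) (ω a) (ms a)) (some []) <;> rfl

end Codes

section Presentations

theorem presentation_equivTuple : Primrec Presentation.equivTuple := Primrec.of_equiv

variable {c : α → Presentation}

theorem size (hc : Primrec c) : Primrec fun a => (c a).size :=
  fst (presentation_equivTuple.comp hc)

theorem one (hc : Primrec c) : Primrec fun a => (c a).one :=
  fst (snd (presentation_equivTuple.comp hc))

theorem mulTable (hc : Primrec c) : Primrec fun a => (c a).mul :=
  fst (snd (snd (presentation_equivTuple.comp hc)))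

theorem letter (hc : Primrec c) : Primrec fun a => (c a).letter :=
  fst (snd (snd (snd (presentation_equivTuple.comp hc))))

theorem production (hc : Primrec c) : Primrec fun a => (c a).production :=
  snd (snd (snd (snd (presentation_equivTuple.comp hc))))

theorem presentation_mk {size one : α → ℕ} {mul letter : α → List ℕ} {production : α → List ℤ}
    (hs : Primrec size) (ho : Primrec one) (hm : Primrec mul) (hl : Primrec letter)
    (hp : Primrec production) :
    Primrec fun a => Presentation.mk (size a) (one a) (mul a) (letter a) (production a) :=
  (Primrec.of_equiv_symm (e := Presentation.equivTuple)).comp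
    (hs.pair (ho.pair (hm.pair (hl.pair hp))))

theorem naturalPresentation {f : α → List ℕ → ℤ} {k d ℓ ω : α → ℕ}
    (hf : Primrec fun p : α × List ℕ => f p.1 p.2) (hk : Primrec k) (hd : Primrec d)
    (hℓ : Primrec ℓ) (hω : Primrec ω) :
    Primrec fun a => naturalPresentation (f a) (k a) (d a) (ℓ a) (ω a) := by
  have hs := pow (add hℓ hω) (add hk (Primrec.const 1))
  have hd1 := add hd (Primrec.const 1)
  refine presentation_mk hs (Primrec.const 0) (map (range (mul hs hs)) ?_) (map (range hk) ?_)
    (map (range (pow hs hd1)) ?_)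
  · exact mulCode (hk.comp Primrec.fst) (hℓ.comp Primrec.fst) (hω.comp Primrec.fst)
      (mod Primrec.snd (hs.comp Primrec.fst)) (div Primrec.snd (hs.comp Primrec.fst))
  · exact codeWord (hk.comp Primrec.fst) (hℓ.comp Primrec.fst) (hω.comp Primrec.fst)
      (single Primrec.snd)
  · exact natCast (codeValue (hf.comp ((fst Primrec.fst).pair Primrec.snd)) (hk.comp Primrec.fst)
      (hd.comp Primrec.fst) (hℓ.comp Primrec.fst) (hω.comp Primrec.fst)
      (map (range (hd1.comp Primrec.fst)) (digit (hs.comp (fst Primrec.fst)) Primrec.snd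
        (snd Primrec.fst))))

theorem evalWord {w : α → List ℕ} (hc : Primrec c) (hw : Primrec w) :
    Primrec fun a => (c a).evalWord (w a) :=
  foldl hw (one hc) (getD 0 (mulTable (hc.comp Primrec.fst)) (add (fst Primrec.snd)
    (mul (size (hc.comp Primrec.fst)) (getD 0 (letter (hc.comp Primrec.fst)) (snd Primrec.snd)))))

theorem evalProduction {ms : α → List ℕ} (hc : Primrec c) (hms : Primrec ms) :
    Primrec fun a => (c a).evalProduction (ms a) :=
  getD 0 (production hc) (foldr hms (Primrec.const 0) (add (fst Primrec.snd)
    (mul (size (hc.comp Primrec.fst)) (snd Primrec.snd))))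

theorem splitStep : Primrec splitStep :=
  flatMap Primrec.id (map (range (add (length (snd Primrec.snd)) (Primrec.const 1)))
    ((append (fst (snd Primrec.fst)) (single (take Primrec.snd (snd (snd Primrec.fst))))).pair
      (drop Primrec.snd (snd (snd Primrec.fst)))))

theorem eval {d : α → ℕ} {w : α → List ℕ} (hc : Primrec c) (hd : Primrec d) (hw : Primrec w) :
    Primrec fun a => (c a).eval (d a) (w a) := by
  have hsplit : Primrec fun a => NPolyreg.splitStep^[d a] [([], w a)] :=
    Primrec.nat_iterate hd (single ((Primrec.const []).pair hw)) (splitStep.comp Primrec.snd).to₂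
  exact intSum (map hsplit (evalProduction (hc.comp Primrec.fst)
    (map (append (fst Primrec.snd) (single (snd Primrec.snd)))
      (evalWord (hc.comp (fst Primrec.fst)) Primrec.snd))))

end Presentations

section Certificates

variable {I : α → ℕ × ℕ × Presentation} {w z is : α → List ℕ}

theorem symEval (hI : Primrec I) (hw : Primrec w) : Primrec fun a => symEval (I a) (w a) :=
  eval (snd (snd hI)) (fst (snd hI))
    (sortedWord (fst hI) (count Primrec.snd (hw.comp Primrec.fst)))

theorem symEval_fst (hI : Primrec I) :
    Primrec fun p : α × List ℕ => NPolyreg.symEval (I p.1) p.2 :=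
  symEval (hI.comp Primrec.fst) Primrec.snd

theorem basePeriod (hI : Primrec I) : Primrec fun a => basePeriod (I a) :=
  factorial (size (snd (snd hI)))

theorem baseThreshold (hI : Primrec I) : Primrec fun a => baseThreshold (I a) :=
  mul (size (snd (snd hI))) (add (fst (snd hI)) (Primrec.const 1))

theorem letterLists {k n : α → ℕ} (hk : Primrec k) (hn : Primrec n) :
    Primrec fun a => letterLists (k a) (n a) := by
  have h : Primrec fun q : α × List (List ℕ) =>
      [] :: q.2.flatMap fun p => (List.range (k q.1)).map fun i => i :: p :=
    cons (Primrec.const []) (flatMap Primrec.snd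
      (map (range (hk.comp (fst Primrec.fst))) (cons Primrec.snd (snd Primrec.fst))))
  exact Primrec.nat_iterate hn (Primrec.const []) h.to₂

theorem isNonnegThreshold {ℓ : α → ℕ} (hI : Primrec I) (hℓ : Primrec ℓ) :
    PrimrecPred fun a => IsNonnegThreshold (I a) (ℓ a) := by
  have hω := basePeriod hI
  have hB := add hℓ hω
  refine (le (add (add (baseThreshold hI) (fst hI)) (Primrec.const 1)) hℓ).and
    (forallLt (pow hB (fst hI)) (forallMem (letterLists (fst (hI.comp Primrec.fst))
      (add (fst (snd (hI.comp Primrec.fst))) (Primrec.const 1))) ?_))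
  have h1 : PrimrecPred fun q : (α × ℕ) × List ℕ =>
      ∀ i ∈ q.2, ℓ q.1.1 ≤ NPolyreg.digit (ℓ q.1.1 + NPolyreg.basePeriod (I q.1.1)) i q.1.2 :=
    forallMem Primrec.snd (le (hℓ.comp (fst (fst Primrec.fst)))
      (digit (hB.comp (fst (fst Primrec.fst))) Primrec.snd (snd (fst Primrec.fst))))
  have h2 : PrimrecPred fun q : (α × ℕ) × List ℕ => 0 ≤ NPolyreg.wordDiff
      (NPolyreg.symEval (I q.1.1)) (NPolyreg.basePeriod (I q.1.1)) (q.2.map fun i => [i])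
      (NPolyreg.wordOfCode (ℓ q.1.1 + NPolyreg.basePeriod (I q.1.1)) (I q.1.1).1 q.1.2) :=
    intLe (Primrec.const 0) (wordDiff (symEval_fst (hI.comp (fst Primrec.fst)))
      (hω.comp (fst Primrec.fst)) (letters Primrec.snd) (wordOfCode (hB.comp (fst Primrec.fst))
        (fst (hI.comp (fst Primrec.fst))) (snd Primrec.fst)))
  exact (h1.not.or h2).of_eq fun q => imp_iff_not_or.symm

theorem lettersBelow (hI : Primrec I) (hz : Primrec z) (hw : Primrec w) :
    PrimrecPred fun a => ∀ i ∈ z a, i < (I a).1 ∧ NPolyreg.baseThreshold (I a) ≤ (w a).count i :=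
  forallMem hz ((lt Primrec.snd (fst (hI.comp Primrec.fst))).and
    (le ((baseThreshold hI).comp Primrec.fst) (count Primrec.snd (hw.comp Primrec.fst))))

theorem isNegativeRayCertificate (hI : Primrec I) (hw : Primrec w) (hz : Primrec z)
    (his : Primrec is) : PrimrecPred fun a => IsNegativeRayCertificate (I a) (w a) (z a) (is a) :=
  (lettersBelow hI hz hw).and ((forallMem his (mem Primrec.snd (hz.comp Primrec.fst))).and
    ((intLt (wordDiff (symEval_fst hI) (basePeriod hI) (letters his) hw) (Primrec.const 0)).and
      (forallLt (add (fst (snd hI)) (Primrec.const 1)) (intLe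
        (wordDiff (symEval_fst (hI.comp Primrec.fst)) ((basePeriod hI).comp Primrec.fst)
          (append (replicate Primrec.snd (hz.comp Primrec.fst))
            ((letters his).comp Primrec.fst)) (hw.comp Primrec.fst)) (Primrec.const 0)))))

theorem isDegreeCertificate (hI : Primrec I) (hw : Primrec w) (his : Primrec is) :
    PrimrecPred fun a => IsDegreeCertificate (I a) (w a) (is a) :=
  (eq (length his) (add (fst (snd hI)) (Primrec.const 1))).and ((lettersBelow hI his hw).and
    (eq (wordDiff (symEval_fst hI) (basePeriod hI) (letters his) hw) (Primrec.const 0)).not)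

end Certificates

end PR

end NPolyreg

namespace NPolyreg

/-! ### The equivalence over `Fin k`. -/

section Equivalence

theorem IsCommutative.exists_eq_parikh {α : Type*} [Fintype α] [DecidableEq α] {f : List α → ℤ}
    (hf : IsCommutative f) : ∃ F : (α → ℕ) → ℤ, ∀ w, f w = F (parikh w) := by
  choose word hword using exists_parikh_eq (α := α)
  exact ⟨fun n => f (word n), fun w => hf _ _ (parikh_eq_iff_perm.1 (hword _).symm)⟩

theorem isCombinatorial_of_nonnegDiff {α : Type*} [DecidableEq α] {p ω ℓ d : ℕ} {f : List α → ℤ}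
    {F : (α → ℕ) → ℤ} (hf : ∀ w, f w = F (parikh w)) (hω : 1 ≤ ω) (hℓ : 1 ≤ ℓ)
    (hd : HasDegreeLE ω ℓ d F) (hF : NonnegDiff ω ℓ F) : IsCombinatorial p f :=
  ⟨ω * ℓ, Nat.mul_pos hω hℓ, fun q => ⟨_, isPumpingPolynomial_of_nonnegDiff hf hω hd hF q⟩⟩

theorem IsCommutative.isCombinatorial {α : Type*} [Fintype α] [DecidableEq α] {p d : ℕ}
    {f : List α → ℤ} (hf : IsCommutative f) (hN : f ∈ NPoly d) : IsCombinatorial p f := by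
  obtain ⟨F, hF⟩ := hf.exists_eq_parikh
  obtain ⟨M, _, _, μ, π, hπ⟩ := hN
  have h : ∀ w, factorizationSum μ (fun m => (π m : ℤ)) w = F (parikh w) := fun w => by
    rw [← hF, hπ]
  have hd := hasDegreeLE_of_commutative μ _ h
  have hn := nonnegDiff_of_commutative μ _ (fun m => Nat.cast_nonneg _) h
  exact isCombinatorial_of_nonnegDiff hF (Nat.factorial_pos _)
    (Nat.succ_pos (max (Nat.card M * (d + 1)) (Nat.card M * (d + 1) * (d + 1))))
    (hd.mono (by omega)) (hn.mono (by omega))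

theorem mem_nPoly_of_isCombinatorial {k d : ℕ} {f : List (Fin k) → ℤ} (hZ : f ∈ ZPoly d)
    (hf : IsCommutative f) (h : IsCombinatorial k f) : f ∈ NPoly d := by
  obtain ⟨F, hF⟩ := hf.exists_eq_parikh
  obtain ⟨M, _, _, μ, π, hπ⟩ := hZ
  have hd := hasDegreeLE_of_commutative μ π (F := F) fun w => by rw [← hF, hπ]
  obtain ⟨ℓ, hℓ⟩ := exists_nonnegDiff (Nat.factorial_pos _) hd (h.not_negativeRay hF hd)
  -- One threshold above both bounds; the summand `k + 1` makes it positive and leaves room for the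
  -- code of the last letter.
  have hmem := mem_nPoly_of_nonnegDiff (k := k) (d := d)
    (ℓ := max ℓ (Nat.card M * (d + 1) + k + 1)) (f := fun w => F (letterCount k w))
    (Nat.factorial_pos (Nat.card M))
    (by omega) (by omega) (fun _ => rfl) (hd.mono (by omega)) (hℓ.mono (by omega))
  simpa only [letterCount_map_val, ← hF] using hmem

end Equivalence

/-! ### Transfer to arbitrary finite alphabets. -/

section Renaming

variable {α β : Type*}

theorem IsCommutative.comp_map {f : List β → ℤ} (hf : IsCommutative f) (g : α → β) :
    IsCommutative fun w => f (w.map g) :=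
  fun _ _ h => hf _ _ (h.map g)

theorem comp_map_mem_zPoly {d : ℕ} {f : List β → ℤ} (hf : f ∈ ZPoly d) (g : α → β) :
    (fun w => f (w.map g)) ∈ ZPoly d := by
  obtain ⟨M, hM, hfin, μ, π, h⟩ := hf
  exact ⟨M, hM, hfin, _, π, fun w => (h _).trans (factorizationSum_map g μ π w)⟩

theorem comp_map_mem_nPoly {d : ℕ} {f : List β → ℤ} (hf : f ∈ NPoly d) (g : α → β) :
    (fun w => f (w.map g)) ∈ NPoly d := by
  obtain ⟨M, hM, hfin, μ, π, h⟩ := hf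
  exact ⟨M, hM, hfin, _, π, fun w => (h _).trans (factorizationSum_map g μ _ w)⟩

theorem IsCombinatorial.comp_map {p : ℕ} {f : List β → ℤ} (hf : IsCombinatorial p f) (g : α → β) :
    IsCombinatorial p fun w => f (w.map g) := by
  obtain ⟨ω, hω, h⟩ := hf
  refine ⟨ω, hω, fun q => ?_⟩
  obtain ⟨P, hP, hq⟩ := h ⟨q.head.map g, fun i => (q.block i).map g, fun i => (q.tail i).map g⟩
  refine ⟨P, hP, fun x hx => ?_⟩
  rw [← hq x hx]
  congr 2
  simp [PumpingPattern.word, List.map_flatten, List.map_ofFn, Function.comp_def]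

theorem isCombinatorial_iff_mem_nPoly [Fintype α] {k d : ℕ} (hk : Fintype.card α = k)
    {f : List α → ℤ} (hZ : f ∈ ZPoly d) (hf : IsCommutative f) :
    IsCombinatorial k f ↔ f ∈ NPoly d := by
  let e : α ≃ Fin k := Fintype.equivFinOfCardEq hk
  have hfe : (fun w : List α => f ((w.map e).map e.symm)) = f := by simp
  constructor
  · intro h
    have h1 := comp_map_mem_nPoly (mem_nPoly_of_isCombinatorial (comp_map_mem_zPoly hZ e.symm)
      (hf.comp_map e.symm) (h.comp_map e.symm)) e
    rwa [hfe] at h1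
  · intro h
    have h1 := ((hf.comp_map e.symm).isCombinatorial (p := k)
      (comp_map_mem_nPoly h e.symm)).comp_map e
    rwa [hfe] at h1

end Renaming

/-! ### The algorithms. -/

section Algorithms

/-- A certificate is a threshold, a word, and two lists of letters. -/
abbrev Certificate : Type := ℕ × List ℕ × List ℕ × List ℕ

/-- The certificates for the nonnegativity of the differences of a presented function, or against
it, or against the bound on its degree. -/
def IsCertificate (I : ℕ × ℕ × Presentation) (t : Certificate) : Prop :=
  IsNonnegThreshold I t.1 ∨ IsNegativeRayCertificate I t.2.1 t.2.2.1 t.2.2.2 ∨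
    IsDegreeCertificate I t.2.1 t.2.2.2

theorem exists_computable_certificate :
    ∃ cert : ℕ × ℕ × Presentation → Certificate, Computable cert ∧ ∀ I, IsCertificate I (cert I) := by
  classical
  -- The search runs through codes of certificates; the default only serves for numbers that code
  -- nothing.
  let dec : ℕ → Certificate := fun n => (Encodable.decode (α := Certificate) n).getD (0, [], [], [])
  have hdec : Primrec dec := Primrec.option_getD.comp Primrec.decode (Primrec.const _)
  have hpred : PrimrecPred fun p : (ℕ × ℕ × Presentation) × ℕ => IsCertificate p.1 (dec p.2) := by
    have hI : Primrec fun p : (ℕ × ℕ × Presentation) × ℕ => p.1 := Primrec.fst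
    have ht : Primrec fun p : (ℕ × ℕ × Presentation) × ℕ => dec p.2 := hdec.comp Primrec.snd
    exact (PR.isNonnegThreshold hI (PR.fst ht)).or ((PR.isNegativeRayCertificate hI
      (PR.fst (PR.snd ht)) (PR.fst (PR.snd (PR.snd ht))) (PR.snd (PR.snd (PR.snd ht)))).or
        (PR.isDegreeCertificate hI (PR.fst (PR.snd ht)) (PR.snd (PR.snd (PR.snd ht)))))
  have hex : ∀ I, ∃ n, IsCertificate I (dec n) := fun I => by
    obtain ⟨ℓ, w, z, is, h⟩ := exists_certificate I
    refine ⟨Encodable.encode ((ℓ, w, z, is) : Certificate), ?_⟩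
    simpa only [dec, Encodable.encodek, Option.getD_some, IsCertificate] using h
  exact ⟨fun I => dec (Nat.find (hex I)), hdec.to_comp.comp
    (Computable.find (P := fun I n => IsCertificate I (dec n)) hpred.computablePred hex),
    fun I => Nat.find_spec (hex I)⟩

variable {c : Presentation} {k d : ℕ} {f : List (Fin k) → ℤ}

theorem Presentation.Presents.mem_zPoly (h : c.Presents k d f) : f ∈ ZPoly d := by
  obtain ⟨M, hM, e, μ, π, -, -, -, -, hf⟩ := h
  exact ⟨M, hM, Finite.of_equiv _ e.symm, μ, π, hf⟩

theorem Presentation.Presents.hasDegreeLE (h : c.Presents k d f) (hf : IsCommutative f) :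
    HasDegreeLE (basePeriod (k, d, c)) (baseThreshold (k, d, c)) d (symFun (k, d, c)) := by
  have hF := h.eq_symFun hf
  obtain ⟨M, hM, e, μ, π, -, -, -, -, hsum⟩ := h
  have hfin : Finite M := Finite.of_equiv _ e.symm
  have hd := hasDegreeLE_of_commutative μ π (F := symFun (k, d, c)) fun w => by rw [← hF, hsum]
  rwa [Nat.card_congr e, Nat.card_fin] at hd

/-- For a combinatorial `f` the other two kinds of certificates are impossible: negative rays by
`IsCombinatorial.not_negativeRay`, degree failures by the bound on the degree. So checking the
threshold of any certificate decides the property. -/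
theorem Presentation.Presents.isNonnegThreshold_iff (h : c.Presents k d f) (hf : IsCommutative f)
    {t : Certificate} (ht : IsCertificate (k, d, c) t) :
    IsNonnegThreshold (k, d, c) t.1 ↔ IsCombinatorial k f := by
  have hd := h.hasDegreeLE hf
  have hF := h.eq_symFun hf
  constructor
  · intro hℓ
    have hle := hℓ.1
    exact isCombinatorial_of_nonnegDiff hF (one_le_basePeriod _) (by omega)
      (hd.mono (by omega)) (hℓ.nonnegDiff hd)
  · intro hcomb
    rcases ht with ht | ht | ht
    · exact ht
    · obtain ⟨n, z, is, hray⟩ := ht.exists_negativeRay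
      exact absurd hray (hcomb.not_negativeRay hF hd n z is)
    · obtain ⟨hlen, his, hne⟩ := ht
      obtain ⟨js, hjs⟩ := exists_map_val_eq fun i hi => (his i hi).1
      rw [← hjs] at hlen his hne
      rw [wordDiff_symEval_letters] at hne
      exact absurd (AddSubmonoid.mem_bot.1 (hd _ js (by simpa using hlen.ge)
        fun i hi => (his i (List.mem_map_of_mem hi)).2)) hne

/-- The pumping of a presented function along a pattern, as a list of summands. -/
def pumpingList (I : ℕ × ℕ × Presentation) (ℓ : ℕ) (q : List ℕ × List (List ℕ × List ℕ)) :
    List (ℕ × List (ℕ × ℕ)) :=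
  (List.range ((I.2.1 + 1) ^ I.1)).map fun t =>
    ((wordDiff (symEval I) (basePeriod I) ((List.range I.1).flatMap fun i =>
        List.replicate (digit (I.2.1 + 1) i t) (wordPow (q.2.getD i ([], [])).1 ℓ))
      (q.1 ++ q.2.flatMap fun p => wordPow p.1 (basePeriod I * ℓ) ++ p.2)).toNat,
      (List.range I.1).map fun i => (0, digit (I.2.1 + 1) i t))

theorem primrec_pumpingList {α : Type*} [Primcodable α] {I : α → ℕ × ℕ × Presentation} {ℓ : α → ℕ}
    {q : α → List ℕ × List (List ℕ × List ℕ)} (hI : Primrec I) (hℓ : Primrec ℓ) (hq : Primrec q) :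
    Primrec fun a => pumpingList (I a) (ℓ a) (q a) := by
  have hk := PR.fst hI
  have hd := PR.add (PR.fst (PR.snd hI)) (Primrec.const 1)
  have hω := PR.basePeriod hI
  have hbase : Primrec fun a => (q a).1 ++ (q a).2.flatMap fun r =>
      wordPow r.1 (basePeriod (I a) * ℓ a) ++ r.2 :=
    PR.append (PR.fst hq) (PR.flatMap (PR.snd hq) (PR.append (PR.wordPow (PR.fst Primrec.snd)
      ((PR.mul hω hℓ).comp Primrec.fst)) (PR.snd Primrec.snd)))
  have hzs : Primrec fun r : α × ℕ => (List.range (I r.1).1).flatMap fun i =>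
      List.replicate (digit ((I r.1).2.1 + 1) i r.2)
        (wordPow ((q r.1).2.getD i ([], [])).1 (ℓ r.1)) :=
    PR.flatMap (PR.range (hk.comp Primrec.fst)) (PR.replicate
      (PR.digit (hd.comp (PR.fst Primrec.fst)) Primrec.snd (PR.snd Primrec.fst))
      (PR.wordPow (PR.fst (PR.getD ([], []) ((PR.snd hq).comp (PR.fst Primrec.fst)) Primrec.snd))
        (hℓ.comp (PR.fst Primrec.fst))))
  have hcoeff := PR.toNat (PR.wordDiff (f := fun r : α × ℕ => symEval (I r.1))
    (PR.symEval_fst (hI.comp Primrec.fst)) (hω.comp Primrec.fst) hzs (hbase.comp Primrec.fst))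
  have hexp : Primrec fun r : α × ℕ => (List.range (I r.1).1).map fun i =>
      ((0 : ℕ), digit ((I r.1).2.1 + 1) i r.2) :=
    PR.map (PR.range (hk.comp Primrec.fst)) ((Primrec.const 0).pair
      (PR.digit (hd.comp (PR.fst Primrec.fst)) Primrec.snd (PR.snd Primrec.fst)))
  exact PR.map (PR.range (PR.pow hd hk)) (hcoeff.pair hexp)

section Computable

variable {ℓ : ℕ × ℕ × Presentation → ℕ}

theorem computable_decide [DecidablePred fun I => IsNonnegThreshold I (ℓ I)] (hℓ : Computable ℓ) :
    Computable fun I => decide (IsNonnegThreshold I (ℓ I)) := by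
  classical
  have h : Primrec fun p : (ℕ × ℕ × Presentation) × ℕ => decide (IsNonnegThreshold p.1 p.2) :=
    (PR.isNonnegThreshold Primrec.fst Primrec.snd).decide
  exact (h.to_comp.comp (Computable.id.pair hℓ)).of_eq fun I => decide_eq_decide.2 Iff.rfl

theorem primrec_naturalPresentation : Primrec fun p : (ℕ × ℕ × Presentation) × ℕ =>
    naturalPresentation (symEval p.1) p.1.1 p.1.2.1 p.2 (basePeriod p.1) := by
  have hI : Primrec fun p : (ℕ × ℕ × Presentation) × ℕ => p.1 := Primrec.fst
  exact PR.naturalPresentation (f := fun p : (ℕ × ℕ × Presentation) × ℕ => symEval p.1)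
    (PR.symEval_fst hI) (PR.fst hI) (PR.fst (PR.snd hI)) Primrec.snd (PR.basePeriod hI)

theorem computable_naturalPresentation (hℓ : Computable ℓ) : Computable fun I =>
    naturalPresentation (symEval I) I.1 I.2.1 (ℓ I) (basePeriod I) := by
  have h := Computable.comp primrec_naturalPresentation.to_comp (Computable.id.pair hℓ)
  exact h

theorem computable_period (hℓ : Computable ℓ) : Computable fun I => basePeriod I * ℓ I :=
  Primrec.nat_mul.to_comp.comp (PR.basePeriod Primrec.id).to_comp hℓ

theorem primrec_pumpingList_tuple :
    Primrec fun p : ((ℕ × ℕ × Presentation) × ℕ) × List ℕ × List (List ℕ × List ℕ) =>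
      pumpingList p.1.1 p.1.2 p.2 :=
  primrec_pumpingList (PR.fst Primrec.fst) (PR.snd Primrec.fst) Primrec.snd

theorem computable_pumpingList (hℓ : Computable ℓ) : Computable
    fun p : (ℕ × ℕ × Presentation) × List ℕ × List (List ℕ × List ℕ) =>
      pumpingList p.1 (ℓ p.1) p.2 := by
  have h := Computable.comp primrec_pumpingList_tuple.to_comp
    ((Computable.fst.pair (hℓ.comp Computable.fst)).pair Computable.snd)
  exact h

end Computable

theorem map_val_word {k p : ℕ} (q : PumpingPattern (Fin k) p) (x : ℕ) :
    (q.word fun _ => x).map Fin.val =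
      q.code.1 ++ q.code.2.flatMap fun r => wordPow r.1 x ++ r.2 := by
  simp [PumpingPattern.word, PumpingPattern.code, List.flatMap, List.map_flatten, List.map_ofFn,
    Function.comp_def, wordPow]

/-- The indices `t` code the tuples of exponents in base `d + 1`. -/
theorem polynomialOfList_pumpingList (ℓ : ℕ) (q : PumpingPattern (Fin k) k) :
    polynomialOfList k (pumpingList (k, d, c) ℓ q.code) =
      binomialSum (ι := Fin k → Fin (d + 1)) (fun s =>
        (pumpingCoeff (symFun (k, d, c)) (basePeriod (k, d, c)) ℓ q fun i => s i).toNat)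
        fun s i => s i := by
  rw [polynomialOfList, pumpingList, List.map_map, ← List.sum_toFinset _ List.nodup_range,
    List.toFinset_range, ← Fin.sum_univ_eq_sum_range, binomialSum,
    ← finFunctionFinEquiv.sum_comp]
  refine Finset.sum_congr rfl fun s _ => ?_
  have hdig : ∀ i : Fin k, digit (d + 1) i (finFunctionFinEquiv s) = s i := fun i => by
    rw [digit, ← finFunctionFinEquiv_symm_apply_val, Equiv.symm_apply_apply]
  have hzs : ((List.range k).flatMap fun i => List.replicate (digit (d + 1) i (finFunctionFinEquiv s))
      (wordPow (q.code.2.getD i ([], [])).1 ℓ)) = ((List.finRange k).flatMap fun i =>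
        List.replicate (s i) (List.replicate ℓ (q.block i)).flatten).map fun z => z.map Fin.val := by
    rw [List.map_flatMap, ← List.map_coe_finRange_eq_range, List.flatMap_map]
    refine List.flatMap_congr fun i _ => ?_
    rw [hdig, List.map_replicate]
    congr 1
    simp [wordPow, List.map_flatten, PumpingPattern.code, List.getD_eq_getElem?_getD]
  simp only [Function.comp_apply, hzs, ← map_val_word]
  congr 1
  · rw [pumpingCoeff, ← letterCount_map_val]
    congr 3
    exact wordDiff_symEval (I := (k, d, c)) _ _
  · refine Finset.prod_congr rfl fun j _ => ?_
    have : ((List.range k).map fun i => (0, digit (d + 1) i (finFunctionFinEquiv s))).getD j (0, 0) =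
        (0, (s j : ℕ)) := by
      rw [List.getD_eq_getElem?_getD, List.getElem?_map, List.getElem?_range j.2, Option.map_some,
        Option.getD_some, hdig]
    rw [this]

theorem Presentation.Presents.isPumpingPolynomial (h : c.Presents k d f) (hf : IsCommutative f)
    {ℓ : ℕ} (hℓ : IsNonnegThreshold (k, d, c) ℓ) (q : PumpingPattern (Fin k) k) :
    IsPumpingPolynomial f (basePeriod (k, d, c) * ℓ) q
      (polynomialOfList k (pumpingList (k, d, c) ℓ q.code)) := by
  have hd := h.hasDegreeLE hf
  have hle := hℓ.1
  rw [polynomialOfList_pumpingList]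
  exact isPumpingPolynomial_of_nonnegDiff (h.eq_symFun hf) (one_le_basePeriod _)
    (hd.mono (by omega)) (hℓ.nonnegDiff hd) q

theorem Presentation.Presents.naturalPresentation (h : c.Presents k d f) (hf : IsCommutative f)
    {ℓ : ℕ} (hℓ : IsNonnegThreshold (k, d, c) ℓ) :
    (naturalPresentation (symEval (k, d, c)) k d ℓ (basePeriod (k, d, c))).Presents k d f := by
  have hd := h.hasDegreeLE hf
  have hle := hℓ.1
  have h1 := naturalPresentation_presents (k := k) (d := d) (one_le_basePeriod _)
    (by omega) (by omega) (symEval_eq (k, d, c)) (hd.mono (by omega)) (hℓ.nonnegDiff hd)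
  simpa only [h.symEval_map_val hf] using h1

end Algorithms

end NPolyreg

theorem mainTheorem5 :
    -- the equivalence
    (∀ (α : Type*) [Fintype α] (k d : ℕ), Fintype.card α = k →
      ∀ f : List α → ℤ, f ∈ NPolyreg.ZPoly d → NPolyreg.IsCommutative f →
        (NPolyreg.IsCombinatorial k f ↔ f ∈ NPolyreg.NPoly d)) ∧
    -- both properties are decidable, uniformly in `k`, `d` and a presentation of `f`
    (∃ dec : ℕ × ℕ × NPolyreg.Presentation → Bool, Computable dec ∧
      ∀ (k d : ℕ) (c : NPolyreg.Presentation) (f : List (Fin k) → ℤ),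
        c.Presents k d f → NPolyreg.IsCommutative f →
          (dec (k, d, c) = true ↔ NPolyreg.IsCombinatorial k f) ∧
          (dec (k, d, c) = true ↔ f ∈ NPolyreg.NPoly d)) ∧
    -- if `f` is combinatorial, a presentation with a production function in `ℕ` is computable
    (∃ conv : ℕ × ℕ × NPolyreg.Presentation → NPolyreg.Presentation, Computable conv ∧
      ∀ (k d : ℕ) (c : NPolyreg.Presentation) (f : List (Fin k) → ℤ),
        c.Presents k d f → NPolyreg.IsCommutative f → NPolyreg.IsCombinatorial k f →
          (conv (k, d, c)).IsNatural ∧ (conv (k, d, c)).Presents k d f) ∧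
    -- if `f` is in `NPoly d`, a period and the polynomials of all patterns are computable
    (∃ (period : ℕ × ℕ × NPolyreg.Presentation → ℕ)
        (poly : (ℕ × ℕ × NPolyreg.Presentation) × (List ℕ × List (List ℕ × List ℕ)) →
          List (ℕ × List (ℕ × ℕ))),
      Computable period ∧ Computable poly ∧
      ∀ (k d : ℕ) (c : NPolyreg.Presentation) (f : List (Fin k) → ℤ),
        c.Presents k d f → NPolyreg.IsCommutative f → f ∈ NPolyreg.NPoly d →
          1 ≤ period (k, d, c) ∧
          ∀ q : NPolyreg.PumpingPattern (Fin k) k,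
            NPolyreg.IsPumpingPolynomial f (period (k, d, c)) q
              (NPolyreg.polynomialOfList k (poly ((k, d, c), q.code)))) := by
  classical
  -- All algorithms share this certificate: the decision checks its threshold, and the two
  -- conversions rely on it when it is valid.
  obtain ⟨cert, hcert, hspec⟩ := NPolyreg.exists_computable_certificate
  have hℓ : Computable fun I => (cert I).1 := Computable.fst.comp hcert
  have hiff : ∀ (k d : ℕ) (c : NPolyreg.Presentation) (f : List (Fin k) → ℤ),
      c.Presents k d f → NPolyreg.IsCommutative f →
        (NPolyreg.IsCombinatorial k f ↔ f ∈ NPolyreg.NPoly d) := fun k d c f h hf =>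
    NPolyreg.isCombinatorial_iff_mem_nPoly (Fintype.card_fin k) h.mem_zPoly hf
  refine ⟨fun α _ k d hk f hZ hf => NPolyreg.isCombinatorial_iff_mem_nPoly hk hZ hf,
    ⟨fun I => decide (NPolyreg.IsNonnegThreshold I (cert I).1), ?_, ?_⟩,
    ⟨fun I => NPolyreg.naturalPresentation (NPolyreg.symEval I) I.1 I.2.1 (cert I).1
      (NPolyreg.basePeriod I), ?_, ?_⟩,
    ⟨fun I => NPolyreg.basePeriod I * (cert I).1,
      fun p => NPolyreg.pumpingList p.1 (cert p.1).1 p.2, ?_, ?_, ?_⟩⟩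
  · exact NPolyreg.computable_decide hℓ
  · intro k d c f h hf
    have h1 := h.isNonnegThreshold_iff hf (hspec (k, d, c))
    rw [← hiff k d c f h hf, decide_eq_true_iff]
    exact ⟨h1, h1⟩
  · exact NPolyreg.computable_naturalPresentation hℓ
  · intro k d c f h hf hcomb
    exact ⟨NPolyreg.naturalPresentation_isNatural _ _ _ _ _, h.naturalPresentation hf
      ((h.isNonnegThreshold_iff hf (hspec (k, d, c))).2 hcomb)⟩
  · exact NPolyreg.computable_period hℓ
  · exact NPolyreg.computable_pumpingList (ℓ := fun I => (cert I).1) hℓ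
  · intro k d c f h hf hN
    have h1 := (h.isNonnegThreshold_iff hf (hspec (k, d, c))).2 ((hiff k d c f h hf).2 hN)
    refine ⟨Nat.mul_pos (NPolyreg.one_le_basePeriod _) ?_, h.isPumpingPolynomial hf h1⟩
    exact le_trans (Nat.le_add_left 1 _) h1.1
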